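/- Let $n\ge 1$ and let $\mathcal{K}(\mathbb{R}^n)$ be the space of convex bodies (nonempty compact convex subsets of $\mathbb{R}^n$) with the Hausdorff metric. A map $\varphi:\mathcal{K}(\mathbb{R}^n)\to\mathbb{C}$ is a valuation if $\varphi(K\cup L)+\varphi(K\cap L)=\varphi(K)+\varphi(L)$ whenever $K,L,K\cup L\in\mathcal{K}(\mathbb{R}^n)$; it is a polynomial valuation if, moreover, there is $d\in\mathbb{N}_0$ such that $x\mapsto\varphi(K+x)$ is a polynomial of degree at most $d$ on $\mathbb{R}^n$ for every $K$. A continuous polynomial valuation is uniquely a finite sum $\varphi=\sum_{r\ge 0}\varphi_r$ of continuous polynomial valuations $\varphi_r$ with $\varphi_r(tK)=t^r\varphi_r(K)$ for $t\ge0$. Let $\bar\varphi_r:\mathcal{K}(\mathbb{R}^n)^r\to\mathbb{C}$ be the polarization of $\varphi_r$, that is, the unique continuous symmetric map, Minkowski additive in each argument, with $\varphi_r(\sum_{i=1}^m\lambda_iK_i)=\sum_{r_1+\dots+r_m=r}\binom{r}{r_1,\dots,r_m}\lambda_1^{r_1}\cdots\lambda_m^{r_m}\bar\varphi_r(K_1[r_1],\dots,K_m[r_m])$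 for all $m$, all bodies $K_i$ and all $\lambda_i\ge0$. The Goodey--Weil distribution $\mathrm{GW}(\varphi_r)$ is the unique distribution on $(S^{n-1})^r$ with $\mathrm{GW}(\varphi_r)[h_{K_1}\otimes\dots\otimes h_{K_r}]=\bar\varphi_r(K_1,\dots,K_r)$ for all smooth convex bodies $K_1,\dots,K_r$ with strictly positive Gauss curvature, where $h_K(y)=\sup_{x\in K}\langle y,x\rangle$. The vertical support of $\varphi$ is $$\operatorname{v-supp}\varphi=\bigcup_{r\ge1}\{u\in S^{n-1}: (u,\dots,u)\in\operatorname{supp}\mathrm{GW}(\varphi_r)\}.$$ Finally, $\varphi$ is $GL(n,\mathbb{R})$-smooth if $g\mapsto g\cdot\varphi$, $(g\cdot\varphi)(K)=\varphi(g^{-1}K)$, is a smooth map from $GL(n,\mathbb{R})$ into the continuous polynomial valuations with the topology of uniform convergence on compact sets of convex bodies. Theorem. Let $\varphi:\mathcal{K}(\mathbb{R}^n)\to\mathbb{C}$ be a continuous polynomial valuation and let $(U_\alpha)_{\alpha\in\mathcal{A}}$ be an open cover of $S^{n-1}$. Then there exist an integer $M\ge1$ and continuous polynomial valuations $\varphi_1,\dots,\varphi_M:\mathcal{K}(\mathbb{R}^n)\to\mathbb{C}$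 with $$\varphi=\varphi_1+\dots+\varphi_M$$ such that for every $j$ there is an $\alpha\in\mathcal{A}$ with $\operatorname{v-supp}\varphi_j\subseteq U_\alpha$. If $\varphi$ is $GL(n,\mathbb{R})$-smooth, then $\varphi_1,\dots,\varphi_M$ can be chosen to be $GL(n,\mathbb{R})$-smooth as well. -/

import Mathlib

open scoped ContDiff Manifold RealInnerProductSpace Pointwise

noncomputable section

namespace ConvVal

/-! ### Convex bodies in Euclidean space -/

/-- Euclidean space `ℝⁿ`. -/
abbrev E (n : ℕ) : Type := EuclideanSpace ℝ (Fin n)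

/-- The space of convex bodies (nonempty, convex, compact sets) of `ℝⁿ`, a metric space under the
Hausdorff metric. -/
abbrev Body (n : ℕ) : Type := ConvexBody (E n)

/-- The unit sphere `S^{n-1}` of `ℝⁿ`. -/
abbrev Sph (n : ℕ) : Type := Metric.sphere (0 : E n) 1

variable {n : ℕ}

/-- The translate `K + x`. -/
def translate (K : Body n) (x : E n) : Body n where
  carrier := (fun y => y + x) '' (K : Set (E n))
  convex' := by
    have h := K.convex.translate x
    simpa [add_comm] using h
  isCompact' := K.isCompact.image (continuous_id.add continuous_const)
  nonempty' := K.nonempty.image _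

/-- The image `A K` of a convex body under a linear map. -/
def linImage (A : E n →L[ℝ] E n) (K : Body n) : Body n where
  carrier := A '' (K : Set (E n))
  convex' := K.convex.linear_image A.toLinearMap
  isCompact' := K.isCompact.image A.continuous
  nonempty' := K.nonempty.image _

theorem continuous_linImage (A : E n →L[ℝ] E n) : Continuous (linImage A) := by
  have key : LipschitzWith ‖A‖₊ (linImage A) := by
    refine LipschitzWith.of_dist_le_mul fun K L => ?_
    have hd : 0 ≤ dist K L := dist_nonneg
    refine Metric.hausdorffDist_le_of_mem_dist (by positivity) ?_ ?_
    · rintro _ ⟨x, hx, rfl⟩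
      obtain ⟨y, hy, hxy⟩ := L.isCompact.exists_infDist_eq_dist L.nonempty x
      refine ⟨A y, ⟨y, hy, rfl⟩, (A.lipschitz.dist_le_mul x y).trans ?_⟩
      gcongr
      rw [← hxy]
      exact Metric.infDist_le_hausdorffDist_of_mem hx ConvexBody.hausdorffEDist_ne_top
    · rintro _ ⟨x, hx, rfl⟩
      obtain ⟨y, hy, hxy⟩ := K.isCompact.exists_infDist_eq_dist K.nonempty x
      refine ⟨A y, ⟨y, hy, rfl⟩, (A.lipschitz.dist_le_mul x y).trans ?_⟩
      gcongr
      rw [← hxy, dist_comm]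
      exact Metric.infDist_le_hausdorffDist_of_mem hx ConvexBody.hausdorffEDist_ne_top
  exact key.continuous

/-- The support function `h_K(y) = sup_{x ∈ K} ⟨y, x⟩`. -/
def supportFun (K : Body n) (y : E n) : ℝ :=
  sSup ((fun x => ⟪y, x⟫) '' (K : Set (E n)))

/-! ### Continuous polynomial valuations -/

/-- `φ` is a valuation: `φ(K ∪ L) + φ(K ∩ L) = φ(K) + φ(L)` whenever `K`, `L`, `K ∪ L` are convex
bodies. If `K ∪ L` is a convex body, then `K ∩ L` is automatically one. -/
def IsValuation (φ : Body n → ℂ) : Prop :=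
  ∀ K L U I : Body n, (U : Set (E n)) = (K : Set (E n)) ∪ L → (I : Set (E n)) = (K : Set (E n)) ∩ L →
    φ U + φ I = φ K + φ L

/-- `φ` is a polynomial valuation of degree at most `d`: it is a valuation, and `x ↦ φ(K + x)` is
a polynomial of degree at most `d` for every convex body `K`. -/
def IsPolynomialValuationOfDegree (d : ℕ) (φ : Body n → ℂ) : Prop :=
  IsValuation φ ∧
    ∀ K : Body n, ∃ p : MvPolynomial (Fin n) ℂ, p.totalDegree ≤ d ∧
      ∀ x : E n, φ (translate K x) = MvPolynomial.eval (fun i => (x i : ℂ)) p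

/-- `φ` is a polynomial valuation (the degree bound does not depend on the body). -/
def IsPolynomialValuation (φ : Body n → ℂ) : Prop :=
  ∃ d : ℕ, IsPolynomialValuationOfDegree d φ

/-- `φ` is `r`-homogeneous: `φ(tK) = t^r φ(K)` for all real `t ≥ 0`. -/
def IsHomogeneous (r : ℕ) (φ : Body n → ℂ) : Prop :=
  ∀ (t : ℝ) (K : Body n), 0 ≤ t → φ (t • K) = (t : ℂ) ^ r * φ K

/-- `φ = ∑_{r = 0}^{d + n} ψ_r` is a decomposition of `φ` into continuous polynomial valuations
`ψ_r` of degree at most `d` that are homogeneous of degree `r` (`ψ_r = 0` for `r > d + n`). -/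
def IsHomogeneousDecomposition (φ : C(Body n, ℂ)) (d : ℕ) (ψ : ℕ → C(Body n, ℂ)) : Prop :=
  (∀ r, IsPolynomialValuationOfDegree d (ψ r) ∧ IsHomogeneous r (ψ r)) ∧
    (∀ r, d + n < r → ψ r = 0) ∧ φ = ∑ r ∈ Finset.range (d + n + 1), ψ r

open Classical in
/-- The `r`-homogeneous component of a continuous polynomial valuation `φ`. Every such `φ` has a
decomposition into homogeneous components, and the components are uniquely determined by `φ`.
(Functions without such a decomposition get the value `0`.) -/
def homComponent (φ : C(Body n, ℂ)) : ℕ → C(Body n, ℂ) :=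
  if h : ∃ ψ : ℕ → C(Body n, ℂ), ∃ d, IsHomogeneousDecomposition φ d ψ then h.choose else 0

/-- `B` is the polarization of the `r`-homogeneous functional `φ`: it is continuous, symmetric,
Minkowski additive in each argument, and `φ(λ₁K₁ + ⋯ + λₘKₘ)` is the expansion of
`B(∑ λᵢKᵢ, …, ∑ λᵢKᵢ)`. The sum over all maps `f : {1, …, r} → {1, …, m}` is the multinomial sum
over `(r₁, …, rₘ)`: the number of maps with fibres of cardinality `r₁, …, rₘ` is the multinomial
coefficient. -/
structure IsPolarization {r : ℕ} (φ : Body n → ℂ) (B : (Fin r → Body n) → ℂ) : Prop where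
  continuous : Continuous B
  symmetric : ∀ (σ : Equiv.Perm (Fin r)) (K : Fin r → Body n), B (K ∘ σ) = B K
  additive : ∀ (i : Fin r) (K : Fin r → Body n) (L M : Body n),
    B (Function.update K i (L + M)) = B (Function.update K i L) + B (Function.update K i M)
  expansion : ∀ (m : ℕ) (K : Fin m → Body n) (l : Fin m → ℝ), (∀ i, 0 ≤ l i) →
    φ (∑ i, l i • K i) = ∑ f : Fin r → Fin m, (∏ j, (l (f j) : ℂ)) * B (fun j => K (f j))

/-! ### Distributions on `(S^{n-1})^r` -/

open Classical in
/-- The extension of `F : (S^{n-1})^r → ℂ` to `(ℝⁿ ∖ {0})^r` that is homogeneous of degree `0` in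
each of the `r` variables (with the value `0` outside `(ℝⁿ ∖ {0})^r`). -/
def ext0 {r : ℕ} (F : (Fin r → Sph n) → ℂ) (x : Fin r → E n) : ℂ :=
  if h : ∀ i, x i ≠ 0 then
    F fun i => ⟨‖x i‖⁻¹ • x i, by
      rw [mem_sphere_zero_iff_norm, norm_smul, norm_inv, norm_norm,
        inv_mul_cancel₀ (norm_ne_zero_iff.2 (h i))]⟩
  else 0

/-- The open subset `(ℝⁿ ∖ {0})^r` of `(ℝⁿ)^r`. -/
def punctured (n r : ℕ) : Set (Fin r → E n) := {x | ∀ i, x i ≠ 0}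

/-- `C^∞((S^{n-1})^r)`: the complex-valued functions on `(S^{n-1})^r` whose `0`-homogeneous extension
is smooth on `(ℝⁿ ∖ {0})^r`. -/
def SmoothFun (n r : ℕ) : Submodule ℂ ((Fin r → Sph n) → ℂ) where
  carrier := {F | ContDiffOn ℝ ∞ (ext0 F) (punctured n r)}
  zero_mem' := by
    have h : ext0 (0 : (Fin r → Sph n) → ℂ) = 0 := by
      funext x
      simp [ext0]
    change ContDiffOn ℝ ∞ (ext0 (0 : (Fin r → Sph n) → ℂ)) _
    rw [h]
    exact contDiffOn_const
  add_mem' := by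
    intro F G hF hG
    have h : ext0 (F + G) = ext0 F + ext0 G := by
      funext x
      by_cases hx : ∀ i, x i ≠ 0 <;> simp [ext0, hx]
    change ContDiffOn ℝ ∞ (ext0 (F + G)) _
    rw [h]
    exact ContDiffOn.add hF hG
  smul_mem' := by
    intro c F hF
    have h : ext0 (c • F) = fun x => c • ext0 F x := by
      funext x
      by_cases hx : ∀ i, x i ≠ 0 <;> simp [ext0, hx]
    change ContDiffOn ℝ ∞ (ext0 (c • F)) _
    rw [h]
    exact ContDiffOn.const_smul c hF

instance (n r : ℕ) : FunLike (SmoothFun n r) (Fin r → Sph n) ℂ where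
  coe F := F.1
  coe_injective _ _ h := Subtype.ext h

/-- A distribution on `(S^{n-1})^r`: a linear functional on `C^∞((S^{n-1})^r)` that is continuous
for the `C^∞`-topology, i.e. bounded by a multiple of some `C^k`-norm. -/
structure SphereDistribution (n r : ℕ) where
  /-- the underlying linear functional -/
  toLin : SmoothFun n r →ₗ[ℂ] ℂ
  bound : ∃ (k : ℕ) (C : ℝ), ∀ (F : SmoothFun n r) (M : ℝ), 0 ≤ M →
    (∀ m ≤ k, ∀ p : Fin r → Sph n, ‖iteratedFDeriv ℝ m (ext0 F) (fun i => (p i : E n))‖ ≤ M) →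
      ‖toLin F‖ ≤ C * M

instance (n r : ℕ) : Zero (SphereDistribution n r) :=
  ⟨0, 0, 0, fun F M _ _ => by simp⟩

/-- The support of a distribution on `(S^{n-1})^r`: the smallest closed set such that the
distribution vanishes on all test functions supported in its complement. -/
def SphereDistribution.support {r : ℕ} (T : SphereDistribution n r) : Set (Fin r → Sph n) :=
  Distribution.dsupport (fun F : SmoothFun n r => T.toLin F)

/-! ### Goodey–Weil distributions and the vertical support -/

/-- `K` is a smooth convex body with strictly positive Gauss curvature, expressed through its support
function: `h_K` is smooth on `ℝⁿ ∖ {0}`, and its Hessian at `u ∈ S^{n-1}` restricted to `u^⊥` (the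
differential of the inverse Gauss map, whose eigenvalues are the principal radii of curvature) is
positive definite. -/
def IsSmoothPositivelyCurved (K : Body n) : Prop :=
  ContDiffOn ℝ ∞ (supportFun K) {x | x ≠ 0} ∧
    ∀ u v : E n, ‖u‖ = 1 → ⟪u, v⟫ = 0 → v ≠ 0 →
      0 < iteratedFDeriv ℝ 2 (supportFun K) u ![v, v]

/-- The function `h_{K₁} ⊗ ⋯ ⊗ h_{K_r}` on `(S^{n-1})^r`, for bodies `Kᵢ` that are smooth with strictly
positive Gauss curvature, as an element of `C^∞((S^{n-1})^r)`. -/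
def tensorSupport {r : ℕ} (K : Fin r → Body n) (hK : ∀ i, IsSmoothPositivelyCurved (K i)) :
    SmoothFun n r :=
  ⟨fun p => ∏ i, ((supportFun (K i) (p i : E n) : ℝ) : ℂ), by
    have h : ContDiffOn ℝ ∞
        (fun x : Fin r → E n => ∏ i, ((supportFun (K i) (‖x i‖⁻¹ • x i) : ℝ) : ℂ))
        (punctured n r) := by
      refine contDiffOn_prod fun i _ => ?_
      refine Complex.ofRealCLM.contDiff.comp_contDiffOn ?_
      refine (hK i).1.comp (t := {x | x ≠ 0}) ?_ ?_
      · have hi : ContDiffOn ℝ ∞ (fun x : Fin r → E n => x i) (punctured n r) :=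
          (contDiff_apply ℝ (E n) i).contDiffOn
        exact ((hi.norm ℝ fun x hx => hx i).inv fun x hx => norm_ne_zero_iff.2 (hx i)).smul hi
      · intro x hx
        exact smul_ne_zero (inv_ne_zero (norm_ne_zero_iff.2 (hx i))) (hx i)
    refine h.congr fun x hx => ?_
    have hx' : ∀ i, x i ≠ 0 := hx
    simp [ext0, hx']⟩

/-- `T` is the Goodey–Weil distribution of the `r`-homogeneous functional `φ`:
`T[h_{K₁} ⊗ ⋯ ⊗ h_{K_r}] = φ̄(K₁, …, K_r)` for all smooth convex bodies `K₁, …, K_r` with strictly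
positive Gauss curvature, where `φ̄` is the polarization of `φ`. -/
def IsGoodeyWeil {r : ℕ} (φ : Body n → ℂ) (T : SphereDistribution n r) : Prop :=
  ∃ B : (Fin r → Body n) → ℂ, IsPolarization φ B ∧
    ∀ (K : Fin r → Body n) (hK : ∀ i, IsSmoothPositivelyCurved (K i)),
      T.toLin (tensorSupport K hK) = B K

open Classical in
/-- The Goodey–Weil distribution `GW(φ)` of an `r`-homogeneous continuous polynomial valuation, which
exists and is unique for every such valuation. (Other functionals for which no such distribution
exists get the value `0`.) -/
def goodeyWeil (r : ℕ) (φ : Body n → ℂ) : SphereDistribution n r :=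
  if h : ∃ T : SphereDistribution n r, IsGoodeyWeil φ T then h.choose else 0

/-- The vertical support of an `r`-homogeneous valuation: the preimage of the support of `GW(φ)` under
the diagonal embedding `S^{n-1} → (S^{n-1})^r`. -/
def vsuppHom (r : ℕ) (φ : Body n → ℂ) : Set (Sph n) :=
  (fun (u : Sph n) (_ : Fin r) => u) ⁻¹' (goodeyWeil r φ).support

/-- The vertical support of a continuous polynomial valuation: the union of the vertical supports of
its homogeneous components of positive degree. -/
def vsupp (φ : C(Body n, ℂ)) : Set (Sph n) :=
  ⋃ (r : ℕ) (_ : 1 ≤ r), vsuppHom r (homComponent φ r)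

/-! ### Smooth valuations -/

/-- The general linear group `GL(n, ℝ)` as a Lie group (an open subset of `End(ℝⁿ)`). -/
abbrev GLn (n : ℕ) : Type := (E n →L[ℝ] E n)ˣ

/-- The action `(g · φ)(K) = φ(g⁻¹ K)` of `GL(n, ℝ)`. -/
def glAct (g : GLn n) (φ : C(Body n, ℂ)) : C(Body n, ℂ) :=
  φ.comp ⟨linImage ((g⁻¹ : GLn n) : E n →L[ℝ] E n), continuous_linImage _⟩

/-- `φ` is `GL(n, ℝ)`-smooth: the map `g ↦ g · φ` is smooth with respect to the topology of uniform
convergence on compact sets of convex bodies, i.e. for every compact set `S` of convex bodies the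
map `g ↦ (g · φ)|_S` into the Banach space `C(S)` with the sup norm is smooth. -/
def IsGLSmooth (φ : C(Body n, ℂ)) : Prop :=
  ∀ S : TopologicalSpace.Compacts (Body n),
    ContMDiff 𝓘(ℝ, E n →L[ℝ] E n) 𝓘(ℝ, C(S, ℂ)) ∞
      (fun g : GLn n => ((glAct g φ).comp ⟨Subtype.val, continuous_subtype_val⟩ : C(S, ℂ)))

end ConvVal

end

/-!
The decomposition comes from a smooth partition of unity `χ₁, …, χ_M` on the sphere that is
subordinate to the cover. By McMullen's theorem a continuous polynomial valuation is a sum of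
homogeneous ones, so let `φ` be homogeneous of degree `r`, with polarization `B`. By additivity `B`
extends to a multilinear functional of differences of support functions (`extMulti`). The space of
these differences is stable under multiplication by smooth functions on the sphere: if `c` is large
compared with the `C²`-norm of `χ` and the size of `K`, then `χ h_K + ‖χ‖ h_K + c ‖·‖` is a support
function, because it lies above its linearizations (`exists_supportFun_mul`). Hence
`φ(K) = ∑_f B(χ_{f 1} h_K, …, χ_{f r} h_K)`, the sum being over all maps
`f : {1, …, r} → {1, …, M}`, and these are the required summands (`angVal`).

*McMullen's theorem.* Cutting a dilated simplex by hyperplanes parallel to its facets relates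
translates of dilates of a polytope `P` in such a way that iterated differences of `t ↦ φ(tP)`
vanish (`fwdDiff_iter_polytope`). So `t ↦ φ(tP)` is a polynomial, and cutting into unit boxes bounds
its growth and therefore its degree, uniformly in `P` (`exists_growth_bound`). Approximation by
polytopes gives all bodies (`dilPoly_of_isValuation`). The directional derivatives of `φ`, that is,
the coefficients of `t` in `φ(K + tL)`, are additive in `L` and commute, and the polarization is the
`r`-fold derivative at `{0}`, up to the factor `r!` (`polar`).

*The summands are continuous polynomial valuations.* By the polarization formula it suffices to
consider `B(χ h_K, …, χ h_K)`. Evaluate `φ` at the body with support function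
`(χ + (1 + t) ‖χ‖) h_K + c ‖·‖`, with `c` depending on `t`. For `t ≥ 0` this is a valuation in `K`,
since the factor of `h_K` is nonnegative, so that maxima and minima of support functions are
respected. The value is polynomial in `t`, and `t = -1` is the assertion
(`isValuation_angVal_const`). Continuity follows from an explicit formula in terms of values of `φ`
at finitely many bodies depending continuously on `K` (`theta_restrictTo`).

*Their vertical support.* The polarization of a summand vanishes at functions that are all killed by
one and the same multiplier `χⱼ` (`extMulti_eq_zero`). So the Goodey–Weil distribution vanishes on the
tensor products of functions supported near a point `u` outside the support of `χⱼ`. Mollifying with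
product kernels shows that these tensor products are dense among the functions supported near
`(u, …, u)`, and `(u, …, u)` is not in the support (`notMem_support_of_tensor`).

*Smoothness.* On bodies in a fixed ball, the summand is a bounded multilinear function of the
restriction of `φ` to a larger ball and of the multipliers, for the supremum norm and the `C²`-norm
(`thetaMulti`). The action of `g ∈ GL(n, ℝ)` on a summand amounts to acting on `φ` and composing the
multipliers with the transpose of `g` (`angVal_linImage`), and both depend smoothly on `g`
(`isGLSmooth_angVal`).
-/

open scoped ContDiff Manifold RealInnerProductSpace Pointwise

noncomputable section

namespace ConvVal

open Set Filter Topology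
open scoped NNReal

variable {n : ℕ}

/-! ### Support functions -/

theorem bddAbove_inner_image (K : Body n) (y : E n) :
    BddAbove ((fun x => ⟪y, x⟫) '' (K : Set (E n))) :=
  (K.isCompact.image (by fun_prop)).bddAbove

theorem inner_le_supportFun {K : Body n} {x : E n} (hx : x ∈ K) (y : E n) :
    ⟪y, x⟫ ≤ supportFun K y :=
  le_csSup (bddAbove_inner_image K y) ⟨x, hx, rfl⟩

theorem supportFun_le {K : Body n} {y : E n} {c : ℝ} (h : ∀ x ∈ K, ⟪y, x⟫ ≤ c) :
    supportFun K y ≤ c := by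
  refine csSup_le (K.nonempty.image _) ?_
  rintro _ ⟨x, hx, rfl⟩
  exact h x hx

theorem exists_inner_eq_supportFun (K : Body n) (y : E n) :
    ∃ x ∈ K, ⟪y, x⟫ = supportFun K y := by
  obtain ⟨x, hx, h⟩ := K.isCompact.exists_isMaxOn K.nonempty
    (f := fun x => ⟪y, x⟫) (by fun_prop)
  exact ⟨x, hx, le_antisymm (inner_le_supportFun hx y) (supportFun_le h)⟩

theorem supportFun_mono {K L : Body n} (h : (K : Set (E n)) ⊆ L) (y : E n) :
    supportFun K y ≤ supportFun L y :=
  supportFun_le fun _ hx => inner_le_supportFun (h hx) y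

theorem supportFun_add (K L : Body n) : supportFun (K + L) = supportFun K + supportFun L := by
  funext y
  apply le_antisymm
  · refine supportFun_le fun x hx => ?_
    obtain ⟨k, hk, l, hl, rfl⟩ := Set.mem_add.1 (show x ∈ (K : Set (E n)) + L from hx)
    rw [inner_add_right]
    exact add_le_add (inner_le_supportFun hk y) (inner_le_supportFun hl y)
  · obtain ⟨k, hk, hk'⟩ := exists_inner_eq_supportFun K y
    obtain ⟨l, hl, hl'⟩ := exists_inner_eq_supportFun L y
    rw [Pi.add_apply, ← hk', ← hl', ← inner_add_right]
    exact inner_le_supportFun (K := K + L) (Set.add_mem_add hk hl) y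

theorem supportFun_smul {t : ℝ} (ht : 0 ≤ t) (K : Body n) :
    supportFun (t • K) = t • supportFun K := by
  funext y
  apply le_antisymm
  · refine supportFun_le fun x hx => ?_
    obtain ⟨k, hk, rfl⟩ := Set.mem_smul_set.1 (show x ∈ t • (K : Set (E n)) from hx)
    rw [real_inner_smul_right]
    exact mul_le_mul_of_nonneg_left (inner_le_supportFun hk y) ht
  · obtain ⟨k, hk, hk'⟩ := exists_inner_eq_supportFun K y
    rw [Pi.smul_apply, ← hk', smul_eq_mul, ← real_inner_smul_right]
    exact inner_le_supportFun (K := t • K) (Set.smul_mem_smul_set hk) y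

theorem supportFun_nnsmul (t : ℝ≥0) (K : Body n) :
    supportFun (t • K) = (t : ℝ) • supportFun K :=
  supportFun_smul t.2 K

@[simp]
theorem supportFun_zero : supportFun (0 : Body n) = 0 := by
  funext y
  obtain ⟨x, hx, h⟩ := exists_inner_eq_supportFun (0 : Body n) y
  rw [← h, show x = 0 from hx, inner_zero_right, Pi.zero_apply]

theorem supportFun_sum {ι : Type*} (s : Finset ι) (K : ι → Body n) :
    supportFun (∑ i ∈ s, K i) = ∑ i ∈ s, supportFun (K i) := by
  classical
  induction s using Finset.induction_on with
  | empty => simp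
  | insert i s hi ih => rw [Finset.sum_insert hi, Finset.sum_insert hi, supportFun_add, ih]

theorem supportFun_translate (K : Body n) (x y : E n) :
    supportFun (translate K x) y = supportFun K y + ⟪y, x⟫ := by
  apply le_antisymm
  · refine supportFun_le fun z hz => ?_
    obtain ⟨k, hk, rfl⟩ : z ∈ (fun y => y + x) '' (K : Set (E n)) := hz
    rw [inner_add_right]
    exact add_le_add_left (inner_le_supportFun hk y) _
  · obtain ⟨k, hk, hk'⟩ := exists_inner_eq_supportFun K y
    rw [← hk', ← inner_add_right]
    exact inner_le_supportFun (K := translate K x) (Set.mem_image_of_mem _ hk) y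

theorem supportFun_linImage (A : E n →L[ℝ] E n) (K : Body n) (y : E n) :
    supportFun (linImage A K) y = supportFun K (A.adjoint y) := by
  apply le_antisymm
  · refine supportFun_le fun z hz => ?_
    obtain ⟨k, hk, rfl⟩ : z ∈ A '' (K : Set (E n)) := hz
    rw [← ContinuousLinearMap.adjoint_inner_left]
    exact inner_le_supportFun hk _
  · obtain ⟨k, hk, hk'⟩ := exists_inner_eq_supportFun K (A.adjoint y)
    rw [← hk', ContinuousLinearMap.adjoint_inner_left]
    exact inner_le_supportFun (K := linImage A K) (Set.mem_image_of_mem _ hk) y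

theorem supportFun_smul_arg (K : Body n) {t : ℝ} (ht : 0 ≤ t) (y : E n) :
    supportFun K (t • y) = t * supportFun K y := by
  apply le_antisymm
  · refine supportFun_le fun x hx => ?_
    rw [real_inner_smul_left]
    exact mul_le_mul_of_nonneg_left (inner_le_supportFun hx y) ht
  · obtain ⟨k, hk, hk'⟩ := exists_inner_eq_supportFun K y
    rw [← hk', ← real_inner_smul_left]
    exact inner_le_supportFun hk _

@[simp]
theorem supportFun_zero_arg (K : Body n) : supportFun K 0 = 0 := by
  simpa using supportFun_smul_arg K le_rfl (0 : E n)

theorem convexOn_supportFun (K : Body n) : ConvexOn ℝ univ (supportFun K) := by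
  refine ⟨convex_univ, fun y _ z _ a b ha hb _ => supportFun_le fun x hx => ?_⟩
  rw [inner_add_left, real_inner_smul_left, real_inner_smul_left, smul_eq_mul, smul_eq_mul]
  exact add_le_add (mul_le_mul_of_nonneg_left (inner_le_supportFun hx y) ha)
    (mul_le_mul_of_nonneg_left (inner_le_supportFun hx z) hb)

/-- A point `x` is at distance at most `δ` from `L` if no unit direction separates it from `L` by
more than `δ`. -/
theorem exists_dist_le_of_inner_le (L : Body n) {x : E n} {δ : ℝ} (hδ : 0 ≤ δ)
    (h : ∀ y : E n, ‖y‖ = 1 → ⟪y, x⟫ ≤ supportFun L y + δ) : ∃ p ∈ L, dist x p ≤ δ := by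
  obtain ⟨p, hp, hpmin⟩ := exists_norm_eq_iInf_of_complete_convex L.nonempty
    L.isCompact.isComplete L.convex x
  refine ⟨p, hp, ?_⟩
  have hle := (norm_eq_iInf_iff_real_inner_le_zero L.convex hp).1 hpmin
  rw [dist_eq_norm]
  by_cases h0 : ‖x - p‖ = 0
  · rw [h0]; exact hδ
  have hpos : 0 < ‖x - p‖ := lt_of_le_of_ne (norm_nonneg _) (Ne.symm h0)
  have hy : ‖‖x - p‖⁻¹ • (x - p)‖ = 1 := by
    rw [norm_smul, norm_inv, norm_norm, inv_mul_cancel₀ h0]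
  have h1 := h _ hy
  have h2 : supportFun L (‖x - p‖⁻¹ • (x - p)) ≤ ⟪‖x - p‖⁻¹ • (x - p), p⟫ := by
    refine supportFun_le fun z hz => ?_
    have := hle z hz
    rw [inner_sub_right] at this
    rw [real_inner_smul_left, real_inner_smul_left]
    exact mul_le_mul_of_nonneg_left (by linarith) (by positivity)
  have h3 : ⟪‖x - p‖⁻¹ • (x - p), x⟫ - ⟪‖x - p‖⁻¹ • (x - p), p⟫ = ‖x - p‖ := by
    rw [← inner_sub_right, real_inner_smul_left, real_inner_self_eq_norm_sq]
    field_simp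
  linarith

theorem mem_iff_inner_le_supportFun (K : Body n) (x : E n) :
    x ∈ K ↔ ∀ y, ⟪y, x⟫ ≤ supportFun K y := by
  refine ⟨fun hx y => inner_le_supportFun hx y, fun h => ?_⟩
  obtain ⟨p, hp, hd⟩ := exists_dist_le_of_inner_le K le_rfl (x := x) fun y _ => by simpa using h y
  have : x = p := dist_le_zero.1 hd
  rwa [this]

theorem supportFun_injective : Function.Injective (supportFun : Body n → E n → ℝ) := by
  intro K L h
  refine ConvexBody.ext (Set.ext fun x => ?_)
  have h1 := mem_iff_inner_le_supportFun K x
  rw [h] at h1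
  exact h1.trans (mem_iff_inner_le_supportFun L x).symm

theorem subset_iff_supportFun_le {K L : Body n} :
    (K : Set (E n)) ⊆ L ↔ ∀ y, supportFun K y ≤ supportFun L y :=
  ⟨fun h y => supportFun_mono h y, fun h x hx =>
    (mem_iff_inner_le_supportFun L x).2 fun y => (inner_le_supportFun hx y).trans (h y)⟩

theorem supportFun_sub_le_dist (K L : Body n) (y : E n) :
    supportFun K y - supportFun L y ≤ ‖y‖ * dist K L := by
  obtain ⟨x, hx, hx'⟩ := exists_inner_eq_supportFun K y
  obtain ⟨p, hp, hd⟩ := L.isCompact.exists_infDist_eq_dist L.nonempty x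
  have h1 : dist x p ≤ dist K L := by
    rw [← hd]
    exact Metric.infDist_le_hausdorffDist_of_mem hx ConvexBody.hausdorffEDist_ne_top
  have h2 := inner_le_supportFun hp y
  have h3 : ⟪y, x - p⟫ ≤ ‖y‖ * ‖x - p‖ := real_inner_le_norm _ _
  rw [inner_sub_right, ← dist_eq_norm] at h3
  have h4 : ‖y‖ * dist x p ≤ ‖y‖ * dist K L := by gcongr
  linarith

theorem abs_supportFun_sub_le_dist (K L : Body n) (y : E n) :
    |supportFun K y - supportFun L y| ≤ ‖y‖ * dist K L := by
  rw [abs_sub_le_iff]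
  refine ⟨supportFun_sub_le_dist K L y, ?_⟩
  rw [dist_comm]
  exact supportFun_sub_le_dist L K y

/-- The Hausdorff distance is bounded by the sup-distance of the support functions on the
sphere. -/
theorem dist_le_of_abs_supportFun_sub_le {K L : Body n} {δ : ℝ} (hδ : 0 ≤ δ)
    (h : ∀ y : E n, ‖y‖ = 1 → |supportFun K y - supportFun L y| ≤ δ) : dist K L ≤ δ := by
  refine Metric.hausdorffDist_le_of_mem_dist hδ ?_ ?_
  · intro x hx
    refine exists_dist_le_of_inner_le L hδ fun y hy => ?_
    have h1 := inner_le_supportFun hx y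
    have h2 := (abs_le.1 (h y hy)).2
    linarith
  · intro x hx
    refine exists_dist_le_of_inner_le K hδ fun y hy => ?_
    have h1 := inner_le_supportFun hx y
    have h2 := (abs_le.1 (h y hy)).1
    linarith

theorem continuous_supportFun (K : Body n) : Continuous (supportFun K) := by
  obtain ⟨C, hC⟩ := K.isBounded.exists_norm_le
  refine (LipschitzWith.of_le_add_mul C.toNNReal fun y z => ?_).continuous
  obtain ⟨x, hx, hx'⟩ := exists_inner_eq_supportFun K y
  have h1 := inner_le_supportFun hx z
  have h2 : ⟪y - z, x⟫ ≤ ‖y - z‖ * ‖x‖ := real_inner_le_norm _ _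
  rw [inner_sub_left] at h2
  have h3 : ‖y - z‖ * ‖x‖ ≤ ‖y - z‖ * C.toNNReal := by
    gcongr
    exact (hC x hx).trans (Real.le_coe_toNNReal C)
  rw [dist_eq_norm]
  linarith

/-- A function that is the pointwise maximum of the linear functionals below it, and is bounded on
the unit sphere, is a support function. -/
theorem exists_supportFun_eq {F : E n → ℝ} {C : ℝ} (hC0 : 0 ≤ C) (hC : ∀ z, F z ≤ C * ‖z‖)
    (h : ∀ y, ∃ a : E n, (∀ z, ⟪z, a⟫ ≤ F z) ∧ ⟪y, a⟫ = F y) :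
    ∃ K : Body n, supportFun K = F := by
  let S : Set (E n) := {a | ∀ z, ⟪z, a⟫ ≤ F z}
  have hclosed : IsClosed S := by
    have : S = ⋂ z, {a | ⟪z, a⟫ ≤ F z} := by ext a; simp [S]
    rw [this]
    exact isClosed_iInter fun z => isClosed_le (by fun_prop) continuous_const
  have hbdd : Bornology.IsBounded S := by
    refine (Metric.isBounded_closedBall (x := (0 : E n)) (r := C)).subset fun a ha => ?_
    rw [mem_closedBall_zero_iff]
    have h1 := (ha a).trans (hC a)
    rw [real_inner_self_eq_norm_sq] at h1
    by_cases h0 : ‖a‖ = 0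
    · rw [h0]; exact hC0
    · have hpos : 0 < ‖a‖ := lt_of_le_of_ne (norm_nonneg _) (Ne.symm h0)
      nlinarith
  have hconv : Convex ℝ S := by
    intro a ha b hb s t hs ht hst z
    rw [inner_add_right, real_inner_smul_right, real_inner_smul_right]
    calc s * ⟪z, a⟫ + t * ⟪z, b⟫ ≤ s * F z + t * F z :=
          add_le_add (mul_le_mul_of_nonneg_left (ha z) hs) (mul_le_mul_of_nonneg_left (hb z) ht)
      _ = F z := by rw [← add_mul, hst, one_mul]
  obtain ⟨a₀, ha₀, -⟩ := h 0
  refine ⟨⟨S, hconv, Metric.isCompact_of_isClosed_isBounded hclosed hbdd, ⟨a₀, ha₀⟩⟩, ?_⟩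
  funext y
  apply le_antisymm
  · exact supportFun_le fun x hx => hx y
  · obtain ⟨a, ha, hay⟩ := h y
    rw [← hay]
    exact inner_le_supportFun (K := ⟨S, hconv, _, _⟩) ha y

/-! ### Unions and intersections of convex bodies -/

/-- If `K ∪ L` is convex, every segment from `K` to `L` meets `K ∩ L`. -/
theorem exists_convexComb_mem_inter {K L U I : Body n} (hU : (U : Set (E n)) = (K : Set (E n)) ∪ L)
    (hI : (I : Set (E n)) = (K : Set (E n)) ∩ L) {k l : E n} (hk : k ∈ K) (hl : l ∈ L) :
    ∃ a b : ℝ, 0 ≤ a ∧ 0 ≤ b ∧ a + b = 1 ∧ a • k + b • l ∈ I := by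
  have hseg : segment ℝ k l ⊆ (K : Set (E n)) ∪ L := by
    rw [← hU]
    refine U.convex.segment_subset ?_ ?_ <;> rw [hU]
    · exact Or.inl hk
    · exact Or.inr hl
  obtain ⟨z, ⟨a, b, ha, hb, hab, rfl⟩, hzK, hzL⟩ :=
    isPreconnected_closed_iff.1 (convex_segment k l).isPreconnected _ _ K.isClosed L.isClosed hseg
      ⟨k, left_mem_segment ℝ k l, hk⟩ ⟨l, right_mem_segment ℝ k l, hl⟩
  exact ⟨a, b, ha, hb, hab, by rw [← SetLike.mem_coe, hI]; exact ⟨hzK, hzL⟩⟩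

theorem supportFun_union {K L U : Body n} (hU : (U : Set (E n)) = (K : Set (E n)) ∪ L) (y : E n) :
    supportFun U y = max (supportFun K y) (supportFun L y) := by
  apply le_antisymm
  · refine supportFun_le fun x hx => ?_
    rw [← SetLike.mem_coe, hU] at hx
    rcases hx with hx | hx
    · exact (inner_le_supportFun hx y).trans (le_max_left _ _)
    · exact (inner_le_supportFun hx y).trans (le_max_right _ _)
  · exact max_le (supportFun_mono (hU ▸ subset_union_left) y)
      (supportFun_mono (hU ▸ subset_union_right) y)

theorem supportFun_inter {K L U I : Body n} (hU : (U : Set (E n)) = (K : Set (E n)) ∪ L)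
    (hI : (I : Set (E n)) = (K : Set (E n)) ∩ L) (y : E n) :
    supportFun I y = min (supportFun K y) (supportFun L y) := by
  apply le_antisymm
  · exact le_min (supportFun_mono (hI ▸ inter_subset_left) y)
      (supportFun_mono (hI ▸ inter_subset_right) y)
  · obtain ⟨k, hk, hk'⟩ := exists_inner_eq_supportFun K y
    obtain ⟨l, hl, hl'⟩ := exists_inner_eq_supportFun L y
    obtain ⟨a, b, ha, hb, hab, hi⟩ := exists_convexComb_mem_inter hU hI hk hl
    refine le_trans ?_ (inner_le_supportFun hi y)
    rw [inner_add_right, real_inner_smul_right, real_inner_smul_right, hk', hl']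
    have h1 := mul_le_mul_of_nonneg_left (min_le_left (supportFun K y) (supportFun L y)) ha
    have h2 := mul_le_mul_of_nonneg_left (min_le_right (supportFun K y) (supportFun L y)) hb
    calc _ = (a + b) * min (supportFun K y) (supportFun L y) := by rw [hab, one_mul]
      _ ≤ _ := by rw [add_mul]; exact add_le_add h1 h2

theorem coe_eq_inter_of_supportFun {K L I : Body n}
    (hI : ∀ y, supportFun I y = min (supportFun K y) (supportFun L y)) :
    (I : Set (E n)) = (K : Set (E n)) ∩ L := by
  refine Subset.antisymm (subset_inter ?_ ?_) fun x hx => ?_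
  · exact subset_iff_supportFun_le.2 fun y => (hI y).trans_le (min_le_left _ _)
  · exact subset_iff_supportFun_le.2 fun y => (hI y).trans_le (min_le_right _ _)
  · refine (mem_iff_inner_le_supportFun I x).2 fun y => ?_
    rw [hI]
    exact le_min (inner_le_supportFun hx.1 y) (inner_le_supportFun hx.2 y)

/-- If the minimum of two support functions is a support function, the maximum is the support
function of the union. -/
theorem coe_eq_union_of_supportFun {K L U I : Body n}
    (hU : ∀ y, supportFun U y = max (supportFun K y) (supportFun L y))
    (hI : ∀ y, supportFun I y = min (supportFun K y) (supportFun L y)) :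
    (U : Set (E n)) = (K : Set (E n)) ∪ L := by
  refine Subset.antisymm (fun x hx => ?_) (union_subset ?_ ?_)
  · -- A point of `U` outside `K ∪ L` would be separated from `K` and from `L` by functionals `y`, `z`.
    -- The convexity of `h_I = min (h_K, h_L)` gives a functional on the segment from `y` to `z` that
    -- separates it from both, hence from `U`.
    by_contra hx'
    rw [mem_union, not_or] at hx'
    obtain ⟨y, hy⟩ := not_forall.1 (mt (mem_iff_inner_le_supportFun K x).2 hx'.1)
    obtain ⟨z, hz⟩ := not_forall.1 (mt (mem_iff_inner_le_supportFun L x).2 hx'.2)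
    push Not at hy hz
    have hopen : ∀ M : Body n, IsOpen {w : E n | supportFun M w < ⟪w, x⟫} := fun M =>
      isOpen_lt (continuous_supportFun M) (by fun_prop)
    have hcover : segment ℝ y z ⊆ {w | supportFun K w < ⟪w, x⟫} ∪ {w | supportFun L w < ⟪w, x⟫} := by
      rintro w ⟨a, b, ha, hb, hab, rfl⟩
      have h1 := (convexOn_supportFun I).2 (mem_univ y) (mem_univ z) ha hb hab
      have hyI : supportFun I y < ⟪y, x⟫ := by rw [hI]; exact (min_le_left _ _).trans_lt hy
      have hzI : supportFun I z < ⟪z, x⟫ := by rw [hI]; exact (min_le_right _ _).trans_lt hz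
      have h2 : supportFun I (a • y + b • z) < ⟪a • y + b • z, x⟫ := by
        rw [inner_add_left, real_inner_smul_left, real_inner_smul_left]
        refine h1.trans_lt ?_
        rw [smul_eq_mul, smul_eq_mul]
        rcases ha.eq_or_lt with rfl | ha'
        · rw [zero_add] at hab
          subst hab
          linarith
        · have := mul_lt_mul_of_pos_left hyI ha'
          have := mul_le_mul_of_nonneg_left hzI.le hb
          linarith
      rw [hI] at h2
      rcases min_lt_iff.1 h2 with h | h
      · exact Or.inl h
      · exact Or.inr h
    obtain ⟨w, -, hwK, hwL⟩ := (convex_segment y z).isPreconnected _ _ (hopen K) (hopen L) hcover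
      ⟨y, left_mem_segment ℝ y z, hy⟩ ⟨z, right_mem_segment ℝ y z, hz⟩
    have := inner_le_supportFun hx w
    rw [hU] at this
    exact absurd this (not_le.2 (max_lt hwK hwL))
  · exact subset_iff_supportFun_le.2 fun y => (le_max_left _ _).trans (hU y).ge
  · exact subset_iff_supportFun_le.2 fun y => (le_max_right _ _).trans (hU y).ge

/-! ### Continuity of the Minkowski operations, and compactness -/

theorem dist_add_add_le' (K K' L L' : Body n) :
    dist (K + L) (K' + L') ≤ dist K K' + dist L L' := by
  refine dist_le_of_abs_supportFun_sub_le (by positivity) fun y hy => ?_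
  rw [supportFun_add, supportFun_add, Pi.add_apply, Pi.add_apply]
  have h1 := abs_supportFun_sub_le_dist K K' y
  have h2 := abs_supportFun_sub_le_dist L L' y
  rw [hy, one_mul] at h1 h2
  rw [add_sub_add_comm]
  exact (abs_add_le _ _).trans (add_le_add h1 h2)

instance : ContinuousAdd (Body n) :=
  ⟨continuous_iff_continuousAt.2 fun p => by
    rw [ContinuousAt, tendsto_iff_dist_tendsto_zero]
    refine squeeze_zero (fun _ => dist_nonneg) (fun q => dist_add_add_le' q.1 p.1 q.2 p.2) ?_
    have h1 : Continuous fun q : Body n × Body n => dist q.1 p.1 + dist q.2 p.2 := by fun_prop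
    have := h1.tendsto p
    simpa using this⟩

theorem continuous_smul_body {t : ℝ} (ht : 0 ≤ t) : Continuous fun K : Body n => t • K := by
  refine (LipschitzWith.of_dist_le_mul (K := t.toNNReal) fun K L => ?_).continuous
  rw [Real.coe_toNNReal _ ht]
  refine dist_le_of_abs_supportFun_sub_le (by positivity) fun y hy => ?_
  have h1 := abs_supportFun_sub_le_dist K L y
  rw [hy, one_mul] at h1
  rw [supportFun_smul ht, supportFun_smul ht, Pi.smul_apply, Pi.smul_apply, ← smul_sub, smul_eq_mul,
    abs_mul, abs_of_nonneg ht]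
  gcongr

theorem abs_supportFun_le {K : Body n} {R : ℝ} (hR : ∀ x ∈ K, ‖x‖ ≤ R) (y : E n) :
    |supportFun K y| ≤ R * ‖y‖ := by
  obtain ⟨x, hx, h⟩ := exists_inner_eq_supportFun K y
  rw [← h, mul_comm]
  exact (abs_real_inner_le_norm y x).trans (by gcongr; exact hR x hx)

theorem norm_le_of_supportFun_le {K : Body n} {R : ℝ} (hR0 : 0 ≤ R)
    (hR : ∀ y : E n, supportFun K y ≤ R * ‖y‖) : ∀ x ∈ K, ‖x‖ ≤ R := by
  intro x hx
  have h1 := (inner_le_supportFun hx x).trans (hR x)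
  rw [real_inner_self_eq_norm_sq] at h1
  by_cases h0 : ‖x‖ = 0
  · rw [h0]; exact hR0
  · have hpos : 0 < ‖x‖ := lt_of_le_of_ne (norm_nonneg _) (Ne.symm h0)
    nlinarith

theorem exists_norm_le (K : Body n) : ∃ R : ℝ, 0 ≤ R ∧ ∀ x ∈ K, ‖x‖ ≤ R := by
  obtain ⟨C, hC, h⟩ := K.isBounded.exists_pos_norm_le
  exact ⟨C, hC.le, h⟩

theorem continuousOn_smul_body (K : Body n) : ContinuousOn (fun t : ℝ => t • K) (Ici 0) := by
  obtain ⟨R, hR0, hR⟩ := exists_norm_le K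
  refine (LipschitzOnWith.of_dist_le_mul (K := R.toNNReal) fun s hs t ht => ?_).continuousOn
  rw [Real.coe_toNNReal _ hR0]
  refine dist_le_of_abs_supportFun_sub_le (by positivity) fun y hy => ?_
  have h1 := abs_supportFun_le hR y
  rw [hy, mul_one] at h1
  rw [supportFun_smul hs, supportFun_smul ht, Pi.smul_apply, Pi.smul_apply, ← sub_smul, smul_eq_mul,
    abs_mul, mul_comm, Real.dist_eq]
  gcongr

/-- The set of convex bodies contained in the closed ball of radius `R` about the origin. -/
def bodiesInBall (n : ℕ) (R : ℝ) : Set (Body n) := {K | ∀ x ∈ K, ‖x‖ ≤ R}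

/-- Blaschke's selection theorem. -/
theorem isCompact_bodiesInBall (R : ℝ) : IsCompact (bodiesInBall n R) := by
  let ι : Body n → TopologicalSpace.NonemptyCompacts (E n) :=
    fun K => ⟨⟨K, K.isCompact⟩, K.nonempty⟩
  have hι : Isometry ι := Isometry.of_dist_eq fun K L => rfl
  rw [hι.isEmbedding.isCompact_iff]
  -- Compactness of the space of nonempty compact subsets of the ball is known, so it remains to see
  -- that limits of convex sets are convex.
  have himg : ι '' bodiesInBall n R =
      {L : TopologicalSpace.NonemptyCompacts (E n) | (L : Set (E n)) ⊆ Metric.closedBall 0 R} ∩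
        {L | Convex ℝ (L : Set (E n))} := by
    ext L
    constructor
    · rintro ⟨K, hK, rfl⟩
      exact ⟨fun x hx => mem_closedBall_zero_iff.2 (hK x hx), K.convex⟩
    · rintro ⟨h1, h2⟩
      exact ⟨⟨L, h2, L.isCompact, L.nonempty⟩, fun x hx => mem_closedBall_zero_iff.1 (h1 hx), rfl⟩
  rw [himg]
  refine (TopologicalSpace.NonemptyCompacts.isCompact_subsets_of_isCompact
    (isCompact_closedBall 0 R)).inter_right ?_
  refine isClosed_of_closure_subset fun L hL => ?_
  intro x hx y hy a b ha hb hab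
  rw [SetLike.mem_coe, ← SetLike.mem_coe, ← L.isCompact.isClosed.closure_eq, Metric.mem_closure_iff]
  intro ε hε
  obtain ⟨M, hM, hLM⟩ := Metric.mem_closure_iff.1 hL (ε / 2) (by positivity)
  change Metric.hausdorffDist (L : Set (E n)) M < ε / 2 at hLM
  have hfin : Metric.hausdorffEDist (L : Set (E n)) M ≠ ⊤ :=
    Metric.hausdorffEDist_ne_top_of_nonempty_of_bounded L.nonempty M.nonempty
      L.isCompact.isBounded M.isCompact.isBounded
  obtain ⟨x', hx', hxx⟩ := Metric.exists_dist_lt_of_hausdorffDist_lt hx hLM hfin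
  obtain ⟨y', hy', hyy⟩ := Metric.exists_dist_lt_of_hausdorffDist_lt hy hLM hfin
  obtain ⟨z, hz, hzz⟩ := Metric.exists_dist_lt_of_hausdorffDist_lt' (hM hx' hy' ha hb hab) hLM hfin
  refine ⟨z, hz, ?_⟩
  have h1 : dist (a • x + b • y) (a • x' + b • y') < ε / 2 := by
    refine (dist_add_add_le _ _ _ _).trans_lt ?_
    rw [dist_smul₀, dist_smul₀, Real.norm_of_nonneg ha, Real.norm_of_nonneg hb]
    rcases ha.eq_or_lt with rfl | ha'
    · rw [zero_add] at hab
      subst hab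
      linarith
    · have := mul_lt_mul_of_pos_left hxx ha'
      have := mul_le_mul_of_nonneg_left hyy.le hb
      calc _ < a * (ε / 2) + b * (ε / 2) := by linarith
        _ = ε / 2 := by rw [← add_mul, hab, one_mul]
  have h2 := dist_triangle (a • x + b • y) (a • x' + b • y') z
  rw [dist_comm z] at hzz
  linarith

theorem exists_norm_le_of_isCompact {S : Set (Body n)} (hS : IsCompact S) :
    ∃ R : ℝ, 0 ≤ R ∧ S ⊆ bodiesInBall n R := by
  obtain ⟨C, hC⟩ := hS.isBounded.subset_closedBall (0 : Body n)
  refine ⟨max C 0, le_max_right _ _, fun K hK => norm_le_of_supportFun_le (le_max_right _ _) fun y => ?_⟩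
  have h1 := supportFun_sub_le_dist K 0 y
  rw [supportFun_zero, Pi.zero_apply, sub_zero] at h1
  have h2 : dist K 0 ≤ max C 0 := (hC hK).trans (le_max_left _ _)
  rw [mul_comm]
  exact h1.trans (by gcongr)

/-! ### Functions annihilated by iterated differences -/

/-- `f` is annihilated by all iterated differences of order `m`. Polynomials of degree less than `m`
have this property. -/
def DiffDegLT {V : Type*} [AddCommGroup V] : ℕ → (V → ℂ) → Prop
  | 0, f => ∀ x, f x = 0
  | m + 1, f => ∀ y, DiffDegLT m fun x => f (x + y) - f x

section DiffDegLT

variable {V : Type*} [AddCommGroup V]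

theorem DiffDegLT.add {m : ℕ} {f g : V → ℂ} (hf : DiffDegLT m f) (hg : DiffDegLT m g) :
    DiffDegLT m fun x => f x + g x := by
  induction m generalizing f g with
  | zero => intro x; simp [hf x, hg x]
  | succ m ih =>
    intro y
    have := ih (hf y) (hg y)
    convert this using 2
    ring

theorem DiffDegLT.shift {m : ℕ} {f : V → ℂ} (hf : DiffDegLT m f) (z : V) :
    DiffDegLT m fun x => f (x + z) := by
  induction m generalizing f with
  | zero => intro x; exact hf _
  | succ m ih =>
    intro y
    have := ih (hf y)
    convert this using 4
    abel

theorem DiffDegLT.succ {m : ℕ} {f : V → ℂ} (hf : DiffDegLT m f) : DiffDegLT (m + 1) f := by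
  induction m generalizing f with
  | zero => intro y x; simp [hf x, hf (x + y)]
  | succ m ih => exact fun y => ih (hf y)

theorem DiffDegLT.mono {m k : ℕ} (hmk : m ≤ k) {f : V → ℂ} (hf : DiffDegLT m f) :
    DiffDegLT k f := by
  induction hmk with
  | refl => exact hf
  | step _ ih => exact ih.succ

theorem DiffDegLT.const (c : ℂ) : DiffDegLT 1 fun _ : V => c := fun y x => by simp

theorem DiffDegLT.zero (m : ℕ) : DiffDegLT m fun _ : V => (0 : ℂ) :=
  DiffDegLT.mono (Nat.zero_le m) (m := 0) fun _ => rfl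

theorem DiffDegLT.sum {m : ℕ} {ι : Type*} (s : Finset ι) {f : ι → V → ℂ}
    (hf : ∀ i ∈ s, DiffDegLT m (f i)) : DiffDegLT m fun x => ∑ i ∈ s, f i x := by
  classical
  induction s using Finset.induction_on with
  | empty => simpa using DiffDegLT.zero m
  | insert i s hi ih =>
    simp only [Finset.sum_insert hi]
    exact (hf i (Finset.mem_insert_self i s)).add
      (ih fun j hj => hf j (Finset.mem_insert_of_mem hj))

theorem DiffDegLT.of_add (f : V → ℂ) (h0 : ∀ x y, f (x + y) = f x + f y) : DiffDegLT 2 f := by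
  intro y
  simpa [h0] using DiffDegLT.const (V := V) (f y)

theorem DiffDegLT.mul {N a b : ℕ} (hN : a + b ≤ N + 1) {f g : V → ℂ} (hf : DiffDegLT a f)
    (hg : DiffDegLT b g) : DiffDegLT N fun x => f x * g x := by
  induction N generalizing a b f g with
  | zero =>
    intro x
    obtain rfl | rfl : a = 0 ∨ b = 0 := by omega
    · simp [hf x]
    · simp [hg x]
  | succ N ih =>
    rcases a with _ | a
    · have h0 : ∀ x, f x = 0 := hf
      simp only [h0, zero_mul]
      exact DiffDegLT.zero _
    rcases b with _ | b
    · have h0 : ∀ x, g x = 0 := hg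
      simp only [h0, mul_zero]
      exact DiffDegLT.zero _
    intro y
    have : (fun x => f (x + y) * g (x + y) - f x * g x) =
        fun x => (f (x + y) - f x) * g (x + y) + f x * (g (x + y) - g x) := by
      funext x; ring
    change DiffDegLT N (fun x => f (x + y) * g (x + y) - f x * g x)
    rw [this]
    exact (ih (by omega) (hf y) (hg.shift y)).add (ih (by omega) hf (hg y))

theorem DiffDegLT.const_mul {m : ℕ} {f : V → ℂ} (hf : DiffDegLT m f) (c : ℂ) :
    DiffDegLT m fun x => c * f x :=
  (DiffDegLT.const c).mul (by omega) hf

theorem DiffDegLT.fwdDiff_iter {m : ℕ} {f : V → ℂ} (hf : DiffDegLT m f) (y : V) {k : ℕ}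
    (hk : m ≤ k) : (fwdDiff y)^[k] f = 0 := by
  induction k generalizing m f with
  | zero =>
    obtain rfl : m = 0 := by omega
    exact funext hf
  | succ k ih =>
    rw [Function.iterate_succ_apply]
    rcases m with _ | m
    · have : fwdDiff y f = 0 := by
        funext x
        rw [fwdDiff, hf, hf, sub_zero, Pi.zero_apply]
      rw [this]
      exact ih (DiffDegLT.zero 0) (Nat.zero_le _)
    · exact ih (hf y) (by omega)

end DiffDegLT

theorem DiffDegLT.coord (i : Fin n) : DiffDegLT 2 fun x : E n => ((x i : ℝ) : ℂ) :=
  DiffDegLT.of_add _ fun x y => by simp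

theorem diffDegLT_eval {d : ℕ} {p : MvPolynomial (Fin n) ℂ} (hp : p.totalDegree ≤ d) :
    DiffDegLT (d + 1) fun x : E n => MvPolynomial.eval (fun i => (x i : ℂ)) p := by
  simp only [MvPolynomial.eval_eq]
  refine DiffDegLT.sum _ fun a ha => DiffDegLT.const_mul ?_ _
  have hprod : ∀ (s : Finset (Fin n)), DiffDegLT (∑ i ∈ s, a i + 1)
      fun x : E n => ∏ i ∈ s, ((x i : ℝ) : ℂ) ^ a i := by
    intro s
    induction s using Finset.induction_on with
    | empty => simpa using DiffDegLT.const (V := E n) 1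
    | insert i s hi ih =>
      simp only [Finset.prod_insert hi, Finset.sum_insert hi]
      have hpow : ∀ k : ℕ, DiffDegLT (k + 1) fun x : E n => ((x i : ℝ) : ℂ) ^ k := by
        intro k
        induction k with
        | zero => simpa using DiffDegLT.const (V := E n) 1
        | succ k ihk =>
          simp only [pow_succ]
          exact ihk.mul (by omega) (DiffDegLT.coord i)
      exact (hpow (a i)).mul (by omega) ih
  refine (hprod a.support).mono ?_
  have := MvPolynomial.le_totalDegree ha
  rw [Finsupp.sum] at this
  omega

/-! ### Operations on valuations -/

/-- `φ` is polynomial under translations, in the sense of iterated differences. -/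
def TransDegLT (m : ℕ) (φ : Body n → ℂ) : Prop :=
  ∀ K : Body n, DiffDegLT m fun x : E n => φ (translate K x)

theorem coe_translate (K : Body n) (x : E n) :
    (translate K x : Set (E n)) = (fun y => y + x) '' (K : Set (E n)) := rfl

theorem translate_eq_add (K : Body n) (x : E n) :
    (translate K x : Set (E n)) = (K : Set (E n)) + {x} := by
  rw [coe_translate, Set.add_singleton]

/-- The convex body consisting of one point. -/
def pointBody (x : E n) : Body n := ⟨{x}, convex_singleton x, isCompact_singleton, singleton_nonempty x⟩

theorem translate_eq (K : Body n) (x : E n) : translate K x = K + pointBody x :=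
  ConvexBody.ext (translate_eq_add K x)

theorem supportFun_pointBody (x y : E n) : supportFun (pointBody x) y = ⟪y, x⟫ := by
  obtain ⟨z, hz, h⟩ := exists_inner_eq_supportFun (pointBody x) y
  rw [← h, show z = x from hz]

theorem translate_add (K L : Body n) (x : E n) : translate (K + L) x = translate K x + L := by
  rw [translate_eq, translate_eq, add_right_comm]

theorem translate_translate (K : Body n) (x y : E n) :
    translate (translate K x) y = translate K (x + y) := by
  apply supportFun_injective
  funext z
  simp only [supportFun_translate, inner_add_right]
  ring

@[simp]
theorem translate_zero (K : Body n) : translate K 0 = K := by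
  apply supportFun_injective
  funext z
  simp [supportFun_translate]

theorem IsPolynomialValuationOfDegree.transDegLT {d : ℕ} {φ : Body n → ℂ}
    (h : IsPolynomialValuationOfDegree d φ) : TransDegLT (d + 1) φ := by
  intro K
  obtain ⟨p, hp, hp'⟩ := h.2 K
  simp only [hp']
  exact diffDegLT_eval hp

theorem IsValuation.add_right {φ : Body n → ℂ} (h : IsValuation φ) (L : Body n) :
    IsValuation fun K => φ (K + L) := by
  intro K K' U I hU hI
  refine h _ _ _ _ ?_ ?_
  · rw [ConvexBody.coe_add, hU, Set.union_add, ConvexBody.coe_add, ConvexBody.coe_add]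
  · refine coe_eq_inter_of_supportFun fun y => ?_
    simp only [supportFun_add, Pi.add_apply, supportFun_inter hU hI, min_add]

theorem TransDegLT.add_right {m : ℕ} {φ : Body n → ℂ} (h : TransDegLT m φ) (L : Body n) :
    TransDegLT m fun K => φ (K + L) := by
  intro K
  have := h (K + L)
  simpa only [translate_add] using this

theorem IsValuation.add {φ ψ : Body n → ℂ} (h : IsValuation φ) (h' : IsValuation ψ) :
    IsValuation fun K => φ K + ψ K := by
  intro K L U I hU hI
  linear_combination h K L U I hU hI + h' K L U I hU hI

theorem IsValuation.const_mul {φ : Body n → ℂ} (h : IsValuation φ) (c : ℂ) :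
    IsValuation fun K => c * φ K := by
  intro K L U I hU hI
  linear_combination c * h K L U I hU hI

theorem IsValuation.sum {ι : Type*} (s : Finset ι) {φ : ι → Body n → ℂ}
    (h : ∀ i ∈ s, IsValuation (φ i)) : IsValuation fun K => ∑ i ∈ s, φ i K := by
  intro K L U I hU hI
  simp only [← Finset.sum_add_distrib]
  exact Finset.sum_congr rfl fun i hi => h i hi K L U I hU hI

/-- A map of convex bodies acting on support functions in a way that respects pointwise maxima and
minima pulls valuations back to valuations. -/
theorem IsValuation.comp_lattice {φ : Body n → ℂ} (h : IsValuation φ) (G : Body n → Body n)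
    (hmax : ∀ K L U : Body n, (∀ y, supportFun U y = max (supportFun K y) (supportFun L y)) →
      ∀ y, supportFun (G U) y = max (supportFun (G K) y) (supportFun (G L) y))
    (hmin : ∀ K L I : Body n, (∀ y, supportFun I y = min (supportFun K y) (supportFun L y)) →
      ∀ y, supportFun (G I) y = min (supportFun (G K) y) (supportFun (G L) y)) :
    IsValuation fun K => φ (G K) := by
  intro K L U I hU hI
  have h1 := hmax K L U (supportFun_union hU)
  have h2 := hmin K L I (supportFun_inter hU hI)
  exact h _ _ _ _ (coe_eq_union_of_supportFun h1 h2) (coe_eq_inter_of_supportFun h2)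

theorem IsValuation.smul_arg {φ : Body n → ℂ} (h : IsValuation φ) {t : ℝ} (ht : 0 ≤ t) :
    IsValuation fun K => φ (t • K) := by
  refine h.comp_lattice (fun K => t • K) ?_ ?_
  · intro K L U hU y
    simp only [supportFun_smul ht, Pi.smul_apply, hU, smul_eq_mul, mul_max_of_nonneg _ _ ht]
  · intro K L U hU y
    simp only [supportFun_smul ht, Pi.smul_apply, hU, smul_eq_mul, mul_min_of_nonneg _ _ ht]

theorem IsValuation.translate_arg {φ : Body n → ℂ} (h : IsValuation φ) (x : E n) :
    IsValuation fun K => φ (translate K x) := by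
  simpa only [translate_eq] using h.add_right (pointBody x)

theorem smul_translate (t : ℝ) (K : Body n) (x : E n) :
    t • translate K x = translate (t • K) (t • x) := by
  apply ConvexBody.ext
  rw [ConvexBody.coe_smul, translate_eq_add, translate_eq_add, ConvexBody.coe_smul, smul_add,
    Set.smul_set_singleton]

/-! ### Cutting by hyperplanes -/

section Cut

variable {W : Type*} [NormedAddCommGroup W] [NormedSpace ℝ W]

open Classical in
/-- The pull-back of `φ` under a linear map `A`, as a functional on subsets of the source of `A`:
a nonempty compact convex set `S` has the value `φ(A S)`, all other sets (in particular the empty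
set) have the value `0`. -/
def liftFun (φ : Body n → ℂ) (A : W →L[ℝ] E n) (S : Set W) : ℂ :=
  if h : Convex ℝ S ∧ IsCompact S ∧ S.Nonempty then
    φ ⟨A '' S, h.1.linear_image A.toLinearMap, h.2.1.image A.continuous, h.2.2.image _⟩
  else 0

theorem liftFun_empty (φ : Body n → ℂ) (A : W →L[ℝ] E n) : liftFun φ A ∅ = 0 := by
  simp [liftFun]

theorem liftFun_eq {φ : Body n → ℂ} {A : W →L[ℝ] E n} {S : Set W} (hc : Convex ℝ S)
    (hS : IsCompact S) (hne : S.Nonempty) {K : Body n} (hK : (K : Set (E n)) = A '' S) :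
    liftFun φ A S = φ K := by
  rw [liftFun, dif_pos ⟨hc, hS, hne⟩]
  congr 1
  exact ConvexBody.ext hK.symm

theorem convex_le (ℓ : W →L[ℝ] ℝ) (a : ℝ) : Convex ℝ {x | ℓ x ≤ a} :=
  convex_halfSpace_le ℓ.toLinearMap.isLinear a

theorem convex_ge (ℓ : W →L[ℝ] ℝ) (a : ℝ) : Convex ℝ {x | a ≤ ℓ x} :=
  convex_halfSpace_ge ℓ.toLinearMap.isLinear a

theorem isClosed_le_clm (ℓ : W →L[ℝ] ℝ) (a : ℝ) : IsClosed {x | ℓ x ≤ a} :=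
  isClosed_le ℓ.continuous continuous_const

theorem isClosed_ge_clm (ℓ : W →L[ℝ] ℝ) (a : ℝ) : IsClosed {x | a ≤ ℓ x} :=
  isClosed_le continuous_const ℓ.continuous

/-- Cutting a compact convex set by the hyperplane `ℓ = a`. -/
theorem liftFun_cut {φ : Body n → ℂ} (hφ : IsValuation φ) (A : W →L[ℝ] E n) {S : Set W}
    (hc : Convex ℝ S) (hS : IsCompact S) (ℓ : W →L[ℝ] ℝ) (a : ℝ) :
    liftFun φ A S + liftFun φ A (S ∩ ({x | ℓ x ≤ a} ∩ {x | a ≤ ℓ x})) =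
      liftFun φ A (S ∩ {x | ℓ x ≤ a}) + liftFun φ A (S ∩ {x | a ≤ ℓ x}) := by
  have hle := convex_le ℓ a
  have hge := convex_ge ℓ a
  have cle := isClosed_le_clm ℓ a
  have cge := isClosed_ge_clm ℓ a
  have hcov : S ⊆ {x | ℓ x ≤ a} ∪ {x | a ≤ ℓ x} := fun x _ => by simpa using le_total (ℓ x) a
  by_cases h1 : (S ∩ {x | ℓ x ≤ a}).Nonempty
  · by_cases h2 : (S ∩ {x | a ≤ ℓ x}).Nonempty
    · have h3 : (S ∩ ({x | ℓ x ≤ a} ∩ {x | a ≤ ℓ x})).Nonempty :=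
        isPreconnected_closed_iff.1 hc.isPreconnected _ _ cle cge hcov h1 h2
      have hcont := A.continuous
      let mk : ∀ T : Set W, Convex ℝ T → IsCompact T → T.Nonempty → Body n := fun T h h' h'' =>
        ⟨A '' T, h.linear_image A.toLinearMap, h'.image hcont, h''.image _⟩
      rw [liftFun_eq hc hS (h1.mono inter_subset_left) (K := mk _ hc hS (h1.mono inter_subset_left)) rfl,
        liftFun_eq (hc.inter (hle.inter hge)) (hS.inter_right (cle.inter cge)) h3
          (K := mk _ (hc.inter (hle.inter hge)) (hS.inter_right (cle.inter cge)) h3) rfl,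
        liftFun_eq (hc.inter hle) (hS.inter_right cle) h1
          (K := mk _ (hc.inter hle) (hS.inter_right cle) h1) rfl,
        liftFun_eq (hc.inter hge) (hS.inter_right cge) h2
          (K := mk _ (hc.inter hge) (hS.inter_right cge) h2) rfl]
      refine hφ _ _ _ _ ?_ ?_
      · change A '' S = A '' _ ∪ A '' _
        rw [← image_union, ← inter_union_distrib_left, inter_eq_left.2 hcov]
      · change A '' _ = A '' _ ∩ A '' _
        refine Subset.antisymm ?_ ?_
        · exact subset_inter (image_mono (inter_subset_inter_right _ inter_subset_left))
            (image_mono (inter_subset_inter_right _ inter_subset_right))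
        · rintro _ ⟨⟨x, ⟨hxS, hx⟩, rfl⟩, ⟨y, ⟨hyS, hy⟩, hxy⟩⟩
          -- the segment between the two preimages meets the hyperplane
          obtain ⟨z, hz, hz1, hz2⟩ := isPreconnected_closed_iff.1 (convex_segment x y).isPreconnected
            _ _ cle cge ((hc.segment_subset hxS hyS).trans hcov)
            ⟨x, left_mem_segment ℝ x y, hx⟩ ⟨y, right_mem_segment ℝ x y, hy⟩
          refine ⟨z, ⟨hc.segment_subset hxS hyS hz, hz1, hz2⟩, ?_⟩
          obtain ⟨s, t, hs, ht, hst, rfl⟩ := hz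
          rw [map_add, map_smul, map_smul, hxy, ← add_smul, hst, one_smul]
    · rw [not_nonempty_iff_eq_empty] at h2
      have h3 : S ∩ ({x | ℓ x ≤ a} ∩ {x | a ≤ ℓ x}) = ∅ :=
        subset_empty_iff.1 ((inter_subset_inter_right _ inter_subset_right).trans h2.subset)
      have h4 : S ∩ {x | ℓ x ≤ a} = S := by
        refine inter_eq_left.2 fun x hx => (hcov hx).resolve_right fun h => ?_
        exact (h2 ▸ (⟨hx, h⟩ : x ∈ S ∩ {x | a ≤ ℓ x}) : x ∈ (∅ : Set W))
      rw [h2, h3, h4]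
  · rw [not_nonempty_iff_eq_empty] at h1
    have h3 : S ∩ ({x | ℓ x ≤ a} ∩ {x | a ≤ ℓ x}) = ∅ :=
      subset_empty_iff.1 ((inter_subset_inter_right _ inter_subset_left).trans h1.subset)
    have h4 : S ∩ {x | a ≤ ℓ x} = S := by
      refine inter_eq_left.2 fun x hx => (hcov hx).resolve_left fun h => ?_
      exact (h1 ▸ (⟨hx, h⟩ : x ∈ S ∩ {x | ℓ x ≤ a}) : x ∈ (∅ : Set W))
    rw [h1, h3, h4, liftFun_empty, zero_add, add_zero]

/-- The part of `S` where all coordinates with index in `I` are at least `δ`. -/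
def upperPart {k : ℕ} (δ : ℝ) (I : Finset (Fin k)) (S : Set (Fin k → ℝ)) : Set (Fin k → ℝ) :=
  S ∩ {c | ∀ i ∈ I, δ ≤ c i}

theorem convex_upperPart {k : ℕ} (δ : ℝ) (I : Finset (Fin k)) {S : Set (Fin k → ℝ)}
    (hS : Convex ℝ S) : Convex ℝ (upperPart δ I S) := by
  refine hS.inter ?_
  have : {c : Fin k → ℝ | ∀ i ∈ I, δ ≤ c i} = ⋂ i ∈ I, {c | δ ≤ c i} := by ext; simp
  rw [this]
  exact convex_iInter₂ fun i _ => convex_ge (ContinuousLinearMap.proj (φ := fun _ : Fin k => ℝ) i) δ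

theorem isCompact_upperPart {k : ℕ} (δ : ℝ) (I : Finset (Fin k)) {S : Set (Fin k → ℝ)}
    (hS : IsCompact S) : IsCompact (upperPart δ I S) := by
  refine hS.inter_right ?_
  have : {c : Fin k → ℝ | ∀ i ∈ I, δ ≤ c i} = ⋂ i ∈ I, {c | δ ≤ c i} := by ext; simp
  rw [this]
  exact isClosed_biInter fun i _ => isClosed_le continuous_const (continuous_apply i)

theorem upperPart_inter {k : ℕ} (δ : ℝ) (I : Finset (Fin k)) (S T : Set (Fin k → ℝ)) :
    upperPart δ I (S ∩ T) = upperPart δ I S ∩ T := inter_right_comm _ _ _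

/-- Inclusion–exclusion for the hyperplane cuts `cᵢ = δ`: the alternating sum vanishes if no point
of `S` has all its coordinates at most `δ`. -/
theorem sum_powerset_liftFun_upperPart {φ : Body n → ℂ} (hφ : IsValuation φ) {k : ℕ}
    (A : (Fin k → ℝ) →L[ℝ] E n) (δ : ℝ) (T : Finset (Fin k)) {S : Set (Fin k → ℝ)}
    (hc : Convex ℝ S) (hS : IsCompact S) (hT : ∀ c ∈ S, ∃ i ∈ T, δ < c i) :
    ∑ I ∈ T.powerset, (-1 : ℂ) ^ I.card * liftFun φ A (upperPart δ I S) = 0 := by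
  induction T using Finset.induction_on generalizing S with
  | empty =>
    have : S = ∅ := by
      refine eq_empty_of_forall_notMem fun c hcS => ?_
      obtain ⟨i, hi, -⟩ := hT c hcS
      simp at hi
    simp [this, upperPart, liftFun_empty]
  | insert i T hi ih =>
    let ℓ : (Fin k → ℝ) →L[ℝ] ℝ := ContinuousLinearMap.proj i
    rw [Finset.sum_powerset_insert hi]
    have h1 : ∀ I ∈ T.powerset,
        (-1 : ℂ) ^ I.card * liftFun φ A (upperPart δ I S) +
          (-1 : ℂ) ^ (insert i I).card * liftFun φ A (upperPart δ (insert i I) S) =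
        (-1 : ℂ) ^ I.card * liftFun φ A (upperPart δ I (S ∩ {c | ℓ c ≤ δ})) -
        (-1 : ℂ) ^ I.card * liftFun φ A
          (upperPart δ I (S ∩ ({c | ℓ c ≤ δ} ∩ {c | δ ≤ ℓ c}))) := by
      intro I hI
      have hiI : i ∉ I := fun h => hi (Finset.mem_powerset.1 hI h)
      have h2 := liftFun_cut hφ A (convex_upperPart δ I hc) (isCompact_upperPart δ I hS) ℓ δ
      have h3 : upperPart δ (insert i I) S = upperPart δ I S ∩ {c | δ ≤ ℓ c} := by
        ext c
        simp only [upperPart, Finset.forall_mem_insert, mem_inter_iff, mem_ofPred_eq, ℓ,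
          ContinuousLinearMap.proj_apply]
        tauto
      rw [Finset.card_insert_of_notMem hiI, h3, upperPart_inter, upperPart_inter, pow_succ]
      linear_combination (-1 : ℂ) ^ I.card * h2
    rw [← Finset.sum_add_distrib, Finset.sum_congr rfl h1, Finset.sum_sub_distrib,
      ih (hc.inter (convex_le ℓ δ)) (hS.inter_right (isClosed_le_clm ℓ δ)),
      ih (hc.inter ((convex_le ℓ δ).inter (convex_ge ℓ δ)))
        (hS.inter_right ((isClosed_le_clm ℓ δ).inter (isClosed_ge_clm ℓ δ))), sub_zero]
    · rintro c ⟨hcS, hc1, -⟩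
      obtain ⟨j, hj, hj'⟩ := hT c hcS
      rcases Finset.mem_insert.1 hj with rfl | hj
      · exact absurd hj' (not_lt.2 hc1)
      · exact ⟨j, hj, hj'⟩
    · rintro c ⟨hcS, hc1⟩
      obtain ⟨j, hj, hj'⟩ := hT c hcS
      rcases Finset.mem_insert.1 hj with rfl | hj
      · exact absurd hj' (not_lt.2 hc1)
      · exact ⟨j, hj, hj'⟩

end Cut

/-! ### Polynomiality of dilations of polytopes -/

/-- The convex hull of `v₁, …, v_k`, as the image of the standard simplex. -/
def polytope {k : ℕ} (hk : 0 < k) (A : (Fin k → ℝ) →L[ℝ] E n) : Body n where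
  carrier := A '' stdSimplex ℝ (Fin k)
  convex' := (convex_stdSimplex ℝ _).linear_image A.toLinearMap
  isCompact' := (isCompact_stdSimplex ℝ (Fin k)).image A.continuous
  nonempty' := by
    exact ⟨_, _, single_mem_stdSimplex ℝ (⟨0, hk⟩ : Fin k), rfl⟩

/-- The simplex of nonnegative vectors with coordinate sum `t`. -/
def simplexOf (k : ℕ) (t : ℝ) : Set (Fin k → ℝ) := {c | (∀ i, 0 ≤ c i) ∧ ∑ i, c i = t}

theorem simplexOf_eq_smul (k : ℕ) {t : ℝ} (ht : 0 < t) :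
    simplexOf k t = t • stdSimplex ℝ (Fin k) := by
  ext c
  rw [Set.mem_smul_set_iff_inv_smul_mem₀ ht.ne']
  simp only [simplexOf, stdSimplex, mem_ofPred_eq, Pi.smul_apply, smul_eq_mul, ← Finset.mul_sum]
  refine and_congr (forall_congr' fun i => ?_) ?_
  · rw [mul_nonneg_iff_of_pos_left (inv_pos.2 ht)]
  · rw [inv_mul_eq_one₀ ht.ne', eq_comm]

theorem upperPart_simplexOf {k : ℕ} {δ : ℝ} (hδ : 0 ≤ δ) (I : Finset (Fin k)) (t : ℝ) :
    upperPart δ I (simplexOf k t) =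
      (fun c => c + δ • (fun i => if i ∈ I then (1 : ℝ) else 0)) '' simplexOf k (t - I.card * δ) := by
  ext c
  have hsum : ∑ i, (δ • (fun i => if i ∈ I then (1 : ℝ) else 0) : Fin k → ℝ) i = I.card * δ := by
    simp [mul_comm]
  constructor
  · rintro ⟨⟨h0, hs⟩, hI⟩
    refine ⟨c - δ • (fun i => if i ∈ I then (1 : ℝ) else 0), ⟨fun i => ?_, ?_⟩, by simp⟩
    · by_cases hi : i ∈ I
      · simpa [hi] using hI i hi
      · simpa [hi] using h0 i
    · simp only [Pi.sub_apply, Finset.sum_sub_distrib, hs, hsum]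
  · rintro ⟨c, ⟨h0, hs⟩, rfl⟩
    refine ⟨⟨fun i => ?_, ?_⟩, fun i hi => ?_⟩
    · have := h0 i
      by_cases hi : i ∈ I <;> simp [hi] <;> linarith
    · simp only [Pi.add_apply, Finset.sum_add_distrib, hs, hsum]
      ring
    · simpa [hi] using h0 i

/-- The simplex `{c ≥ 0 : ∑ cᵢ = μ + kδ}` has no point with all coordinates at most `δ`, and its part
`{cᵢ ≥ δ for i ∈ I}` is a translate of the simplex with coordinate sum `μ + (k - |I|)δ`. Hence
inclusion–exclusion becomes a relation between translates of dilates of the polytope. -/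
theorem sum_powerset_polytope {φ : Body n → ℂ} (hφ : IsValuation φ) {k : ℕ} (hk : 0 < k)
    (A : (Fin k → ℝ) →L[ℝ] E n) {δ μ : ℝ} (hδ : 0 < δ) (hμ : 0 < μ) :
    ∑ I ∈ (Finset.univ : Finset (Fin k)).powerset, (-1 : ℂ) ^ I.card *
      φ (translate ((μ + (k - I.card : ℕ) • δ) • polytope hk A)
        (A (δ • (fun i => if i ∈ I then (1 : ℝ) else 0)))) = 0 := by
  have hc : Convex ℝ (simplexOf k (μ + k * δ)) := by
    rw [simplexOf_eq_smul k (by positivity)]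
    exact (convex_stdSimplex ℝ _).smul _
  have hS : IsCompact (simplexOf k (μ + k * δ)) := by
    rw [simplexOf_eq_smul k (by positivity)]
    exact (isCompact_stdSimplex ℝ (Fin k)).smul _
  have h := sum_powerset_liftFun_upperPart hφ A δ Finset.univ hc hS ?_
  · rw [← h]
    refine Finset.sum_congr rfl fun I _ => ?_
    congr 1
    have hcard : I.card ≤ k := by simpa using Finset.card_le_univ I
    have heq : μ + k * δ - I.card * δ = μ + (k - I.card : ℕ) • δ := by
      rw [nsmul_eq_mul, Nat.cast_sub hcard]; ring
    have hpos : 0 < μ + (k - I.card : ℕ) • δ := by positivity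
    have himg : upperPart δ I (simplexOf k (μ + k * δ)) =
        (fun c => c + δ • (fun i => if i ∈ I then (1 : ℝ) else 0)) ''
          ((μ + (k - I.card : ℕ) • δ) • stdSimplex ℝ (Fin k)) := by
      rw [upperPart_simplexOf hδ.le, heq, simplexOf_eq_smul k hpos]
    symm
    refine liftFun_eq (convex_upperPart _ _ hc) (isCompact_upperPart _ _ hS) ?_ ?_
    · rw [himg]
      exact Set.Nonempty.image _ (Set.Nonempty.smul_set
        ⟨_, single_mem_stdSimplex ℝ (⟨0, hk⟩ : Fin k)⟩)
    · rw [himg, coe_translate, ConvexBody.coe_smul]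
      change _ '' ((μ + (k - I.card : ℕ) • δ) • (A '' stdSimplex ℝ (Fin k))) = _
      rw [← image_smul_set, image_image, image_image]
      simp only [map_add]
  · rintro c ⟨h0, hs⟩
    by_contra hlt
    push Not at hlt
    have : ∑ i, c i ≤ ∑ _i : Fin k, δ := Finset.sum_le_sum fun i _ => hlt i (Finset.mem_univ i)
    rw [hs] at this
    simp at this
    linarith

theorem fwdDiff_iter_congr {f g : ℝ → ℂ} {δ : ℝ} (hδ : 0 ≤ δ) (h : ∀ t, 0 < t → f t = g t)
    (N : ℕ) {t : ℝ} (ht : 0 < t) : (fwdDiff δ)^[N] f t = (fwdDiff δ)^[N] g t := by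
  rw [fwdDiff_iter_eq_sum_shift, fwdDiff_iter_eq_sum_shift]
  refine Finset.sum_congr rfl fun j _ => ?_
  rw [h]
  positivity

/-- Iterated differences of `t ↦ φ(tP)` vanish, with a bound on the order that depends on the number
of vertices of the polytope `P`. -/
theorem fwdDiff_iter_polytope {m : ℕ} {φ : Body n → ℂ} (hφ : IsValuation φ) (hm : TransDegLT m φ)
    {k : ℕ} (hk : 0 < k) (A : (Fin k → ℝ) →L[ℝ] E n) {δ μ : ℝ} (hδ : 0 < δ) (hμ : 0 < μ) :
    (fwdDiff δ)^[m * k] (fun t : ℝ => φ (t • polytope hk A)) μ = 0 := by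
  induction m generalizing φ μ with
  | zero =>
    have h0 : φ (translate (μ • polytope hk A) 0) = 0 := hm _ _
    simpa using h0
  | succ m ih =>
    -- Up to translations, the relation says that the `k`-th difference of `t ↦ φ(tP)` vanishes. The
    -- translation differences `g I` have smaller degree, so induction applies to them.
    let y : Finset (Fin k) → E n := fun I => A (δ • (fun i => if i ∈ I then (1 : ℝ) else 0))
    let g : Finset (Fin k) → Body n → ℂ := fun I K => φ (translate K (y I)) + (-1) * φ K
    have hg : ∀ I, IsValuation (g I) := fun I => (hφ.translate_arg (y I)).add (hφ.const_mul (-1))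
    have hgm : ∀ I, TransDegLT m (g I) := by
      intro I K
      have := hm K (y I)
      simp only [g, translate_translate, neg_one_mul, ← sub_eq_add_neg]
      exact this
    let G : ℝ → ℂ := fun t => ∑ I ∈ (Finset.univ : Finset (Fin k)).powerset, (-1 : ℂ) ^ (I.card + 1) *
      g I ((t + (k - I.card : ℕ) • δ) • polytope hk A)
    have hstep : ∀ t, 0 < t → (fwdDiff δ)^[k] (fun t : ℝ => φ (t • polytope hk A)) t = G t := by
      intro t ht
      have h1 := sum_powerset_polytope hφ hk A hδ ht
      have h2 : (fwdDiff δ)^[k] (fun t : ℝ => φ (t • polytope hk A)) t =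
          ∑ I ∈ (Finset.univ : Finset (Fin k)).powerset, (-1 : ℂ) ^ I.card *
            φ ((t + (k - I.card : ℕ) • δ) • polytope hk A) := by
        rw [Finset.sum_powerset_apply_card (fun j => (-1 : ℂ) ^ j *
          φ ((t + (k - j : ℕ) • δ) • polytope hk A)), fwdDiff_iter_eq_sum_shift,
          Finset.card_univ, Fintype.card_fin, ← Finset.sum_range_reflect]
        refine Finset.sum_congr rfl fun j hj => ?_
        have hj' : j ≤ k := by simpa [Nat.lt_succ_iff] using hj
        have e1 : k + 1 - 1 - j = k - j := by omega
        have e2 : k - (k - j) = j := by omega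
        rw [e1, e2, Nat.choose_symm hj']
        simp only [zsmul_eq_mul, nsmul_eq_mul]
        push_cast
        ring
      rw [h2, ← sub_zero (∑ I ∈ _, _), ← h1, ← Finset.sum_sub_distrib]
      refine Finset.sum_congr rfl fun I _ => ?_
      simp only [g, y, pow_succ]
      ring
    rw [Nat.succ_mul, Function.iterate_add_apply, fwdDiff_iter_congr hδ.le hstep _ hμ]
    have hG : G = ∑ I ∈ (Finset.univ : Finset (Fin k)).powerset, (-1 : ℂ) ^ (I.card + 1) •
        fun t : ℝ => (fun t : ℝ => g I (t • polytope hk A)) (t + (k - I.card : ℕ) • δ) := by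
      funext t
      simp [G]
    rw [hG, fwdDiff_iter_finsetSum, Finset.sum_apply]
    refine Finset.sum_eq_zero fun I _ => ?_
    rw [fwdDiff_iter_const_smul, Pi.smul_apply, fwdDiff_iter_comp_add δ
      (fun t : ℝ => g I (t • polytope hk A)), ih (hg I) (hgm I) (by positivity),
      smul_zero]

/-! ### Polynomials from vanishing differences, and growth -/

theorem fwdDiff_iter_eq_zero_of_le {f : ℝ → ℂ} {M : ℕ} {δ : ℝ} (hδ : 0 < δ)
    (h : ∀ μ : ℝ, 0 ≤ μ → (fwdDiff δ)^[M] f μ = 0) {k : ℕ} (hk : M ≤ k) {μ : ℝ} (hμ : 0 ≤ μ) :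
    (fwdDiff δ)^[k] f μ = 0 := by
  obtain ⟨j, rfl⟩ := Nat.exists_eq_add_of_le hk
  rw [add_comm, Function.iterate_add_apply, fwdDiff_iter_eq_sum_shift]
  refine Finset.sum_eq_zero fun i _ => ?_
  rw [h _ (by positivity), smul_zero]

theorem exists_polynomial_choose (k : ℕ) : ∃ p : Polynomial ℂ, ∀ N : ℕ, p.eval (N : ℂ) = N.choose k := by
  refine ⟨Polynomial.C ((k.factorial : ℂ)⁻¹) * descPochhammer ℂ k, fun N => ?_⟩
  have hk : (k.factorial : ℂ) ≠ 0 := Nat.cast_ne_zero.2 k.factorial_ne_zero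
  rw [Polynomial.eval_mul, Polynomial.eval_C, descPochhammer_eval_eq_descFactorial,
    Nat.descFactorial_eq_factorial_mul_choose]
  push_cast
  field_simp

/-- A continuous function on `[0, ∞)` whose iterated differences of some order vanish is a
polynomial. -/
theorem exists_polynomial_of_fwdDiff {f : ℝ → ℂ} (hf : ContinuousOn f (Ici 0)) {M : ℕ}
    (h : ∀ δ : ℝ, 0 < δ → ∀ μ : ℝ, 0 < μ → (fwdDiff δ)^[M] f μ = 0) :
    ∃ p : Polynomial ℂ, ∀ t : ℝ, 0 ≤ t → f t = p.eval (t : ℂ) := by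
  -- By continuity, the hypothesis extends to `μ = 0`.
  have h0 : ∀ δ : ℝ, 0 < δ → ∀ μ : ℝ, 0 ≤ μ → (fwdDiff δ)^[M] f μ = 0 := by
    intro δ hδ μ hμ
    have hcont : ContinuousWithinAt ((fwdDiff δ)^[M] f) (Ici 0) μ := by
      have : (fwdDiff δ)^[M] f = fun y => ∑ k ∈ Finset.range (M + 1),
          ((-1 : ℤ) ^ (M - k) * M.choose k) • f (y + k • δ) :=
        funext fun y => fwdDiff_iter_eq_sum_shift _ _ _ _
      rw [this]
      have hco : ContinuousOn (fun y => ∑ k ∈ Finset.range (M + 1),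
          ((-1 : ℤ) ^ (M - k) * M.choose k) • f (y + k • δ)) (Ici 0) := by
        refine continuousOn_finsetSum _ fun k _ => ContinuousOn.const_smul ?_ _
        refine hf.comp (by fun_prop) fun y hy => ?_
        rw [mem_Ici] at hy ⊢
        positivity
      exact hco μ hμ
    have hlim := hcont.mono (show Ioi μ ⊆ Ici 0 from fun x hx => hμ.trans (le_of_lt hx))
    refine tendsto_nhds_unique hlim.tendsto ?_
    refine tendsto_const_nhds.congr' ?_
    filter_upwards [self_mem_nhdsWithin] with x hx
    exact (h δ hδ x (hμ.trans_lt hx)).symm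
  -- On each grid `δℕ`, Newton's forward difference formula gives a polynomial.
  have hgrid : ∀ δ : ℝ, 0 < δ → ∃ p : Polynomial ℂ, ∀ N : ℕ,
      f (N * δ) = p.eval ((N * δ : ℝ) : ℂ) := by
    intro δ hδ
    choose q hq using exists_polynomial_choose
    let p₀ : Polynomial ℂ := ∑ k ∈ Finset.range M, q k * Polynomial.C ((fwdDiff δ)^[k] f 0)
    refine ⟨p₀.comp (Polynomial.C ((δ : ℂ)⁻¹) * Polynomial.X), fun N => ?_⟩
    have hδ' : (δ : ℂ) ≠ 0 := Complex.ofReal_ne_zero.2 hδ.ne'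
    have e1 : (δ : ℂ)⁻¹ * ((N * δ : ℝ) : ℂ) = N := by
      push_cast
      field_simp
    rw [Polynomial.eval_comp, Polynomial.eval_mul, Polynomial.eval_C, Polynomial.eval_X, e1]
    have h1 := shift_eq_sum_fwdDiff_iter δ f N 0
    rw [zero_add, nsmul_eq_mul] at h1
    rw [h1, Polynomial.eval_finsetSum]
    simp only [Polynomial.eval_mul, Polynomial.eval_C, hq, nsmul_eq_mul]
    have e2 : ∀ k, M ≤ k → (N.choose k : ℂ) * (fwdDiff δ)^[k] f 0 = 0 := fun k hk => by
      rw [fwdDiff_iter_eq_zero_of_le hδ (h0 δ hδ) hk le_rfl, mul_zero]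
    have e3 : ∀ k, N + 1 ≤ k → (N.choose k : ℂ) * (fwdDiff δ)^[k] f 0 = 0 := fun k hk => by
      rw [Nat.choose_eq_zero_of_lt hk, Nat.cast_zero, zero_mul]
    rcases le_total (N + 1) M with hle | hle
    · refine Finset.sum_subset (Finset.range_mono hle) fun k _ hk => e3 k ?_
      simpa using hk
    · refine (Finset.sum_subset (Finset.range_mono hle) fun k _ hk => e2 k ?_).symm
      simpa using hk
  obtain ⟨p, hp⟩ := hgrid 1 one_pos
  refine ⟨p, fun t ht => ?_⟩
  -- The polynomials of the grids `q⁻¹ℕ` agree with `p` on `ℕ`, hence everywhere; density of the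
  -- rationals finishes the proof.
  have hgrid' : ∀ q N : ℕ, 0 < q → f (N / q) = p.eval ((N / q : ℝ) : ℂ) := by
    intro q N hq
    have hq' : (0 : ℝ) < q := Nat.cast_pos.2 hq
    obtain ⟨r, hr⟩ := hgrid (q : ℝ)⁻¹ (inv_pos.2 hq')
    have : r = p := by
      refine Polynomial.eq_of_infinite_eval_eq _ _ (Set.Infinite.mono ?_
        (Set.infinite_range_of_injective (f := fun N : ℕ => (N : ℂ)) Nat.cast_injective))
      rintro _ ⟨N, rfl⟩
      have h1 := hr (N * q)
      have h2 := hp N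
      have e : ((N * q : ℕ) : ℝ) * (q : ℝ)⁻¹ = N := by
        push_cast
        field_simp
      rw [e] at h1
      rw [mul_one] at h2
      rw [mem_ofPred_eq]
      simpa using h1.symm.trans h2
    rw [this] at hr
    exact hr N
  have hs : Tendsto (fun q : ℕ => ((⌊t * q⌋₊ : ℝ) / (q : ℝ))) atTop (𝓝 t) :=
    (tendsto_nat_floor_mul_div_atTop (R := ℝ) ht).comp tendsto_natCast_atTop_atTop
  have hs' : Tendsto (fun q : ℕ => ((⌊t * q⌋₊ : ℝ) / (q : ℝ))) atTop (𝓝[Ici 0] t) :=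
    tendsto_nhdsWithin_iff.2 ⟨hs, Eventually.of_forall fun q => by rw [mem_Ici]; positivity⟩
  have h1 := (hf t ht).tendsto.comp hs'
  have h2 : Tendsto (fun q : ℕ => p.eval (((⌊t * q⌋₊ : ℝ) / (q : ℝ) : ℝ) : ℂ)) atTop
      (𝓝 (p.eval (t : ℂ))) := by
    have hc : Continuous fun s : ℝ => p.eval (s : ℂ) := p.continuous.comp Complex.continuous_ofReal
    exact (hc.tendsto t).comp hs
  refine tendsto_nhds_unique h1 (h2.congr' ?_)
  filter_upwards [eventually_gt_atTop 0] with q hq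
  exact (hgrid' q _ hq).symm

/-- A polynomial that grows at most like `x ^ D` along the powers of two has degree at most `D`:
otherwise its leading coefficient, the value at `0` of the reversed polynomial, would be a limit of
terms of size `2⁻ʲ`. -/
theorem natDegree_le_of_growth {p : Polynomial ℂ} {C : ℝ} {D : ℕ}
    (h : ∀ j : ℕ, ‖p.eval ((2 : ℂ) ^ j)‖ ≤ C * ((2 : ℝ) ^ j) ^ D) : p.natDegree ≤ D := by
  by_contra hlt
  push Not at hlt
  have hp : p ≠ 0 := by
    rintro rfl
    simp at hlt
  have hrev : ∀ j : ℕ, ‖p.reverse.eval (((2 : ℂ) ^ j)⁻¹)‖ ≤ C * ((2 : ℝ)⁻¹) ^ j := by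
    intro j
    have hx : ((2 : ℂ) ^ j) ≠ 0 := pow_ne_zero _ two_ne_zero
    let _ : Invertible ((2 : ℂ) ^ j) := invertibleOfNonzero hx
    have h1 := Polynomial.eval₂_reverse_mul_pow (RingHom.id ℂ) ((2 : ℂ) ^ j) p
    rw [invOf_eq_inv] at h1
    change p.reverse.eval (((2 : ℂ) ^ j)⁻¹) * _ = p.eval ((2 : ℂ) ^ j) at h1
    have h2 := h j
    rw [← h1, norm_mul, norm_pow, norm_pow] at h2
    simp only [Complex.norm_ofNat] at h2
    obtain ⟨e, he⟩ := Nat.exists_eq_add_of_lt hlt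
    have hpos : (0 : ℝ) < ((2 : ℝ) ^ j) ^ D := by positivity
    have hb : (1 : ℝ) ≤ (2 : ℝ) ^ j := one_le_pow₀ (by norm_num)
    have hb' : (0 : ℝ) < (2 : ℝ) ^ j := by positivity
    rw [he, pow_succ, pow_add] at h2
    have h3 : ‖p.reverse.eval (((2 : ℂ) ^ j)⁻¹)‖ * ((2 : ℝ) ^ j) ≤ C := by
      have h4 : ‖p.reverse.eval (((2 : ℂ) ^ j)⁻¹)‖ * ((2 : ℝ) ^ j) * ((2 : ℝ) ^ j) ^ D ≤
          C * ((2 : ℝ) ^ j) ^ D := by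
        refine le_trans ?_ h2
        have : (1 : ℝ) ≤ ((2 : ℝ) ^ j) ^ e := one_le_pow₀ hb
        have hnn : 0 ≤ ‖p.reverse.eval (((2 : ℂ) ^ j)⁻¹)‖ * ((2 : ℝ) ^ j) * ((2 : ℝ) ^ j) ^ D := by
          positivity
        nlinarith
      exact le_of_mul_le_mul_right h4 hpos
    rw [inv_pow, ← div_eq_mul_inv, le_div_iff₀ hb']
    exact h3
  have hl1 : Tendsto (fun j : ℕ => p.reverse.eval (((2 : ℂ) ^ j)⁻¹)) atTop
      (𝓝 (p.reverse.eval 0)) := by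
    refine (p.reverse.continuous.tendsto 0).comp ?_
    simp only [← inv_pow]
    exact tendsto_pow_atTop_nhds_zero_of_norm_lt_one (by norm_num)
  have hl2 : Tendsto (fun j : ℕ => p.reverse.eval (((2 : ℂ) ^ j)⁻¹)) atTop (𝓝 0) := by
    refine squeeze_zero_norm hrev ?_
    have := (tendsto_pow_atTop_nhds_zero_of_lt_one (r := (2 : ℝ)⁻¹) (by norm_num)
      (by norm_num)).const_mul C
    simpa using this
  have h5 := tendsto_nhds_unique hl1 hl2
  rw [← Polynomial.coeff_zero_eq_eval_zero, Polynomial.coeff_zero_reverse,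
    Polynomial.leadingCoeff_eq_zero] at h5
  exact hp h5

/-- `S` lies in the box with lower corner `z` and side lengths `w`. -/
def InBox (z w : Fin n → ℝ) (S : Set (E n)) : Prop :=
  ∀ x ∈ S, ∀ i, z i ≤ x i ∧ x i ≤ z i + w i

/-- Halving one side of a box expresses the value of a valuation by three values at bodies in smaller
boxes. So doubling the sides in the directions of `s` multiplies a bound by `3 ^ |s|`. -/
theorem norm_liftFun_le_of_inBox_insert {φ : Body n → ℂ} (hφ : IsValuation φ) {Q : Set (E n)}
    {w B : ℝ}
    (hB : ∀ S : Set (E n), Convex ℝ S → IsCompact S → S ⊆ Q → ∀ z, InBox z (fun _ => w) S →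
      ‖liftFun φ (ContinuousLinearMap.id ℝ (E n)) S‖ ≤ B) (s : Finset (Fin n)) :
    ∀ S : Set (E n), Convex ℝ S → IsCompact S → S ⊆ Q →
      ∀ z, InBox z (fun i => if i ∈ s then 2 * w else w) S →
      ‖liftFun φ (ContinuousLinearMap.id ℝ (E n)) S‖ ≤ 3 ^ s.card * B := by
  induction s using Finset.induction_on with
  | empty => simpa using hB
  | insert i s hi ih =>
    intro S hc hS hQ z hz
    let ℓ : E n →L[ℝ] ℝ := EuclideanSpace.proj i
    have hcut := liftFun_cut hφ (ContinuousLinearMap.id ℝ (E n)) hc hS ℓ (z i + w)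
    have h1 := ih (S ∩ {x | ℓ x ≤ z i + w}) (hc.inter (convex_le _ _))
      (hS.inter_right (isClosed_le_clm _ _)) (inter_subset_left.trans hQ) z (by
        rintro x ⟨hx, hx'⟩ j
        have hx'' : x i ≤ z i + w := hx'
        have := hz x hx j
        by_cases hj : j = i
        · subst hj
          simp only [hi, if_false]
          exact ⟨this.1, hx''⟩
        · simpa [hj] using this)
    have h2 := ih (S ∩ {x | z i + w ≤ ℓ x}) (hc.inter (convex_ge _ _))
      (hS.inter_right (isClosed_ge_clm _ _)) (inter_subset_left.trans hQ)
      (Function.update z i (z i + w)) (by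
        rintro x ⟨hx, hx'⟩ j
        have hx'' : z i + w ≤ x i := hx'
        have := hz x hx j
        by_cases hj : j = i
        · subst hj
          simp only [Finset.mem_insert_self, if_true] at this
          simp only [hi, if_false, Function.update_self]
          exact ⟨hx'', by linarith⟩
        · simpa [hj] using this)
    have h3 := ih (S ∩ ({x | ℓ x ≤ z i + w} ∩ {x | z i + w ≤ ℓ x}))
      (hc.inter ((convex_le _ _).inter (convex_ge _ _)))
      (hS.inter_right ((isClosed_le_clm _ _).inter (isClosed_ge_clm _ _)))
      (inter_subset_left.trans hQ) z (by
        rintro x ⟨hx, hx', -⟩ j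
        have hx'' : x i ≤ z i + w := hx'
        have := hz x hx j
        by_cases hj : j = i
        · subst hj
          simp only [hi, if_false]
          exact ⟨this.1, hx''⟩
        · simpa [hj] using this)
    rw [← eq_sub_iff_add_eq] at hcut
    rw [hcut, Finset.card_insert_of_notMem hi, pow_succ]
    refine (norm_sub_le _ _).trans ?_
    have := norm_add_le (liftFun φ (ContinuousLinearMap.id ℝ (E n)) (S ∩ {x | ℓ x ≤ z i + w}))
      (liftFun φ (ContinuousLinearMap.id ℝ (E n)) (S ∩ {x | z i + w ≤ ℓ x}))
    linarith

theorem norm_liftFun_le_of_inBox_dyadic {φ : Body n → ℂ} (hφ : IsValuation φ) {Q : Set (E n)}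
    {B : ℝ}
    (hB : ∀ S : Set (E n), Convex ℝ S → IsCompact S → S ⊆ Q → ∀ z, InBox z (fun _ => 1) S →
      ‖liftFun φ (ContinuousLinearMap.id ℝ (E n)) S‖ ≤ B) (j : ℕ) :
    ∀ S : Set (E n), Convex ℝ S → IsCompact S → S ⊆ Q → ∀ z, InBox z (fun _ => 2 ^ j) S →
      ‖liftFun φ (ContinuousLinearMap.id ℝ (E n)) S‖ ≤ 3 ^ (n * j) * B := by
  induction j with
  | zero => simpa using hB
  | succ j ih =>
    intro S hc hS hQ z hz
    have h := norm_liftFun_le_of_inBox_insert hφ (w := 2 ^ j) ih Finset.univ S hc hS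
      hQ z (by simpa [pow_succ, mul_comm] using hz)
    rw [Finset.card_univ, Fintype.card_fin, ← mul_assoc, ← pow_add] at h
    rwa [Nat.mul_succ, add_comm]

theorem norm_le_of_abs_coord_le {x : E n} (h : ∀ i, |x i| ≤ 1) : ‖x‖ ≤ n + 1 := by
  rw [EuclideanSpace.norm_eq]
  refine Real.sqrt_le_iff.2 ⟨by positivity, ?_⟩
  have h1 : ∑ i, ‖x i‖ ^ 2 ≤ ∑ _i : Fin n, (1 : ℝ) := by
    refine Finset.sum_le_sum fun i _ => ?_
    rw [Real.norm_eq_abs]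
    exact pow_le_one₀ (abs_nonneg _) (h i)
  simp only [Finset.sum_const, Finset.card_univ, Fintype.card_fin, nsmul_eq_mul, mul_one] at h1
  nlinarith [h1, (Nat.cast_nonneg n : (0 : ℝ) ≤ n)]

theorem bddOn_bodiesInBall (φ : C(Body n, ℂ)) (R : ℝ) :
    ∃ C : ℝ, 0 ≤ C ∧ ∀ K ∈ bodiesInBall n R, ‖φ K‖ ≤ C := by
  obtain ⟨C, hC⟩ := (isCompact_bodiesInBall (n := n) R).exists_bound_of_continuousOn
    φ.continuous.continuousOn
  exact ⟨max C 0, le_max_right _ _, fun K hK => (hC K hK).trans (le_max_left _ _)⟩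

/-- On small bodies, a continuous functional that is polynomial under translations grows
polynomially with the distance to the origin. -/
theorem exists_bound_inBox_one (φ : C(Body n, ℂ)) {m : ℕ} (hm : TransDegLT m φ) :
    ∃ C : ℝ, 0 ≤ C ∧ ∀ ρ : ℝ, 0 ≤ ρ → ∀ K : Body n, K ∈ bodiesInBall n ρ →
      ∀ z, InBox z (fun _ => 1) (K : Set (E n)) → ‖φ K‖ ≤ C * (1 + ρ) ^ m := by
  -- Move a point `x` of `K` to the origin, giving a body `M` of bounded size, and write `x = N y` with
  -- `‖y‖ ≤ 1`. Newton's formula expresses `φ(M + N y)` by the values `φ(M + j y)`, `j < m`, with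
  -- coefficients of size at most `N ^ m`.
  obtain ⟨C, hC0, hC⟩ := bddOn_bodiesInBall φ (n + 1 + m)
  refine ⟨m * (4 ^ m * C), by positivity, fun ρ hρ K hK z hz => ?_⟩
  obtain ⟨x, hx⟩ := K.nonempty
  have hxρ := hK x hx
  let N : ℕ := ⌈‖x‖⌉₊ + 1
  have hN0 : (0 : ℝ) < N := by positivity
  have hN1 : ‖x‖ ≤ N := (Nat.le_ceil _).trans (by simp [N])
  have hN2 : (N : ℝ) ≤ 2 * (1 + ρ) := by
    have := (Nat.ceil_lt_add_one (norm_nonneg x)).le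
    simp only [N]
    push_cast
    linarith
  let y : E n := (N : ℝ)⁻¹ • x
  have hy : ‖y‖ ≤ 1 := by
    rw [norm_smul, norm_inv, Real.norm_natCast, inv_mul_le_iff₀ hN0, mul_one]
    exact hN1
  have hNy : N • y = x := by
    rw [← Nat.cast_smul_eq_nsmul ℝ, smul_smul, mul_inv_cancel₀ hN0.ne', one_smul]
  let M := translate K (-x)
  have hM : ∀ k ∈ M, ‖k‖ ≤ n + 1 := by
    rintro _ ⟨k, hk, rfl⟩
    refine norm_le_of_abs_coord_le fun i => ?_
    have h1 := hz k hk i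
    have h2 := hz x hx i
    simp only [PiLp.add_apply, PiLp.neg_apply]
    rw [abs_le]
    constructor <;> linarith
  let g : E n → ℂ := fun v => φ (translate M v)
  have hg : ∀ j : ℕ, j ≤ m → ‖g (j • y)‖ ≤ C := by
    intro j hj
    refine hC _ ?_
    rintro _ ⟨k, hk, rfl⟩
    have h1 := hM k hk
    have h2 : ‖j • y‖ ≤ m := by
      rw [← Nat.cast_smul_eq_nsmul ℝ, norm_smul, Real.norm_natCast]
      have : (j : ℝ) ≤ m := Nat.cast_le.2 hj
      nlinarith [norm_nonneg y]
    exact (norm_add_le _ _).trans (add_le_add h1 h2)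
  have hK' : φ K = g (0 + N • y) := by
    simp only [g, M]
    rw [translate_translate, zero_add, hNy, neg_add_cancel, translate_zero]
  have hvan : ∀ k, m ≤ k → (fwdDiff y)^[k] g 0 = 0 := fun k hk => by
    rw [(hm M).fwdDiff_iter y hk, Pi.zero_apply]
  have hterm : ∀ k, k < m → ‖N.choose k • (fwdDiff y)^[k] g 0‖ ≤ (2 * (1 + ρ)) ^ m * (2 ^ m * C) := by
    intro k hk
    have hone : (1 : ℝ) ≤ 2 * (1 + ρ) := by linarith
    have hone' : (1 : ℝ) ≤ N := by simp [N]
    rw [nsmul_eq_mul, norm_mul]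
    refine mul_le_mul ?_ ?_ (norm_nonneg _) (by positivity)
    · rw [Complex.norm_natCast]
      calc ((N.choose k : ℕ) : ℝ) ≤ (N : ℝ) ^ k := by exact_mod_cast Nat.choose_le_pow N k
        _ ≤ (N : ℝ) ^ m := pow_le_pow_right₀ hone' hk.le
        _ ≤ _ := by gcongr
    · rw [fwdDiff_iter_eq_sum_shift]
      calc _ ≤ ∑ j ∈ Finset.range (k + 1), (k.choose j : ℝ) * C := by
            refine (norm_sum_le _ _).trans (Finset.sum_le_sum fun j hj => ?_)
            rw [zsmul_eq_mul, norm_mul, zero_add]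
            push_cast
            rw [norm_mul, norm_pow, norm_neg, norm_one, one_pow, one_mul, Complex.norm_natCast]
            gcongr
            exact hg j (by have := Finset.mem_range.1 hj; omega)
        _ = 2 ^ k * C := by
            rw [← Finset.sum_mul]
            congr 1
            exact_mod_cast Nat.sum_range_choose k
        _ ≤ 2 ^ m * C := by
            gcongr
            norm_num
  rw [hK', shift_eq_sum_fwdDiff_iter y g N 0]
  have hsub : ∑ k ∈ Finset.range (N + 1), N.choose k • (fwdDiff y)^[k] g 0 =
      ∑ k ∈ Finset.range m, N.choose k • (fwdDiff y)^[k] g 0 := by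
    rcases le_total (N + 1) m with hle | hle
    · refine Finset.sum_subset (Finset.range_mono hle) fun k _ hk => ?_
      rw [Finset.mem_range, not_lt] at hk
      rw [Nat.choose_eq_zero_of_lt hk, zero_smul]
    · refine (Finset.sum_subset (Finset.range_mono hle) fun k _ hk => ?_).symm
      rw [Finset.mem_range, not_lt] at hk
      rw [hvan k hk, smul_zero]
  rw [hsub]
  calc _ ≤ ∑ k ∈ Finset.range m, (2 * (1 + ρ)) ^ m * (2 ^ m * C) :=
        (norm_sum_le _ _).trans (Finset.sum_le_sum fun k hk => hterm k (Finset.mem_range.1 hk))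
    _ = m * (4 ^ m * C) * (1 + ρ) ^ m := by
        rw [Finset.sum_const, Finset.card_range, nsmul_eq_mul, mul_pow,
          show (4 : ℝ) = 2 * 2 by norm_num, mul_pow]
        ring

/-- Polynomial growth of `t ↦ φ(tP)` along powers of two. -/
theorem exists_growth_bound (φ : C(Body n, ℂ)) (hφ : IsValuation φ) {m : ℕ} (hm : TransDegLT m φ)
    (P : Body n) : ∃ C : ℝ, ∀ j : ℕ, ‖φ ((2 : ℝ) ^ j • P)‖ ≤ C * ((2 : ℝ) ^ j) ^ (2 * n + m) := by
  obtain ⟨C, hC0, hC⟩ := exists_bound_inBox_one φ hm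
  obtain ⟨R, hR0, hR⟩ := exists_norm_le P
  obtain ⟨a, ha⟩ := pow_unbounded_of_one_lt (2 * R) (one_lt_two)
  refine ⟨3 ^ (n * a) * C * (1 + R) ^ m, fun j => ?_⟩
  have hj : (0 : ℝ) < 2 ^ j := by positivity
  have hj1 : (1 : ℝ) ≤ 2 ^ j := one_le_pow₀ (by norm_num)
  let ρ : ℝ := 2 ^ j * R
  have hρ : 0 ≤ ρ := by positivity
  let L := (2 : ℝ) ^ j • P
  have hL : ∀ x ∈ L, ‖x‖ ≤ ρ := by
    intro x hx
    obtain ⟨k, hk, rfl⟩ := Set.mem_smul_set.1 (show x ∈ (2 : ℝ) ^ j • (P : Set (E n)) from hx)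
    rw [norm_smul, Real.norm_of_nonneg hj.le]
    exact mul_le_mul_of_nonneg_left (hR k hk) hj.le
  have hbox : InBox (fun _ => -ρ) (fun _ => 2 ^ (j + a)) (L : Set (E n)) := by
    intro x hx i
    have h1 : ‖x i‖ ≤ ‖x‖ := PiLp.norm_apply_le x i
    rw [Real.norm_eq_abs, abs_le] at h1
    have h2 := hL x hx
    have h3 : 2 * ρ ≤ 2 ^ (j + a) := by
      simp only [ρ]
      rw [pow_add]
      nlinarith
    constructor <;> linarith
  have h := norm_liftFun_le_of_inBox_dyadic hφ (Q := {x | ‖x‖ ≤ ρ}) (B := C * (1 + ρ) ^ m) ?_ (j + a) L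
    L.convex L.isCompact hL _ hbox
  · rw [liftFun_eq L.convex L.isCompact L.nonempty (K := L) (by simp)] at h
    refine h.trans ?_
    have h3 : (1 + ρ) ^ m ≤ ((2 : ℝ) ^ j) ^ m * (1 + R) ^ m := by
      rw [← mul_pow]
      gcongr
      simp only [ρ]
      nlinarith
    -- `3 ≤ 2 ^ 2` is where the exponent `2 * n` comes from.
    have h4 : (3 : ℝ) ^ (n * j) ≤ ((2 : ℝ) ^ j) ^ (2 * n) := by
      rw [← pow_mul, show j * (2 * n) = 2 * (n * j) by ring, pow_mul (2 : ℝ) 2]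
      exact pow_le_pow_left₀ (by norm_num) (by norm_num) _
    calc (3 : ℝ) ^ (n * (j + a)) * (C * (1 + ρ) ^ m)
        = 3 ^ (n * j) * (3 ^ (n * a) * C) * (1 + ρ) ^ m := by rw [mul_add, pow_add]; ring
      _ ≤ ((2 : ℝ) ^ j) ^ (2 * n) * (3 ^ (n * a) * C) * (((2 : ℝ) ^ j) ^ m * (1 + R) ^ m) := by
          gcongr
      _ = _ := by rw [pow_add]; ring
  · intro S hc hS hQ z hz
    by_cases hne : S.Nonempty
    · rw [liftFun_eq hc hS hne (K := ⟨S, hc, hS, hne⟩) (by simp)]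
      exact hC ρ hρ _ (fun x hx => hQ hx) z hz
    · rw [not_nonempty_iff_eq_empty.1 hne, liftFun_empty, norm_zero]
      positivity

/-! ### Polynomiality of dilations -/

/-- The Lagrange basis polynomial of the node `i` for the nodes `0, …, D`. -/
def lagr (D i : ℕ) : Polynomial ℂ := Lagrange.basis (Finset.range (D + 1)) (fun j : ℕ => (j : ℂ)) i

theorem eq_sum_lagr {D : ℕ} {p : Polynomial ℂ} (hp : p.natDegree ≤ D) :
    p = ∑ i ∈ Finset.range (D + 1), Polynomial.C (p.eval (i : ℂ)) * lagr D i := by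
  have h := Lagrange.eq_interpolate (s := Finset.range (D + 1)) (v := fun j : ℕ => (j : ℂ))
    Nat.cast_injective.injOn (f := p) (by
      rw [Finset.card_range]
      exact (Polynomial.degree_le_natDegree).trans_lt (by exact_mod_cast Nat.lt_succ_of_le hp))
  rw [Lagrange.interpolate_apply] at h
  exact h

theorem natDegree_lagr_le {D i : ℕ} (hi : i ∈ Finset.range (D + 1)) : (lagr D i).natDegree ≤ D := by
  refine Polynomial.natDegree_le_of_degree_le ?_
  rw [lagr, Lagrange.degree_basis Nat.cast_injective.injOn hi, Finset.card_range]
  simp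

/-- `t ↦ φ(tK + L)` is, for all `K` and `L`, a polynomial of degree at most `D` in `t ≥ 0` (expressed
by Lagrange interpolation at the nodes `0, …, D`). -/
def DilPoly (D : ℕ) (φ : Body n → ℂ) : Prop :=
  ∀ (K L : Body n) (t : ℝ), 0 ≤ t →
    φ (t • K + L) = ∑ i ∈ Finset.range (D + 1), φ ((i : ℝ) • K + L) * (lagr D i).eval (t : ℂ)

theorem exists_polytope_dist_lt (K : Body n) {ε : ℝ} (hε : 0 < ε) :
    ∃ (k : ℕ) (hk : 0 < k) (A : (Fin k → ℝ) →L[ℝ] E n), dist (polytope hk A) K < ε := by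
  obtain ⟨T, hTK, hT, hcov⟩ := K.isCompact.finite_cover_balls (half_pos hε)
  have hTne : T.Nonempty := by
    obtain ⟨x, hx⟩ := K.nonempty
    obtain ⟨y, hy, -⟩ := mem_iUnion₂.1 (hcov hx)
    exact ⟨y, hy⟩
  have := hT.fintype
  let e := Fintype.equivFin T
  have hk : 0 < Fintype.card T := Fintype.card_pos_iff.2 hTne.to_subtype
  let v : Fin (Fintype.card T) → E n := fun i => e.symm i
  let A : (Fin (Fintype.card T) → ℝ) →L[ℝ] E n :=
    ∑ i, (ContinuousLinearMap.proj (φ := fun _ : Fin (Fintype.card T) => ℝ) i).smulRight (v i)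
  have hA : ∀ c, A c = ∑ i, c i • v i := fun c => by simp [A]
  refine ⟨_, hk, A, ?_⟩
  refine (Metric.hausdorffDist_le_of_mem_dist (half_pos hε).le ?_ ?_).trans_lt (half_lt_self hε)
  · rintro _ ⟨c, hc, rfl⟩
    refine ⟨A c, ?_, by rw [dist_self]; positivity⟩
    rw [hA]
    exact K.convex.sum_mem (fun i _ => hc.1 i) hc.2 fun i _ => hTK (e.symm i).2
  · intro x hx
    obtain ⟨y, hy, hxy⟩ := mem_iUnion₂.1 (hcov hx)
    refine ⟨y, ⟨_, single_mem_stdSimplex ℝ (e ⟨y, hy⟩), ?_⟩, (Metric.mem_ball.1 hxy).le⟩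
    rw [hA]
    simp [Pi.single_apply, v]

/-- McMullen's theorem: continuous polynomial valuations are polynomial under Minkowski
combinations. -/
theorem dilPoly_of_isValuation (φ : C(Body n, ℂ)) (hφ : IsValuation φ) {m : ℕ}
    (hm : TransDegLT m φ) : DilPoly (2 * n + m) φ := by
  -- it suffices to treat `L = 0`, since `K ↦ φ(K + L)` is a valuation of the same kind
  suffices H : ∀ (ψ : C(Body n, ℂ)), IsValuation ψ → TransDegLT m ψ → ∀ (K : Body n) (t : ℝ), 0 ≤ t →
      ψ (t • K) = ∑ i ∈ Finset.range (2 * n + m + 1), ψ ((i : ℝ) • K) *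
        (lagr (2 * n + m) i).eval (t : ℂ) by
    intro K L t ht
    exact H ⟨fun K => φ (K + L), by fun_prop⟩ (hφ.add_right L) (hm.add_right L) K t ht
  intro ψ hψ hψm K t ht
  -- The interpolation formula is a closed condition on `K`, so polytopes suffice.
  have hclosed : IsClosed {K : Body n | ψ (t • K) = ∑ i ∈ Finset.range (2 * n + m + 1),
      ψ ((i : ℝ) • K) * (lagr (2 * n + m) i).eval (t : ℂ)} := by
    refine isClosed_eq (ψ.continuous.comp (continuous_smul_body ht)) ?_
    refine continuous_finsetSum _ fun i _ => Continuous.mul ?_ continuous_const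
    exact ψ.continuous.comp (continuous_smul_body (Nat.cast_nonneg i))
  refine hclosed.closure_subset_iff.2 subset_rfl (Metric.mem_closure_iff.2 ?_ : K ∈ closure _)
  intro ε hε
  obtain ⟨k, hk, A, hd⟩ := exists_polytope_dist_lt K hε
  refine ⟨polytope hk A, ?_, by rwa [dist_comm]⟩
  obtain ⟨p, hp⟩ := exists_polynomial_of_fwdDiff
    (ψ.continuous.comp_continuousOn (continuousOn_smul_body (polytope hk A)))
    (M := m * k) fun δ hδ μ hμ => fwdDiff_iter_polytope hψ hψm hk A hδ hμ
  have hdeg : p.natDegree ≤ 2 * n + m := by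
    obtain ⟨C, hC⟩ := exists_growth_bound ψ hψ hψm (polytope hk A)
    refine natDegree_le_of_growth (C := C) fun j => ?_
    have h1 := hp (2 ^ j) (by positivity)
    push_cast at h1
    rw [← h1]
    exact hC j
  have h1 := congrArg (Polynomial.eval (t : ℂ)) (eq_sum_lagr hdeg)
  rw [Polynomial.eval_finsetSum] at h1
  rw [mem_ofPred_eq]
  refine (hp t ht).trans (h1.trans (Finset.sum_congr rfl fun i _ => ?_))
  rw [Polynomial.eval_mul, Polynomial.eval_C]
  congr 1
  have := hp i (Nat.cast_nonneg i)
  push_cast at this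
  exact this.symm

/-! ### Coefficients of dilation polynomials and homogeneous components -/

/-- The coefficient of `t ^ r` in the polynomial of degree at most `D` with values `f 0, …, f D` at
`0, …, D`. -/
def coeffAt (D r : ℕ) (f : ℕ → ℂ) : ℂ := ∑ i ∈ Finset.range (D + 1), (lagr D i).coeff r * f i

theorem coeffAt_eq {D r : ℕ} {f : ℕ → ℂ} {q : Polynomial ℂ} (hq : q.natDegree ≤ D)
    (h : ∀ i : ℕ, f i = q.eval (i : ℂ)) : coeffAt D r f = q.coeff r := by
  conv_rhs => rw [eq_sum_lagr hq]
  rw [Polynomial.finsetSum_coeff, coeffAt]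
  refine Finset.sum_congr rfl fun i _ => ?_
  rw [Polynomial.coeff_C_mul, h, mul_comm]

/-- The polynomial with values `φ(tK + L)` for `t ≥ 0`. -/
def dilationPolynomial (D : ℕ) (φ : Body n → ℂ) (K L : Body n) : Polynomial ℂ :=
  ∑ i ∈ Finset.range (D + 1), Polynomial.C (φ ((i : ℝ) • K + L)) * lagr D i

theorem natDegree_dilationPolynomial_le (D : ℕ) (φ : Body n → ℂ) (K L : Body n) :
    (dilationPolynomial D φ K L).natDegree ≤ D :=
  Polynomial.natDegree_sum_le_of_forall_le _ _ fun _ hi =>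
    (Polynomial.natDegree_C_mul_le _ _).trans (natDegree_lagr_le hi)

theorem DilPoly.eval_eq {D : ℕ} {φ : Body n → ℂ} (h : DilPoly D φ) (K L : Body n) {t : ℝ}
    (ht : 0 ≤ t) : (dilationPolynomial D φ K L).eval (t : ℂ) = φ (t • K + L) := by
  rw [h K L t ht, dilationPolynomial, Polynomial.eval_finsetSum]
  simp

theorem coeff_dilationPolynomial (D : ℕ) (φ : Body n → ℂ) (K L : Body n) (r : ℕ) :
    (dilationPolynomial D φ K L).coeff r = coeffAt D r fun i => φ ((i : ℝ) • K + L) := by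
  rw [dilationPolynomial, Polynomial.finsetSum_coeff, coeffAt]
  refine Finset.sum_congr rfl fun i _ => ?_
  rw [Polynomial.coeff_C_mul, mul_comm]

theorem polynomial_eq_of_eval_nonneg {p q : Polynomial ℂ}
    (h : ∀ t : ℝ, 0 ≤ t → p.eval (t : ℂ) = q.eval (t : ℂ)) : p = q := by
  refine Polynomial.eq_of_infinite_eval_eq _ _ (Set.Infinite.mono ?_
    (Set.infinite_range_of_injective (f := fun N : ℕ => (N : ℂ)) Nat.cast_injective))
  rintro _ ⟨N, rfl⟩
  rw [mem_ofPred_eq]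
  have := h N (Nat.cast_nonneg N)
  simpa using this

theorem IsPolynomialValuationOfDegree.zero (d : ℕ) :
    IsPolynomialValuationOfDegree d (0 : Body n → ℂ) :=
  ⟨fun K L U I _ _ => by simp, fun K => ⟨0, by simp, fun x => by simp⟩⟩

theorem IsPolynomialValuationOfDegree.add {d : ℕ} {φ ψ : Body n → ℂ}
    (h : IsPolynomialValuationOfDegree d φ) (h' : IsPolynomialValuationOfDegree d ψ) :
    IsPolynomialValuationOfDegree d (φ + ψ) := by
  refine ⟨h.1.add h'.1, fun K => ?_⟩
  obtain ⟨p, hp, hp'⟩ := h.2 K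
  obtain ⟨q, hq, hq'⟩ := h'.2 K
  exact ⟨p + q, (MvPolynomial.totalDegree_add _ _).trans (max_le hp hq), fun x => by simp [hp', hq']⟩

theorem IsPolynomialValuationOfDegree.smul {d : ℕ} {φ : Body n → ℂ}
    (h : IsPolynomialValuationOfDegree d φ) (c : ℂ) : IsPolynomialValuationOfDegree d (c • φ) := by
  refine ⟨h.1.const_mul c, fun K => ?_⟩
  obtain ⟨p, hp, hp'⟩ := h.2 K
  exact ⟨c • p, (MvPolynomial.totalDegree_smul_le _ _).trans hp, fun x => by simp [hp']⟩

theorem IsPolynomialValuationOfDegree.sum {d : ℕ} {ι : Type*} (s : Finset ι) {φ : ι → Body n → ℂ}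
    (h : ∀ i ∈ s, IsPolynomialValuationOfDegree d (φ i)) :
    IsPolynomialValuationOfDegree d (∑ i ∈ s, φ i) :=
  Finset.sum_induction _ _ (fun _ _ => IsPolynomialValuationOfDegree.add)
    (IsPolynomialValuationOfDegree.zero d) h

theorem IsPolynomialValuationOfDegree.mono {d e : ℕ} (hde : d ≤ e) {φ : Body n → ℂ}
    (h : IsPolynomialValuationOfDegree d φ) : IsPolynomialValuationOfDegree e φ :=
  ⟨h.1, fun K => (h.2 K).imp fun _ hp => ⟨hp.1.trans hde, hp.2⟩⟩

theorem IsPolynomialValuationOfDegree.smul_arg {d : ℕ} {φ : Body n → ℂ}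
    (h : IsPolynomialValuationOfDegree d φ) {t : ℝ} (ht : 0 ≤ t) :
    IsPolynomialValuationOfDegree d fun K => φ (t • K) := by
  refine ⟨h.1.smul_arg ht, fun K => ?_⟩
  obtain ⟨p, hp, hp'⟩ := h.2 (t • K)
  refine ⟨∑ s ∈ p.support, MvPolynomial.monomial s (p.coeff s * ∏ i ∈ s.support, (t : ℂ) ^ s i), ?_,
    fun x => ?_⟩
  · refine (MvPolynomial.totalDegree_finsetSum_le fun s hs => ?_)
    exact (MvPolynomial.totalDegree_monomial_le _ _).trans ((MvPolynomial.le_totalDegree hs).trans hp)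
  · change φ (t • translate K x) = _
    rw [smul_translate, hp', MvPolynomial.eval_eq, map_sum]
    refine Finset.sum_congr rfl fun s _ => ?_
    rw [MvPolynomial.eval_monomial, mul_assoc, Finsupp.prod, ← Finset.prod_mul_distrib]
    congr 1
    refine Finset.prod_congr rfl fun i _ => ?_
    simp [mul_pow]

/-- The `r`-homogeneous component of a functional with polynomial dilations, as a combination of the
functionals `K ↦ φ(iK)`, `i = 0, …, D`. -/
def homPart (D : ℕ) (φ : C(Body n, ℂ)) (r : ℕ) : C(Body n, ℂ) :=
  ∑ i ∈ Finset.range (D + 1), (lagr D i).coeff r •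
    φ.comp ⟨fun K => (i : ℝ) • K, continuous_smul_body (Nat.cast_nonneg i)⟩

theorem homPart_apply (D : ℕ) (φ : C(Body n, ℂ)) (r : ℕ) (K : Body n) :
    homPart D φ r K = (dilationPolynomial D φ K 0).coeff r := by
  rw [coeff_dilationPolynomial, homPart, coeffAt]
  simp

theorem isPolynomialValuationOfDegree_homPart {D d : ℕ} {φ : C(Body n, ℂ)}
    (h : IsPolynomialValuationOfDegree d φ) (r : ℕ) :
    IsPolynomialValuationOfDegree d (homPart D φ r) := by
  have : (homPart D φ r : Body n → ℂ) = ∑ i ∈ Finset.range (D + 1), (lagr D i).coeff r •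
      fun K : Body n => φ ((i : ℝ) • K) := by
    funext K
    simp [homPart]
  rw [this]
  exact IsPolynomialValuationOfDegree.sum _ fun i _ => (h.smul_arg (Nat.cast_nonneg i)).smul _

theorem isHomogeneous_homPart {D : ℕ} {φ : C(Body n, ℂ)} (h : DilPoly D φ) (r : ℕ) :
    IsHomogeneous r (homPart D φ r) := by
  intro s K hs
  rw [homPart_apply, homPart_apply]
  have : dilationPolynomial D φ (s • K) 0 =
      (dilationPolynomial D φ K 0).comp (Polynomial.C (s : ℂ) * Polynomial.X) := by
    refine polynomial_eq_of_eval_nonneg fun t ht => ?_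
    rw [h.eval_eq _ _ ht, Polynomial.eval_comp, Polynomial.eval_mul, Polynomial.eval_C,
      Polynomial.eval_X, ← Complex.ofReal_mul, h.eval_eq _ _ (mul_nonneg hs ht), smul_smul, mul_comm]
  rw [this, Polynomial.comp_C_mul_X_coeff, mul_comm]

theorem sum_homPart {D : ℕ} {φ : C(Body n, ℂ)} (h : DilPoly D φ) :
    φ = ∑ r ∈ Finset.range (D + 1), homPart D φ r := by
  ext K
  have h1 := h.eval_eq K 0 zero_le_one
  rw [one_smul, add_zero, Polynomial.eval_eq_sum_range' (Nat.lt_succ_of_le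
    (natDegree_dilationPolynomial_le D φ K 0))] at h1
  rw [← h1, ContinuousMap.sum_apply]
  simp [homPart_apply]

/-- Homogeneous decompositions are unique. -/
theorem IsHomogeneousDecomposition.unique {φ : C(Body n, ℂ)} {d d' : ℕ} {ψ ψ' : ℕ → C(Body n, ℂ)}
    (h : IsHomogeneousDecomposition φ d ψ) (h' : IsHomogeneousDecomposition φ d' ψ') : ψ = ψ' := by
  have key : ∀ {d : ℕ} {ψ : ℕ → C(Body n, ℂ)}, IsHomogeneousDecomposition φ d ψ → ∀ K : Body n,
      ∃ p : Polynomial ℂ, (∀ r, p.coeff r = ψ r K) ∧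
        ∀ t : ℝ, 0 ≤ t → p.eval (t : ℂ) = φ (t • K) := by
    intro d ψ h K
    refine ⟨∑ r ∈ Finset.range (d + n + 1), Polynomial.monomial r (ψ r K), fun r => ?_, fun t ht => ?_⟩
    · rw [Polynomial.finsetSum_coeff]
      simp only [Polynomial.coeff_monomial, Finset.sum_ite_eq', Finset.mem_range]
      split_ifs with hr
      · rfl
      · rw [h.2.1 r (by omega), ContinuousMap.zero_apply]
    · rw [Polynomial.eval_finsetSum]
      conv_rhs => rw [h.2.2]
      rw [ContinuousMap.sum_apply]
      refine Finset.sum_congr rfl fun r _ => ?_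
      rw [Polynomial.eval_monomial, (h.1 r).2 t K ht, mul_comm]
  funext r
  ext K
  obtain ⟨p, hp, hp'⟩ := key h K
  obtain ⟨q, hq, hq'⟩ := key h' K
  have : p = q := polynomial_eq_of_eval_nonneg fun t ht => by rw [hp' t ht, hq' t ht]
  rw [← hp, ← hq, this]

theorem homComponent_eq {φ : C(Body n, ℂ)} {d : ℕ} {ψ : ℕ → C(Body n, ℂ)}
    (h : IsHomogeneousDecomposition φ d ψ) : homComponent φ = ψ := by
  have hex : ∃ ψ : ℕ → C(Body n, ℂ), ∃ d, IsHomogeneousDecomposition φ d ψ := ⟨ψ, d, h⟩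
  rw [homComponent, dif_pos hex]
  obtain ⟨d', h'⟩ := hex.choose_spec
  exact h'.unique h

theorem homComponent_of_isHomogeneous {ψ : C(Body n, ℂ)} (hψ : IsPolynomialValuation ψ) {r : ℕ}
    (hr : IsHomogeneous r ψ) (s : ℕ) : homComponent ψ s = if s = r then ψ else 0 := by
  obtain ⟨d, hd⟩ := hψ
  have : IsHomogeneousDecomposition ψ (d + r) fun s => if s = r then ψ else 0 := by
    refine ⟨fun s => ?_, fun s hs => if_neg (by omega), ?_⟩
    · by_cases hs : s = r
      · subst hs
        simp only [if_true]
        exact ⟨hd.mono (by omega), hr⟩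
      · simp only [hs, if_false]
        exact ⟨IsPolynomialValuationOfDegree.zero _, fun t K _ => by simp⟩
    · rw [Finset.sum_ite_eq', if_pos (by rw [Finset.mem_range]; omega)]
  rw [homComponent_eq this]

/-! ### Polarization -/

/-- Inclusion–exclusion: only the bijections survive in the alternating sum over all sets `I` of the
sums over the maps with values in `I`. -/
theorem sum_powerset_neg_one_pow_piFinset {r : ℕ} (b : (Fin r → Fin r) → ℂ) :
    ∑ I ∈ (Finset.univ : Finset (Fin r)).powerset, (-1 : ℂ) ^ I.card *
      ∑ g ∈ Fintype.piFinset (fun _ : Fin r => I), b g =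
    (-1) ^ r * ∑ σ : Equiv.Perm (Fin r), b σ := by
  have h1 : ∀ I : Finset (Fin r), ∑ g ∈ Fintype.piFinset (fun _ : Fin r => I), b g =
      ∑ g : Fin r → Fin r, if ∀ j, g j ∈ I then b g else 0 := by
    intro I
    rw [← Finset.sum_filter]
    refine Finset.sum_congr ?_ fun _ _ => rfl
    ext g
    simp [Fintype.mem_piFinset]
  have h2 : ∀ g : Fin r → Fin r, ∑ I ∈ (Finset.univ : Finset (Fin r)).powerset,
      (-1 : ℂ) ^ I.card * (if ∀ j, g j ∈ I then 1 else 0) =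
      if Function.Surjective g then (-1) ^ r else 0 := by
    intro g
    have h3 := Finset.prod_add (fun _ : Fin r => (-1 : ℂ))
      (fun i => if ∃ j, g j = i then (0 : ℂ) else 1) Finset.univ
    have h4 : ∀ I ∈ (Finset.univ : Finset (Fin r)).powerset,
        (∏ i ∈ I, (-1 : ℂ)) * ∏ i ∈ Finset.univ \ I, (if ∃ j, g j = i then (0 : ℂ) else 1) =
        (-1 : ℂ) ^ I.card * (if ∀ j, g j ∈ I then 1 else 0) := by
      intro I _
      rw [Finset.prod_const]
      congr 1
      split_ifs with h
      · refine Finset.prod_eq_one fun i hi => if_neg ?_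
        rintro ⟨j, rfl⟩
        exact (Finset.mem_sdiff.1 hi).2 (h j)
      · push Not at h
        obtain ⟨j, hj⟩ := h
        exact Finset.prod_eq_zero (Finset.mem_sdiff.2 ⟨Finset.mem_univ _, hj⟩) (if_pos ⟨j, rfl⟩)
    rw [Finset.sum_congr rfl h4] at h3
    rw [← h3]
    split_ifs with h
    · have : ∀ i : Fin r, (-1 : ℂ) + (if ∃ j, g j = i then (0 : ℂ) else 1) = -1 := fun i => by
        rw [if_pos (h i), add_zero]
      simp only [this, Finset.prod_const, Finset.card_univ, Fintype.card_fin]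
    · rw [Function.Surjective] at h
      push Not at h
      obtain ⟨i, hi⟩ := h
      refine Finset.prod_eq_zero (Finset.mem_univ i) ?_
      rw [if_neg (by push Not; exact hi)]
      norm_num
  simp only [h1, Finset.mul_sum]
  rw [Finset.sum_comm]
  have h5 : ∀ g : Fin r → Fin r, ∑ I ∈ (Finset.univ : Finset (Fin r)).powerset,
      (-1 : ℂ) ^ I.card * (if ∀ j, g j ∈ I then b g else 0) =
      if Function.Surjective g then (-1) ^ r * b g else 0 := by
    intro g
    have : ∀ I ∈ (Finset.univ : Finset (Fin r)).powerset,
        (-1 : ℂ) ^ I.card * (if ∀ j, g j ∈ I then b g else 0) =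
        ((-1 : ℂ) ^ I.card * (if ∀ j, g j ∈ I then 1 else 0)) * b g := fun I _ => by
      split_ifs <;> simp
    rw [Finset.sum_congr rfl this, ← Finset.sum_mul, h2]
    split_ifs <;> simp
  rw [Finset.sum_congr rfl fun g _ => h5 g, ← Finset.sum_filter]
  refine (Finset.sum_bij (fun (σ : Equiv.Perm (Fin r)) _ => (σ : Fin r → Fin r)) ?_ ?_ ?_ ?_).symm
  · intro σ _
    simpa using σ.surjective
  · intro σ _ τ _ h
    exact Equiv.coe_fn_injective h
  · intro g hg
    have hg' : Function.Surjective g := (Finset.mem_filter.1 hg).2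
    exact ⟨Equiv.ofBijective g (Finite.surjective_iff_bijective.1 hg'), Finset.mem_univ _, rfl⟩
  · intro σ _
    rfl

/-- The polarization formula for symmetric multilinear maps. -/
theorem polarization_formula {R M : Type*} [CommSemiring R] [AddCommMonoid M] [Module R M]
    [Module R ℂ] {r : ℕ} (S : MultilinearMap R (fun _ : Fin r => M) ℂ)
    (hS : ∀ (σ : Equiv.Perm (Fin r)) (x : Fin r → M), S (x ∘ σ) = S x) (x : Fin r → M) :
    S x = (r.factorial : ℂ)⁻¹ * ∑ I ∈ (Finset.univ : Finset (Fin r)).powerset,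
      (-1 : ℂ) ^ (r + I.card) * S fun _ => ∑ i ∈ I, x i := by
  have h := sum_powerset_neg_one_pow_piFinset fun g : Fin r → Fin r => S (x ∘ g)
  have h1 : ∀ I : Finset (Fin r), S (fun _ => ∑ i ∈ I, x i) =
      ∑ g ∈ Fintype.piFinset (fun _ : Fin r => I), S (x ∘ g) := fun I =>
    S.map_sum_finset (fun _ j => x j) fun _ => I
  have h2 : ∑ σ : Equiv.Perm (Fin r), S (x ∘ σ) = r.factorial * S x := by
    simp only [hS, Finset.sum_const, Finset.card_univ, Fintype.card_perm, Fintype.card_fin,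
      nsmul_eq_mul]
  rw [h2] at h
  have hr : (r.factorial : ℂ) ≠ 0 := Nat.cast_ne_zero.2 r.factorial_ne_zero
  rw [eq_inv_mul_iff_mul_eq₀ hr]
  simp only [h1, pow_add, mul_assoc]
  rw [← Finset.mul_sum, h, ← mul_assoc, ← pow_add, ← two_mul, pow_mul]
  simp

/-- The expansion at `∑_{i ∈ I} Kᵢ`, for all sets `I` of indices, determines the polarization. -/
theorem IsPolarization.unique {r : ℕ} {φ : Body n → ℂ} {B B' : (Fin r → Body n) → ℂ}
    (h : IsPolarization φ B) (h' : IsPolarization φ B') : B = B' := by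
  funext K
  have key : ∀ {B : (Fin r → Body n) → ℂ}, IsPolarization φ B →
      (-1) ^ r * ((r.factorial : ℂ) * B K) =
      ∑ I ∈ (Finset.univ : Finset (Fin r)).powerset, (-1 : ℂ) ^ I.card *
        φ (∑ i, (if i ∈ I then (1 : ℝ) else 0) • K i) := by
    intro B h
    have h1 := sum_powerset_neg_one_pow_piFinset fun g : Fin r → Fin r => B fun j => K (g j)
    have h2 : ∑ σ : Equiv.Perm (Fin r), B (fun j => K (σ j)) = r.factorial * B K := by
      have : ∀ σ : Equiv.Perm (Fin r), B (fun j => K (σ j)) = B K := fun σ => h.symmetric σ K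
      simp only [this, Finset.sum_const, Finset.card_univ, Fintype.card_perm, Fintype.card_fin,
        nsmul_eq_mul]
    rw [h2] at h1
    rw [← h1]
    refine Finset.sum_congr rfl fun I _ => ?_
    rw [h.expansion r K _ (fun i => by split_ifs <;> norm_num)]
    congr 1
    have h3 : ∀ g : Fin r → Fin r, (∏ j, (((if g j ∈ I then (1 : ℝ) else 0) : ℝ) : ℂ)) * B (fun j => K (g j)) =
        if ∀ j, g j ∈ I then B (fun j => K (g j)) else 0 := by
      intro g
      split_ifs with hg
      · rw [Finset.prod_eq_one fun j _ => by rw [if_pos (hg j), Complex.ofReal_one], one_mul]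
      · push Not at hg
        obtain ⟨j, hj⟩ := hg
        rw [Finset.prod_eq_zero (Finset.mem_univ j) (by rw [if_neg hj, Complex.ofReal_zero]), zero_mul]
    rw [Finset.sum_congr rfl fun g _ => h3 g, ← Finset.sum_filter]
    refine Finset.sum_congr ?_ fun _ _ => rfl
    ext g
    simp [Fintype.mem_piFinset]
  have hr : (r.factorial : ℂ) ≠ 0 := Nat.cast_ne_zero.2 r.factorial_ne_zero
  have h1 := (key h).trans (key h').symm
  have h3 : ((-1 : ℂ)) ^ r ≠ 0 := pow_ne_zero _ (by norm_num)
  exact mul_left_cancel₀ hr (mul_left_cancel₀ h3 h1)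

theorem smul_eq_toNNReal_smul (K : Body n) {t : ℝ} (ht : 0 ≤ t) : t • K = t.toNNReal • K := by
  apply supportFun_injective
  rw [supportFun_smul ht, supportFun_nnsmul, Real.coe_toNNReal t ht]

/-- A continuous symmetric multilinear functional of convex bodies is the polarization of its
restriction to the diagonal. -/
theorem isPolarization_of_multilinear {r : ℕ} (S : MultilinearMap ℝ≥0 (fun _ : Fin r => Body n) ℂ)
    (hcont : Continuous S) (hsymm : ∀ (σ : Equiv.Perm (Fin r)) (K : Fin r → Body n), S (K ∘ σ) = S K) :
    IsPolarization (fun K => S fun _ => K) S where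
  continuous := hcont
  symmetric := hsymm
  additive i K L M := S.map_update_add K i L M
  expansion m K l hl := by
    have h1 : ∑ i, l i • K i = ∑ i, (l i).toNNReal • K i :=
      Finset.sum_congr rfl fun i _ => smul_eq_toNNReal_smul (K i) (hl i)
    rw [h1, S.map_sum (fun _ i => (l i).toNNReal • K i)]
    refine Finset.sum_congr rfl fun f _ => ?_
    rw [S.map_smul_univ (fun j => (l (f j)).toNNReal) (fun j => K (f j)), NNReal.smul_def,
      NNReal.coe_prod, Complex.real_smul, Complex.ofReal_prod]
    congr 1
    exact Finset.prod_congr rfl fun j _ => by rw [Real.coe_toNNReal _ (hl _)]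

/-- The vector space of continuous functionals with polynomial dilations of degree at most `D`. -/
def dilPolySpace (n D : ℕ) : Submodule ℂ C(Body n, ℂ) where
  carrier := {φ | DilPoly D φ}
  zero_mem' := fun K L t _ => by simp
  add_mem' := by
    intro φ ψ hφ hψ K L t ht
    simp only [ContinuousMap.add_apply, hφ K L t ht, hψ K L t ht, add_mul, Finset.sum_add_distrib]
  smul_mem' := by
    intro c φ hφ K L t ht
    simp only [ContinuousMap.smul_apply, hφ K L t ht, smul_eq_mul, Finset.mul_sum, mul_assoc]

theorem DilPoly.add_right {D : ℕ} {φ : Body n → ℂ} (h : DilPoly D φ) (M : Body n) :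
    DilPoly D fun K => φ (K + M) := by
  intro K L t ht
  simp only [add_assoc]
  exact h K (L + M) t ht

set_option synthInstance.maxHeartbeats 200000 in
/-- A shortcut instance: the endomorphisms form an algebra over the nonnegative reals. -/
instance (D : ℕ) : Algebra ℝ≥0 (Module.End ℂ (dilPolySpace n D)) := inferInstance

set_option synthInstance.maxHeartbeats 200000 in
/-- A shortcut instance. -/
instance (D : ℕ) : SMul ℝ≥0 (Module.End ℂ (dilPolySpace n D)) := Algebra.toSMul

set_option synthInstance.maxHeartbeats 200000 in
/-- A shortcut instance. -/
instance (D : ℕ) : Module ℝ≥0 (Module.End ℂ (dilPolySpace n D)) := Algebra.toModule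

/-- The translate `K ↦ φ(K + M)`. -/
def shiftBody (D : ℕ) (M : Body n) : dilPolySpace n D →ₗ[ℂ] dilPolySpace n D where
  toFun φ := ⟨⟨fun K => φ.1 (K + M), by fun_prop⟩, DilPoly.add_right φ.2 M⟩
  map_add' _ _ := rfl
  map_smul' _ _ := rfl

/-- The derivative of `φ` in the direction of `L`: the coefficient of `t` in `φ(K + tL)`. -/
def dirDeriv (D : ℕ) (L : Body n) : Module.End ℂ (dilPolySpace n D) :=
  ∑ i ∈ Finset.range (D + 1), (lagr D i).coeff 1 • shiftBody D ((i : ℝ) • L)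

theorem dirDeriv_apply (D : ℕ) (L : Body n) (φ : dilPolySpace n D) (K : Body n) :
    (dirDeriv D L φ).1 K = coeffAt D 1 fun i => φ.1 ((i : ℝ) • L + K) := by
  simp [dirDeriv, shiftBody, coeffAt, add_comm K]

theorem dirDeriv_apply' (D : ℕ) (L : Body n) (φ : dilPolySpace n D) (K : Body n) :
    (dirDeriv D L φ).1 K = (dilationPolynomial D φ.1 L K).coeff 1 := by
  rw [dirDeriv_apply, coeff_dilationPolynomial]

/-- Additivity in the direction: interpolating `φ(sL + tM + K)` in both variables, the coefficient of
`t` on the diagonal `s = t` is the sum of the coefficients of `s` and of `t`. -/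
theorem dirDeriv_add (D : ℕ) (L M : Body n) : dirDeriv D (L + M) = dirDeriv D L + dirDeriv D M := by
  refine LinearMap.ext fun φ => Subtype.ext (ContinuousMap.ext fun K => ?_)
  let G : ℕ → ℕ → ℂ := fun i j => φ.1 ((i : ℝ) • L + ((j : ℝ) • M + K))
  have hφ : DilPoly D φ.1 := φ.2
  have hpoly : dilationPolynomial D φ.1 (L + M) K = ∑ j ∈ Finset.range (D + 1),
      ∑ i ∈ Finset.range (D + 1), Polynomial.C (G i j) * (lagr D i * lagr D j) := by
    refine polynomial_eq_of_eval_nonneg fun t ht => ?_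
    rw [hφ.eval_eq _ _ ht, smul_add, add_assoc, add_left_comm, hφ M _ t ht, Polynomial.eval_finsetSum]
    refine Finset.sum_congr rfl fun j _ => ?_
    rw [add_left_comm, hφ L _ t ht, Finset.sum_mul, Polynomial.eval_finsetSum]
    refine Finset.sum_congr rfl fun i _ => ?_
    simp only [Polynomial.eval_mul, Polynomial.eval_C, G, mul_assoc]
  -- The constant coefficient of the interpolation polynomial is the value at the node `0`.
  have h0 : ∀ f : ℕ → ℂ, ∑ i ∈ Finset.range (D + 1), (lagr D i).coeff 0 * f i = f 0 := by
    intro f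
    let q : Polynomial ℂ := ∑ i ∈ Finset.range (D + 1), Polynomial.C (f i) * lagr D i
    have : (q.coeff 0) = f 0 := by
      rw [Polynomial.coeff_zero_eq_eval_zero, Polynomial.eval_finsetSum]
      simp only [Polynomial.eval_mul, Polynomial.eval_C, lagr]
      rw [Finset.sum_eq_single 0]
      · have := Lagrange.eval_basis_self (s := Finset.range (D + 1)) (v := fun j : ℕ => (j : ℂ)) (i := 0)
          Nat.cast_injective.injOn (by simp)
        simp only [Nat.cast_zero] at this
        rw [this, mul_one]
      · intro i hi hi0
        have := Lagrange.eval_basis_of_ne (s := Finset.range (D + 1)) (v := fun j : ℕ => (j : ℂ))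
          (i := i) (j := 0) hi0 (by simp)
        simp only [Nat.cast_zero] at this
        rw [this, mul_zero]
      · simp
    rw [← this, Polynomial.finsetSum_coeff]
    refine Finset.sum_congr rfl fun i _ => ?_
    rw [Polynomial.coeff_C_mul, mul_comm]
  have hG0 : ∀ j, G 0 j = φ.1 ((j : ℝ) • M + K) := fun j => by
    simp only [G, Nat.cast_zero]
    congr 1
    apply supportFun_injective
    rw [supportFun_add, supportFun_smul le_rfl, zero_smul, zero_add]
  have hG0' : ∀ i, G i 0 = φ.1 ((i : ℝ) • L + K) := fun i => by
    simp only [G, Nat.cast_zero]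
    congr 1
    apply supportFun_injective
    rw [supportFun_add, supportFun_add, supportFun_smul le_rfl, zero_smul, zero_add, supportFun_add]
  have hc1 : ∑ j ∈ Finset.range (D + 1), ∑ i ∈ Finset.range (D + 1),
      G i j * ((lagr D i).coeff 0 * (lagr D j).coeff 1) = (dirDeriv D M φ).1 K := by
    rw [dirDeriv_apply, coeffAt]
    refine Finset.sum_congr rfl fun j _ => ?_
    rw [← hG0 j, ← h0 fun i => G i j, Finset.mul_sum]
    exact Finset.sum_congr rfl fun i _ => by ring
  have hc2 : ∑ j ∈ Finset.range (D + 1), ∑ i ∈ Finset.range (D + 1),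
      G i j * ((lagr D i).coeff 1 * (lagr D j).coeff 0) = (dirDeriv D L φ).1 K := by
    rw [dirDeriv_apply, coeffAt, Finset.sum_comm]
    refine Finset.sum_congr rfl fun i _ => ?_
    rw [← hG0' i, ← h0 fun j => G i j, Finset.mul_sum]
    exact Finset.sum_congr rfl fun j _ => by ring
  rw [dirDeriv_apply', hpoly]
  change _ = (dirDeriv D L φ).1 K + (dirDeriv D M φ).1 K
  rw [← hc1, ← hc2, ← Finset.sum_add_distrib, Polynomial.finsetSum_coeff]
  refine Finset.sum_congr rfl fun j _ => ?_
  rw [← Finset.sum_add_distrib, Polynomial.finsetSum_coeff]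
  refine Finset.sum_congr rfl fun i _ => ?_
  rw [Polynomial.coeff_C_mul, Polynomial.mul_coeff_one]
  ring

theorem dirDeriv_smul (D : ℕ) (a : ℝ≥0) (L : Body n) :
    dirDeriv D (a • L) = a • dirDeriv D L := by
  refine LinearMap.ext fun φ => Subtype.ext (ContinuousMap.ext fun K => ?_)
  have hφ : DilPoly D φ.1 := φ.2
  change (dirDeriv D (a • L) φ).1 K = a • (dirDeriv D L φ).1 K
  rw [dirDeriv_apply', dirDeriv_apply']
  have : dilationPolynomial D φ.1 (a • L) K =
      (dilationPolynomial D φ.1 L K).comp (Polynomial.C ((a : ℝ) : ℂ) * Polynomial.X) := by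
    refine polynomial_eq_of_eval_nonneg fun t ht => ?_
    rw [hφ.eval_eq _ _ ht, Polynomial.eval_comp, Polynomial.eval_mul, Polynomial.eval_C,
      Polynomial.eval_X, ← Complex.ofReal_mul, hφ.eval_eq _ _ (mul_nonneg (NNReal.coe_nonneg a) ht), mul_comm,
      mul_smul]
    rfl
  rw [this, Polynomial.comp_C_mul_X_coeff, NNReal.smul_def, Complex.real_smul, pow_one, mul_comm]

/-- The directional derivative as a linear function of the direction. -/
def dirDerivLin (n D : ℕ) : Body n →ₗ[ℝ≥0] Module.End ℂ (dilPolySpace n D) where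
  toFun := dirDeriv D
  map_add' := dirDeriv_add D
  map_smul' := dirDeriv_smul D

theorem dirDeriv_commute (D : ℕ) (L M : Body n) :
    Commute (dirDerivLin n D L) (dirDerivLin n D M) := by
  refine LinearMap.ext fun φ => Subtype.ext (ContinuousMap.ext fun K => ?_)
  change (dirDeriv D L (dirDeriv D M φ)).1 K = (dirDeriv D M (dirDeriv D L φ)).1 K
  simp only [dirDeriv_apply, coeffAt, Finset.mul_sum]
  rw [Finset.sum_comm]
  refine Finset.sum_congr rfl fun i _ => Finset.sum_congr rfl fun j _ => ?_
  rw [add_left_comm]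
  ring

/-- The polarization of an `r`-homogeneous functional: the `r`-fold derivative at `{0}`, divided by
`r!`. -/
def polar (D r : ℕ) (φ : dilPolySpace n D) : MultilinearMap ℝ≥0 (fun _ : Fin r => Body n) ℂ :=
  let ev : Module.End ℂ (dilPolySpace n D) →ₗ[ℝ≥0] ℂ :=
    { toFun := fun A => (r.factorial : ℂ)⁻¹ * (A φ).1 0
      map_add' := fun A B => by simp [mul_add]
      map_smul' := fun a A => by
        change (r.factorial : ℂ)⁻¹ * (a • (A φ).1 0) = a • ((r.factorial : ℂ)⁻¹ * (A φ).1 0)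
        rw [mul_smul_comm] }
  ev.compMultilinearMap
    ((MultilinearMap.mkPiAlgebraFin ℝ≥0 r (Module.End ℂ (dilPolySpace n D))).compLinearMap
      fun _ => dirDerivLin n D)

theorem polar_apply (D r : ℕ) (φ : dilPolySpace n D) (K : Fin r → Body n) :
    polar D r φ K = (r.factorial : ℂ)⁻¹ *
      ((List.ofFn fun i => dirDerivLin n D (K i)).prod φ).1 0 := rfl

theorem polar_symm (D r : ℕ) (φ : dilPolySpace n D) (σ : Equiv.Perm (Fin r)) (K : Fin r → Body n) :
    polar D r φ (K ∘ σ) = polar D r φ K := by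
  rw [polar_apply, polar_apply]
  congr 4
  refine List.Perm.prod_eq' (Equiv.Perm.ofFn_comp_perm σ fun i => dirDerivLin n D (K i)) ?_
  refine List.pairwise_of_forall_mem_list ?_
  intro a ha b hb
  obtain ⟨i, rfl⟩ := (List.mem_ofFn' _ _).1 ha
  obtain ⟨j, rfl⟩ := (List.mem_ofFn' _ _).1 hb
  exact dirDeriv_commute D _ _

/-- The iterated derivative of `φ` in the directions `K₁, …, K_r`. -/
def iterDeriv (D r : ℕ) (φ : dilPolySpace n D) (K : Fin r → Body n) : dilPolySpace n D :=
  (List.ofFn fun i => dirDerivLin n D (K i)).prod φ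

theorem iterDeriv_succ (D r : ℕ) (φ : dilPolySpace n D) (K : Fin (r + 1) → Body n) :
    iterDeriv D (r + 1) φ K = dirDeriv D (K 0) (iterDeriv D r φ fun i => K i.succ) := by
  rw [iterDeriv, List.ofFn_succ, List.prod_cons, Module.End.mul_apply]
  rfl

theorem continuous_iterDeriv (D r : ℕ) (φ : dilPolySpace n D) :
    Continuous fun p : (Fin r → Body n) × Body n => (iterDeriv D r φ p.1).1 p.2 := by
  induction r with
  | zero =>
    have h : ∀ p : (Fin 0 → Body n) × Body n, (iterDeriv D 0 φ p.1).1 p.2 = φ.1 p.2 := fun p => rfl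
    simp only [h]
    fun_prop
  | succ r ih =>
    simp only [iterDeriv_succ, dirDeriv_apply, coeffAt]
    refine continuous_finsetSum _ fun i _ => continuous_const.mul ?_
    have h1 : Continuous fun p : (Fin (r + 1) → Body n) × Body n =>
        ((fun j : Fin r => p.1 j.succ), (i : ℝ) • p.1 0 + p.2) := by
      refine Continuous.prodMk (by fun_prop) (Continuous.add ?_ (by fun_prop))
      exact (continuous_smul_body (Nat.cast_nonneg i)).comp
        ((continuous_apply 0).comp continuous_fst)
    have h2 := Continuous.comp ih h1
    exact h2

theorem continuous_polar (D r : ℕ) (φ : dilPolySpace n D) : Continuous (polar D r φ) := by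
  have h1 : Continuous fun K : Fin r → Body n => (K, (0 : Body n)) :=
    continuous_id.prodMk continuous_const
  have h2 := Continuous.comp (continuous_iterDeriv D r φ) h1
  have h3 := (continuous_const (y := (r.factorial : ℂ)⁻¹)).mul h2
  exact h3

/-- The `j`-th derivative of an `r`-homogeneous functional along the ray of `K`, as for the monomial
`s ^ r`. -/
theorem dirDeriv_iterate_apply {D r : ℕ} (hr : r ≤ D) (φ : dilPolySpace n D)
    (hφ : IsHomogeneous r φ.1) (K : Body n) {j : ℕ} (hj : j ≤ r) {s : ℝ} (hs : 0 ≤ s) :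
    ((⇑(dirDeriv D K))^[j] φ).1 (s • K) =
      (r.descFactorial j : ℂ) * (s : ℂ) ^ (r - j) * φ.1 K := by
  induction j generalizing s with
  | zero => simp [hφ s K hs]
  | succ j ih =>
    rw [Function.iterate_succ_apply', dirDeriv_apply]
    let q : Polynomial ℂ := Polynomial.C ((r.descFactorial j : ℂ) * φ.1 K) *
      (Polynomial.X + Polynomial.C (s : ℂ)) ^ (r - j)
    rw [coeffAt_eq (q := q)]
    · simp only [q]
      rw [Polynomial.coeff_C_mul, Polynomial.coeff_X_add_C_pow, Nat.choose_one_right,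
        Nat.descFactorial_succ, show r - (j + 1) = r - j - 1 by omega]
      push_cast
      ring
    · refine (Polynomial.natDegree_C_mul_le _ _).trans ?_
      refine (Polynomial.natDegree_pow_le).trans ?_
      rw [Polynomial.natDegree_X_add_C]
      omega
    · intro i
      have : (i : ℝ) • K + s • K = ((i : ℝ) + s) • K := by
        apply supportFun_injective
        rw [supportFun_add, supportFun_smul (Nat.cast_nonneg i), supportFun_smul hs,
          supportFun_smul (by positivity), add_smul]
      rw [this, ih (by omega) (by positivity)]
      simp only [q, Polynomial.eval_mul, Polynomial.eval_C, Polynomial.eval_pow, Polynomial.eval_add,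
        Polynomial.eval_X]
      push_cast
      ring

theorem polar_diag {D r : ℕ} (hr : r ≤ D) (φ : dilPolySpace n D) (hφ : IsHomogeneous r φ.1)
    (K : Body n) : polar D r φ (fun _ => K) = φ.1 K := by
  rw [polar_apply, List.ofFn_const, List.prod_replicate, Module.End.pow_apply]
  change _ * ((⇑(dirDeriv D K))^[r] φ).1 0 = _
  have h := dirDeriv_iterate_apply hr φ hφ K le_rfl le_rfl
  have h0 : (0 : ℝ) • K = 0 := by
    apply supportFun_injective
    rw [supportFun_smul le_rfl, zero_smul, supportFun_zero]
  rw [h0, Nat.descFactorial_self, Nat.sub_self, pow_zero, mul_one] at h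
  rw [h, inv_mul_cancel_left₀ (Nat.cast_ne_zero.2 r.factorial_ne_zero)]

/-! ### Differences of support functions -/

/-- The vector space spanned by the support functions; its elements are the differences of two
support functions. -/
def dcSpace (n : ℕ) : Submodule ℝ (E n → ℝ) where
  carrier := {v | ∃ K L : Body n, v = supportFun K - supportFun L}
  zero_mem' := ⟨0, 0, (sub_self _).symm⟩
  add_mem' := by
    rintro _ _ ⟨K, L, rfl⟩ ⟨K', L', rfl⟩
    exact ⟨K + K', L + L', by rw [supportFun_add, supportFun_add]; abel⟩
  smul_mem' := by
    rintro c _ ⟨K, L, rfl⟩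
    rcases le_total 0 c with hc | hc
    · exact ⟨c • K, c • L, by rw [supportFun_smul hc, supportFun_smul hc, smul_sub]⟩
    · refine ⟨(-c) • L, (-c) • K, ?_⟩
      rw [supportFun_smul (neg_nonneg.2 hc), supportFun_smul (neg_nonneg.2 hc), smul_sub, neg_smul,
        neg_smul]
      abel

/-- The support function of a convex body as an element of `dcSpace`. -/
def dcOf (K : Body n) : dcSpace n := ⟨supportFun K, K, 0, by rw [supportFun_zero, sub_zero]⟩

theorem dcOf_add (K L : Body n) : dcOf (K + L) = dcOf K + dcOf L :=
  Subtype.ext (supportFun_add K L)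

theorem dcOf_smul (a : ℝ≥0) (K : Body n) : dcOf (a • K) = a • dcOf K :=
  Subtype.ext (supportFun_nnsmul a K)

/-- A convex body whose support function is the minuend in a representation of `v`. -/
def dcPos (v : dcSpace n) : Body n := v.2.choose

/-- A convex body whose support function is the subtrahend in a representation of `v`. -/
def dcNeg (v : dcSpace n) : Body n := v.2.choose_spec.choose

theorem dcOf_pos_sub_neg (v : dcSpace n) : dcOf (dcPos v) - dcOf (dcNeg v) = v :=
  Subtype.ext v.2.choose_spec.choose_spec.symm

theorem dcOf_injective : Function.Injective (dcOf : Body n → dcSpace n) := fun _ _ h =>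
  supportFun_injective (congrArg Subtype.val h)

/-- For additive `ℓ`, the difference `ℓ(K) - ℓ(L)` depends on `h_K - h_L` only. -/
theorem additive_sub_eq {ℓ : Body n → ℂ} (hℓ : ∀ K L, ℓ (K + L) = ℓ K + ℓ L) {K L K' L' : Body n}
    (h : dcOf K + dcOf L' = dcOf K' + dcOf L) : ℓ K - ℓ L = ℓ K' - ℓ L' := by
  rw [← dcOf_add, ← dcOf_add] at h
  have := congrArg ℓ (dcOf_injective h)
  rw [hℓ, hℓ] at this
  linear_combination this

/-- The alternating sum defining the multilinear extension, split according to the argument `i`. -/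
theorem sum_powerset_update {r : ℕ} (B : (Fin r → Body n) → ℂ) (i : Fin r)
    (P N : Fin r → Body n) (K L : Body n) :
    ∑ s ∈ (Finset.univ : Finset (Fin r)).powerset, (-1 : ℂ) ^ s.card *
      B (s.piecewise (Function.update N i L) (Function.update P i K)) =
    ∑ s ∈ (Finset.univ.erase i).powerset, (-1 : ℂ) ^ s.card *
      (B (Function.update (s.piecewise N P) i K) - B (Function.update (s.piecewise N P) i L)) := by
  have huniv : (Finset.univ : Finset (Fin r)) = insert i (Finset.univ.erase i) :=
    (Finset.insert_erase (Finset.mem_univ i)).symm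
  conv_lhs => rw [huniv]
  rw [Finset.sum_powerset_insert (Finset.notMem_erase i _), ← Finset.sum_add_distrib]
  refine Finset.sum_congr rfl fun s hs => ?_
  have his : i ∉ s := fun h => Finset.notMem_erase i _ (Finset.mem_powerset.1 hs h)
  have h1 : s.piecewise (Function.update N i L) (Function.update P i K) =
      Function.update (s.piecewise N P) i K := by
    funext j
    by_cases hj : j = i
    · subst hj; simp [his]
    · by_cases hjs : j ∈ s <;> simp [hj, hjs]
  have h2 : (insert i s).piecewise (Function.update N i L) (Function.update P i K) =
      Function.update (s.piecewise N P) i L := by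
    funext j
    by_cases hj : j = i
    · subst hj; simp
    · by_cases hjs : j ∈ s <;> simp [hj, hjs]
  rw [h1, h2, Finset.card_insert_of_notMem his, pow_succ]
  ring

theorem sum_powerset_eq_update {r : ℕ} (B : (Fin r → Body n) → ℂ) (i : Fin r)
    (v : Fin r → dcSpace n) (x : dcSpace n) :
    ∑ s ∈ (Finset.univ : Finset (Fin r)).powerset, (-1 : ℂ) ^ s.card *
      B (s.piecewise (fun j => dcNeg (Function.update v i x j))
        (fun j => dcPos (Function.update v i x j))) =
    ∑ s ∈ (Finset.univ.erase i).powerset, (-1 : ℂ) ^ s.card *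
      (B (Function.update (s.piecewise (fun j => dcNeg (v j)) fun j => dcPos (v j)) i (dcPos x)) -
        B (Function.update (s.piecewise (fun j => dcNeg (v j)) fun j => dcPos (v j)) i (dcNeg x))) := by
  rw [← sum_powerset_update]
  refine Finset.sum_congr rfl fun s _ => ?_
  congr 3
  · funext j
    by_cases hj : j = i
    · subst hj; simp
    · simp [hj]
  · funext j
    by_cases hj : j = i
    · subst hj; simp
    · simp [hj]

/-- The extension of a multilinear functional of convex bodies to a multilinear functional of
differences of support functions. -/
def extMulti {r : ℕ} (B : MultilinearMap ℝ≥0 (fun _ : Fin r => Body n) ℂ) :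
    MultilinearMap ℝ (fun _ : Fin r => dcSpace n) ℂ :=
  MultilinearMap.mk' (fun v => ∑ s ∈ (Finset.univ : Finset (Fin r)).powerset, (-1 : ℂ) ^ s.card *
      B (s.piecewise (fun j => dcNeg (v j)) fun j => dcPos (v j)))
    (by
      intro v i x y
      rw [sum_powerset_eq_update, sum_powerset_eq_update, sum_powerset_eq_update,
        ← Finset.sum_add_distrib]
      refine Finset.sum_congr rfl fun s _ => ?_
      rw [← mul_add]
      congr 1
      set w := s.piecewise (fun j => dcNeg (v j)) fun j => dcPos (v j)
      have hadd : ∀ K L, B (Function.update w i (K + L)) =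
          B (Function.update w i K) + B (Function.update w i L) := B.map_update_add w i
      have h := additive_sub_eq (ℓ := fun K => B (Function.update w i K)) hadd
        (K := dcPos (x + y)) (L := dcNeg (x + y)) (K' := dcPos x + dcPos y)
        (L' := dcNeg x + dcNeg y) (by
          have h1 := dcOf_pos_sub_neg (x + y)
          have h2 := dcOf_pos_sub_neg x
          have h3 := dcOf_pos_sub_neg y
          rw [dcOf_add, dcOf_add]
          rw [sub_eq_iff_eq_add] at h1 h2 h3
          rw [h1, h2, h3]
          abel)
      simp only [hadd] at h
      rw [h]
      ring)
    (by
      intro v i c x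
      rw [sum_powerset_eq_update, sum_powerset_eq_update, Finset.smul_sum]
      refine Finset.sum_congr rfl fun s _ => ?_
      rw [← mul_smul_comm]
      congr 1
      set w := s.piecewise (fun j => dcNeg (v j)) fun j => dcPos (v j)
      have hadd : ∀ K L, B (Function.update w i (K + L)) =
          B (Function.update w i K) + B (Function.update w i L) := B.map_update_add w i
      have hsm : ∀ (a : ℝ≥0) K, B (Function.update w i (a • K)) = a • B (Function.update w i K) :=
        B.map_update_smul w i
      have h1 := dcOf_pos_sub_neg (c • x)
      have h2 := dcOf_pos_sub_neg x
      rw [sub_eq_iff_eq_add] at h1 h2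
      rcases le_total 0 c with hc | hc
      · have h := additive_sub_eq (ℓ := fun K => B (Function.update w i K)) hadd
          (K := dcPos (c • x)) (L := dcNeg (c • x)) (K' := c.toNNReal • dcPos x)
          (L' := c.toNNReal • dcNeg x) (by
            rw [dcOf_smul, dcOf_smul, h1, h2, NNReal.smul_def, NNReal.smul_def,
              Real.coe_toNNReal _ hc, smul_add]
            abel)
        simp only [hsm] at h
        rw [h, NNReal.smul_def, NNReal.smul_def, Real.coe_toNNReal _ hc, smul_sub]
      · have h := additive_sub_eq (ℓ := fun K => B (Function.update w i K)) hadd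
          (K := dcPos (c • x)) (L := dcNeg (c • x)) (K' := (-c).toNNReal • dcNeg x)
          (L' := (-c).toNNReal • dcPos x) (by
            rw [dcOf_smul, dcOf_smul, h1, h2, NNReal.smul_def, NNReal.smul_def,
              Real.coe_toNNReal _ (neg_nonneg.2 hc), smul_add]
            module)
        simp only [hsm] at h
        rw [h, NNReal.smul_def, NNReal.smul_def, Real.coe_toNNReal _ (neg_nonneg.2 hc)]
        module)

theorem extMulti_apply {r : ℕ} (B : MultilinearMap ℝ≥0 (fun _ : Fin r => Body n) ℂ)
    (v : Fin r → dcSpace n) :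
    extMulti B v = ∑ s ∈ (Finset.univ : Finset (Fin r)).powerset, (-1 : ℂ) ^ s.card *
      B (s.piecewise (fun j => dcNeg (v j)) fun j => dcPos (v j)) := rfl

/-- The alternating sum at the representations `h_{Kᵢ} = h_{Kᵢ + Nᵢ} - h_{Nᵢ}` is the value at `K`. -/
theorem sum_powerset_piecewise_add {r : ℕ} (B : MultilinearMap ℝ≥0 (fun _ : Fin r => Body n) ℂ)
    (K N : Fin r → Body n) (T : Finset (Fin r)) :
    ∑ s ∈ T.powerset, (-1 : ℂ) ^ s.card * B (s.piecewise N (T.piecewise (K + N) K)) = B K := by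
  induction T using Finset.induction_on generalizing K with
  | empty => simp
  | insert i T hi ih =>
    rw [Finset.sum_powerset_insert hi, ← Finset.sum_add_distrib, ← ih K]
    refine Finset.sum_congr rfl fun s hs => ?_
    have his : i ∉ s := fun h => hi (Finset.mem_powerset.1 hs h)
    set w := s.piecewise N (T.piecewise (K + N) K) with hw
    have h1 : s.piecewise N ((insert i T).piecewise (K + N) K) = Function.update w i (K i + N i) := by
      funext j
      by_cases hj : j = i
      · subst hj; simp [his]
      · by_cases hjs : j ∈ s
        · simp [hj, hjs, hw]
        · by_cases hjT : j ∈ T <;> simp [hj, hjs, hjT, hw]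
    have h2 : (insert i s).piecewise N ((insert i T).piecewise (K + N) K) =
        Function.update w i (N i) := by
      funext j
      by_cases hj : j = i
      · subst hj; simp
      · by_cases hjs : j ∈ s
        · simp [hj, hjs, hw]
        · by_cases hjT : j ∈ T <;> simp [hj, hjs, hjT, hw]
    have h3 : w = Function.update w i (K i) := by
      rw [eq_comm, Function.update_eq_self_iff]
      simp [hw, his, hi]
    rw [h1, h2, B.map_update_add, Finset.card_insert_of_notMem his, pow_succ, ← h3]
    ring

theorem extMulti_dcOf {r : ℕ} (B : MultilinearMap ℝ≥0 (fun _ : Fin r => Body n) ℂ)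
    (K : Fin r → Body n) : (extMulti B fun i => dcOf (K i)) = B K := by
  rw [extMulti_apply, ← sum_powerset_piecewise_add B K (fun j => dcNeg (dcOf (K j))) Finset.univ]
  refine Finset.sum_congr rfl fun s _ => ?_
  congr 3
  funext j
  rw [Finset.piecewise_univ, Pi.add_apply]
  apply dcOf_injective
  have := dcOf_pos_sub_neg (dcOf (K j))
  rw [sub_eq_iff_eq_add] at this
  rw [this, dcOf_add]

theorem extMulti_symm {r : ℕ} (B : MultilinearMap ℝ≥0 (fun _ : Fin r => Body n) ℂ)
    (hB : ∀ (σ : Equiv.Perm (Fin r)) (K : Fin r → Body n), B (K ∘ σ) = B K)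
    (σ : Equiv.Perm (Fin r)) (v : Fin r → dcSpace n) : extMulti B (v ∘ σ) = extMulti B v := by
  rw [extMulti_apply, extMulti_apply]
  refine Finset.sum_bij (fun s _ => s.map σ.toEmbedding) (fun _ _ => by simp) ?_ ?_ ?_
  · intro s _ t _ h
    exact Finset.map_injective _ h
  · intro t _
    refine ⟨t.map σ.symm.toEmbedding, by simp, ?_⟩
    ext j
    simp
  · intro s _
    rw [Finset.card_map, ← hB σ ((s.map σ.toEmbedding).piecewise _ _)]
    congr 2
    funext j
    by_cases hj : j ∈ s <;> simp [Finset.piecewise, hj]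

/-! ### Multiplication of support functions by smooth functions on the sphere -/

/-- The space of functions on `ℝⁿ` that are homogeneous of degree `0` and smooth away from the origin,
normalized to vanish at the origin. These are the smooth functions on the sphere. -/
def angularSubmodule (n : ℕ) : Submodule ℝ (E n → ℝ) where
  carrier := {χ | ContDiffOn ℝ ∞ χ {y | y ≠ 0} ∧ (∀ (t : ℝ) y, 0 < t → χ (t • y) = χ y) ∧ χ 0 = 0}
  zero_mem' := ⟨contDiffOn_const, fun _ _ _ => rfl, rfl⟩
  add_mem' := fun hf hg => ⟨hf.1.add hg.1, fun t y ht => by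
    simp only [Pi.add_apply, hf.2.1 t y ht, hg.2.1 t y ht], by simp [hf.2.2, hg.2.2]⟩
  smul_mem' := fun c f hf => ⟨contDiffOn_const.smul hf.1, fun t y ht => by
    simp only [Pi.smul_apply, hf.2.1 t y ht], by simp [hf.2.2]⟩

/-- A type synonym of `angularSubmodule`, which is going to carry the `C²`-norm on a spherical shell
instead of the topology of pointwise convergence. -/
def Angular (n : ℕ) : Type := angularSubmodule n

instance : AddCommGroup (Angular n) := inferInstanceAs (AddCommGroup (angularSubmodule n))
instance : Module ℝ (Angular n) := inferInstanceAs (Module ℝ (angularSubmodule n))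
instance : FunLike (Angular n) (E n) ℝ where
  coe χ := Subtype.val (p := fun f => f ∈ angularSubmodule n) χ
  coe_injective _ _ h := Subtype.ext h

namespace Angular

theorem ext_fun {χ η : Angular n} (h : ∀ y, χ y = η y) : χ = η := DFunLike.ext _ _ h

theorem mem (χ : Angular n) : ⇑χ ∈ angularSubmodule n :=
  Subtype.property (p := fun f => f ∈ angularSubmodule n) χ

theorem add_apply (χ η : Angular n) (y : E n) : (χ + η) y = χ y + η y := rfl
theorem smul_apply (c : ℝ) (χ : Angular n) (y : E n) : (c • χ) y = c * χ y := rfl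

theorem contDiffOn (χ : Angular n) : ContDiffOn ℝ ∞ χ {y | y ≠ 0} := χ.mem.1

theorem isOpen_ne : IsOpen {y : E n | y ≠ 0} := isOpen_compl_singleton

theorem contDiffAt (χ : Angular n) {y : E n} (hy : y ≠ 0) : ContDiffAt ℝ ∞ χ y :=
  χ.contDiffOn.contDiffAt (isOpen_ne.mem_nhds hy)

theorem apply_smul (χ : Angular n) {t : ℝ} (ht : 0 < t) (y : E n) : χ (t • y) = χ y := χ.mem.2.1 t y ht

theorem apply_zero (χ : Angular n) : χ 0 = 0 := χ.mem.2.2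

theorem contDiffOn_fderiv (χ : Angular n) : ContDiffOn ℝ ∞ (fderiv ℝ χ) {y | y ≠ 0} :=
  χ.contDiffOn.fderiv_of_isOpen isOpen_ne (by simp)

theorem contDiffOn_fderiv_fderiv (χ : Angular n) :
    ContDiffOn ℝ ∞ (fderiv ℝ (fderiv ℝ χ)) {y | y ≠ 0} :=
  χ.contDiffOn_fderiv.fderiv_of_isOpen isOpen_ne (by simp)

theorem differentiableAt (χ : Angular n) {y : E n} (hy : y ≠ 0) : DifferentiableAt ℝ χ y :=
  (χ.contDiffAt hy).differentiableAt (by simp)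

theorem differentiableAt_fderiv (χ : Angular n) {y : E n} (hy : y ≠ 0) :
    DifferentiableAt ℝ (fderiv ℝ χ) y :=
  (χ.contDiffOn_fderiv.contDiffAt (isOpen_ne.mem_nhds hy)).differentiableAt (by simp)

end Angular

/-- The spherical shell `1/2 ≤ ‖y‖ ≤ 1`. -/
def shell (n : ℕ) : Set (E n) := {y | 1 / 2 ≤ ‖y‖ ∧ ‖y‖ ≤ 1}

theorem isCompact_shell : IsCompact (shell n) := by
  have : shell n = Metric.closedBall 0 1 ∩ {y | 1 / 2 ≤ ‖y‖} := by
    ext y; simp [shell, and_comm]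
  rw [this]
  exact (isCompact_closedBall _ _).inter_right (isClosed_le continuous_const continuous_norm)

instance : CompactSpace (shell n) := isCompact_iff_compactSpace.1 isCompact_shell

theorem ne_zero_of_mem_shell {y : E n} (hy : y ∈ shell n) : y ≠ 0 := by
  rintro rfl
  have := hy.1
  norm_num at this

theorem mem_shell_of_norm_eq_one {y : E n} (hy : ‖y‖ = 1) : y ∈ shell n := by
  constructor <;> rw [hy]
  norm_num

theorem shell_subset : shell n ⊆ {y | y ≠ 0} := fun _ => ne_zero_of_mem_shell

/-- The continuous functions on the shell with values in a normed space. -/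
abbrev ShellFun (n : ℕ) (F : Type*) [NormedAddCommGroup F] : Type _ := C(shell n, F)

/-- Restriction of a function that is continuous away from the origin to the shell. -/
def toShell {F : Type*} [NormedAddCommGroup F] (f : E n → F) (hf : ContinuousOn f {y | y ≠ 0}) :
    ShellFun n F := ⟨fun y => f y, (hf.mono shell_subset).domRestrict⟩

set_option synthInstance.maxHeartbeats 200000 in
/-- The `2`-jet on the shell. -/
def jet (n : ℕ) : Angular n →ₗ[ℝ] ShellFun n ℝ × ShellFun n (E n →L[ℝ] ℝ) ×
    ShellFun n (E n →L[ℝ] E n →L[ℝ] ℝ) where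
  toFun χ := (toShell χ χ.contDiffOn.continuousOn,
    toShell (fderiv ℝ χ) χ.contDiffOn_fderiv.continuousOn,
    toShell (fderiv ℝ (fderiv ℝ χ)) χ.contDiffOn_fderiv_fderiv.continuousOn)
  map_add' χ η := by
    have h : ∀ y : E n, y ≠ 0 → fderiv ℝ ⇑(χ + η) y = fderiv ℝ χ y + fderiv ℝ η y :=
      fun y hy => fderiv_add (χ.differentiableAt hy) (η.differentiableAt hy)
    refine Prod.ext rfl (Prod.ext ?_ ?_)
    · ext1 y
      exact h y (ne_zero_of_mem_shell y.2)
    · ext1 y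
      have hy := ne_zero_of_mem_shell y.2
      have h2 : fderiv ℝ ⇑(χ + η) =ᶠ[𝓝 (y : E n)] fderiv ℝ χ + fderiv ℝ η :=
        Filter.eventually_of_mem (Angular.isOpen_ne.mem_nhds hy) fun z hz => h z hz
      exact h2.fderiv_eq.trans (fderiv_add (χ.differentiableAt_fderiv hy)
        (η.differentiableAt_fderiv hy))
  map_smul' c χ := by
    have h : ∀ y : E n, y ≠ 0 → fderiv ℝ ⇑(c • χ) y = c • fderiv ℝ χ y :=
      fun y hy => fderiv_const_smul (χ.differentiableAt hy) c
    refine Prod.ext rfl (Prod.ext ?_ ?_)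
    · ext1 y
      exact h y (ne_zero_of_mem_shell y.2)
    · ext1 y
      have hy := ne_zero_of_mem_shell y.2
      have h2 : fderiv ℝ ⇑(c • χ) =ᶠ[𝓝 (y : E n)] c • fderiv ℝ χ :=
        Filter.eventually_of_mem (Angular.isOpen_ne.mem_nhds hy) fun z hz => h z hz
      exact h2.fderiv_eq.trans (fderiv_const_smul (χ.differentiableAt_fderiv hy) c)

theorem Angular.apply_eq_normalize (χ : Angular n) {y : E n} (hy : y ≠ 0) :
    χ y = χ (‖y‖⁻¹ • y) := (χ.apply_smul (inv_pos.2 (norm_pos_iff.2 hy)) y).symm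

theorem norm_normalize {y : E n} (hy : y ≠ 0) : ‖‖y‖⁻¹ • y‖ = 1 := by
  rw [norm_smul, norm_inv, norm_norm, inv_mul_cancel₀ (norm_ne_zero_iff.2 hy)]

theorem jet_injective : Function.Injective (jet n) := by
  intro χ η h
  refine Angular.ext_fun fun y => ?_
  rcases eq_or_ne y 0 with rfl | hy
  · rw [χ.apply_zero, η.apply_zero]
  · rw [χ.apply_eq_normalize hy, η.apply_eq_normalize hy]
    exact DFunLike.congr_fun (congrArg Prod.fst h)
      ⟨‖y‖⁻¹ • y, mem_shell_of_norm_eq_one (norm_normalize hy)⟩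

instance : NormedAddCommGroup (Angular n) := NormedAddCommGroup.induced _ _ (jet n) jet_injective

instance : NormedSpace ℝ (Angular n) := NormedSpace.induced ℝ (Angular n) _ (jet n)

namespace Angular

theorem norm_eq (χ : Angular n) : ‖χ‖ = ‖jet n χ‖ := rfl

theorem abs_apply_le_of_mem (χ : Angular n) {y : E n} (hy : y ∈ shell n) : |χ y| ≤ ‖χ‖ :=
  (ContinuousMap.norm_coe_le_norm (jet n χ).1 ⟨y, hy⟩).trans (norm_fst_le _)

theorem norm_fderiv_le (χ : Angular n) {y : E n} (hy : y ∈ shell n) : ‖fderiv ℝ χ y‖ ≤ ‖χ‖ :=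
  (ContinuousMap.norm_coe_le_norm (jet n χ).2.1 ⟨y, hy⟩).trans ((norm_fst_le _).trans (norm_snd_le _))

theorem norm_fderiv_fderiv_le (χ : Angular n) {y : E n} (hy : y ∈ shell n) :
    ‖fderiv ℝ (fderiv ℝ χ) y‖ ≤ ‖χ‖ :=
  (ContinuousMap.norm_coe_le_norm (jet n χ).2.2 ⟨y, hy⟩).trans ((norm_snd_le _).trans (norm_snd_le _))

theorem abs_apply_le (χ : Angular n) (y : E n) : |χ y| ≤ ‖χ‖ := by
  rcases eq_or_ne y 0 with rfl | hy
  · rw [χ.apply_zero, abs_zero]; exact norm_nonneg _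
  · rw [χ.apply_eq_normalize hy]
    exact χ.abs_apply_le_of_mem (mem_shell_of_norm_eq_one (norm_normalize hy))

/-- Euler's relation for homogeneity of degree zero. -/
theorem fderiv_self (χ : Angular n) {y : E n} (hy : y ≠ 0) : fderiv ℝ χ y y = 0 := by
  have h1 : HasDerivAt (fun t : ℝ => χ (t • y)) (fderiv ℝ χ y y) 1 := by
    have h2 : HasDerivAt (fun t : ℝ => t • y) y 1 := by
      simpa using (hasDerivAt_id (1 : ℝ)).smul_const y
    have h3 : HasFDerivAt χ (fderiv ℝ χ y) ((fun t : ℝ => t • y) 1) := by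
      simpa using (χ.differentiableAt hy).hasFDerivAt
    exact h3.comp_hasDerivAt 1 h2
  have h4 : HasDerivAt (fun t : ℝ => χ (t • y)) 0 1 := by
    refine (hasDerivAt_const (1 : ℝ) (χ y)).congr_of_eventuallyEq ?_
    filter_upwards [lt_mem_nhds (zero_lt_one' ℝ)] with t ht
    exact χ.apply_smul ht y
  exact h1.unique h4

/-- This is why the norm involves the shell instead of the sphere: mean value estimates between nearby
unit vectors use the segment joining them. -/
theorem segment_subset_shell {y z : E n} (hy : ‖y‖ = 1) (hz : ‖z‖ = 1) (h : ‖z - y‖ ≤ 1) :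
    segment ℝ y z ⊆ shell n := by
  intro w hw
  have hle : ‖w‖ ≤ 1 := by
    have := (convex_closedBall (0 : E n) 1).segment_subset (x := y) (y := z) (by simp [hy])
      (by simp [hz]) hw
    simpa using this
  refine ⟨?_, hle⟩
  have h1 := dist_add_dist_of_mem_segment hw
  rw [dist_comm y z, dist_eq_norm z y] at h1
  have h2 : ‖y‖ ≤ ‖w‖ + dist y w := by
    have := norm_add_le w (y - w)
    rwa [add_sub_cancel, ← dist_eq_norm] at this
  have h3 : ‖z‖ ≤ ‖w‖ + dist w z := by
    have := norm_add_le w (z - w)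
    rwa [add_sub_cancel, ← dist_eq_norm, dist_comm] at this
  linarith

theorem abs_sub_le (χ : Angular n) {y z : E n} (hy : ‖y‖ = 1) (hz : ‖z‖ = 1) :
    |χ z - χ y| ≤ 2 * ‖χ‖ * ‖z - y‖ := by
  have h0 := norm_nonneg χ
  rcases le_total ‖z - y‖ 1 with h | h
  · have hs := segment_subset_shell hy hz h
    have := (convex_segment y z).norm_image_sub_le_of_norm_hasFDerivWithin_le (f := χ)
      (f' := fderiv ℝ χ) (C := ‖χ‖) (fun w hw => (χ.differentiableAt
        (ne_zero_of_mem_shell (hs hw))).hasFDerivAt.hasFDerivWithinAt)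
      (fun w hw => χ.norm_fderiv_le (hs hw)) (left_mem_segment ℝ y z) (right_mem_segment ℝ y z)
    rw [Real.norm_eq_abs] at this
    nlinarith [mul_nonneg h0 (norm_nonneg (z - y))]
  · have h1 := abs_sub (χ z) (χ y)
    have h2 := χ.abs_apply_le z
    have h3 := χ.abs_apply_le y
    nlinarith

theorem abs_sub_sub_fderiv_le (χ : Angular n) {y z : E n} (hy : ‖y‖ = 1) (hz : ‖z‖ = 1) :
    |χ z - χ y - fderiv ℝ χ y (z - y)| ≤ 3 * ‖χ‖ * ‖z - y‖ ^ 2 := by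
  have h0 := norm_nonneg χ
  have hys := mem_shell_of_norm_eq_one hy
  rcases le_total ‖z - y‖ 1 with h | h
  · have hs := segment_subset_shell hy hz h
    have hd : ∀ w ∈ segment ℝ y z, ‖fderiv ℝ χ w - fderiv ℝ χ y‖ ≤ ‖χ‖ * ‖z - y‖ := by
      intro w hw
      have := (convex_segment y z).norm_image_sub_le_of_norm_hasFDerivWithin_le (f := fderiv ℝ χ)
        (f' := fderiv ℝ (fderiv ℝ χ)) (C := ‖χ‖) (fun w hw => (χ.differentiableAt_fderiv
          (ne_zero_of_mem_shell (hs hw))).hasFDerivAt.hasFDerivWithinAt)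
        (fun w hw => χ.norm_fderiv_fderiv_le (hs hw)) (left_mem_segment ℝ y z) hw
      refine this.trans (mul_le_mul_of_nonneg_left ?_ h0)
      have h1 := dist_add_dist_of_mem_segment hw
      rw [← dist_eq_norm, ← dist_eq_norm, dist_comm z y, dist_comm w y]
      linarith [dist_nonneg (x := w) (y := z)]
    have := (convex_segment y z).norm_image_sub_le_of_norm_hasFDerivWithin_le'  (f := χ)
      (f' := fderiv ℝ χ) (φ := fderiv ℝ χ y) (C := ‖χ‖ * ‖z - y‖) (fun w hw => (χ.differentiableAt
        (ne_zero_of_mem_shell (hs hw))).hasFDerivAt.hasFDerivWithinAt)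
      hd (left_mem_segment ℝ y z) (right_mem_segment ℝ y z)
    rw [Real.norm_eq_abs] at this
    nlinarith [mul_nonneg h0 (sq_nonneg (‖z - y‖))]
  · have h1 := abs_sub (χ z - χ y) (fderiv ℝ χ y (z - y))
    have h1' := abs_sub (χ z) (χ y)
    have h2 := χ.abs_apply_le z
    have h3 := χ.abs_apply_le y
    have h4 : |fderiv ℝ χ y (z - y)| ≤ ‖χ‖ * ‖z - y‖ :=
      ((fderiv ℝ χ y).le_opNorm _).trans
        (mul_le_mul_of_nonneg_right (χ.norm_fderiv_le hys) (norm_nonneg _))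
    have h5 : ‖z - y‖ ≤ ‖z - y‖ ^ 2 := by nlinarith
    nlinarith [mul_le_mul_of_nonneg_left h5 h0]

end Angular

/-- The key estimate: `(χ + N) ⟪x, ·⟫ + 10 N R ‖·‖` lies above its linearization at each unit
vector `u`. For unit vectors `z`, the first order expansions of `χ` at `u` bound the error of the first
summand by `(2 + 3) N R ‖z - u‖²`, and `10 N R (1 - ⟪z, u⟫) = 5 N R ‖z - u‖²` is the gain of the
second. -/
theorem linearization_le (χ : Angular n) {N R : ℝ} (hN : ‖χ‖ ≤ N) {x : E n} (hx : ‖x‖ ≤ R)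
    {u : E n} (hu : ‖u‖ = 1) (z : E n) :
    (χ u + N) * ⟪z, x⟫ + ⟪u, x⟫ * fderiv ℝ χ u z + 10 * N * R * ⟪z, u⟫ ≤
      (χ z + N) * ⟪z, x⟫ + 10 * N * R * ‖z‖ := by
  have hχ0 := norm_nonneg χ
  have hx0 := norm_nonneg x
  have key : ∀ z : E n, ‖z‖ = 1 → (χ u + N) * ⟪z, x⟫ + ⟪u, x⟫ * fderiv ℝ χ u z + 10 * N * R * ⟪z, u⟫ ≤
      (χ z + N) * ⟪z, x⟫ + 10 * N * R := by
    intro z hz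
    have h1 := χ.abs_sub_le hu hz
    have h2 := χ.abs_sub_sub_fderiv_le hu hz
    rw [map_sub, χ.fderiv_self (ne_zero_of_mem_shell (mem_shell_of_norm_eq_one hu)), sub_zero] at h2
    have h3 : ‖z - u‖ ^ 2 = 2 * (1 - ⟪z, u⟫) := by
      rw [norm_sub_sq_real, hu, hz]; ring
    have h4 : |⟪z - u, x⟫| ≤ ‖z - u‖ * ‖x‖ := abs_real_inner_le_norm _ _
    have h5 : |⟪u, x⟫| ≤ ‖x‖ := by simpa [hu] using abs_real_inner_le_norm u x
    have h6 : |⟪z - u, x⟫ * (χ z - χ u)| ≤ 2 * ‖χ‖ * ‖x‖ * ‖z - u‖ ^ 2 := by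
      rw [abs_mul]
      calc _ ≤ (‖z - u‖ * ‖x‖) * (2 * ‖χ‖ * ‖z - u‖) :=
            mul_le_mul h4 h1 (abs_nonneg _) (by positivity)
        _ = _ := by ring
    have h7 : |⟪u, x⟫ * (χ z - χ u - fderiv ℝ χ u z)| ≤ 3 * ‖χ‖ * ‖x‖ * ‖z - u‖ ^ 2 := by
      rw [abs_mul]
      calc _ ≤ ‖x‖ * (3 * ‖χ‖ * ‖z - u‖ ^ 2) := mul_le_mul h5 h2 (abs_nonneg _) (by positivity)
        _ = _ := by ring
    have h8 : ‖χ‖ * ‖x‖ ≤ N * R := mul_le_mul hN hx hx0 (hχ0.trans hN)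
    have h9 : ⟪z, x⟫ = ⟪z - u, x⟫ + ⟪u, x⟫ := by rw [← inner_add_left, sub_add_cancel]
    have h10 := mul_le_mul_of_nonneg_right h8 (sq_nonneg ‖z - u‖)
    have h11 := neg_le_of_abs_le h6
    have h12 := neg_le_of_abs_le h7
    rw [h9]
    rw [h3] at h10 h11 h12
    linarith
  rcases eq_or_ne z 0 with rfl | hz
  · simp
  · have hzp := norm_pos_iff.2 hz
    have h := mul_le_mul_of_nonneg_left (key _ (norm_normalize hz)) hzp.le
    rw [← χ.apply_eq_normalize hz, inner_smul_left, inner_smul_left, map_smul, smul_eq_mul] at h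
    simp only [map_inv₀, conj_trivial] at h
    have e : ‖z‖ * ‖z‖⁻¹ = 1 := mul_inv_cancel₀ hzp.ne'
    linear_combination h - ((χ u + N) * ⟪z, x⟫ + ⟪u, x⟫ * fderiv ℝ χ u z + 10 * N * R * ⟪z, u⟫ -
      (χ z + N) * ⟪z, x⟫) * e

/-- Multiplication of a support function by a smooth function on the sphere yields a support function,
up to multiples of the support function and of the norm. -/
theorem exists_supportFun_mul (χ : Angular n) {N R : ℝ} (hN : ‖χ‖ ≤ N) {K : Body n}
    (hK : ∀ x ∈ K, ‖x‖ ≤ R) :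
    ∃ P : Body n, ∀ y,
      supportFun P y = χ y * supportFun K y + N * supportFun K y + 10 * N * R * ‖y‖ := by
  have hN0 := (norm_nonneg χ).trans hN
  obtain ⟨x₀, hx₀⟩ := K.nonempty
  have hR0 : 0 ≤ R := (norm_nonneg x₀).trans (hK x₀ hx₀)
  have hle : ∀ z, ∀ x ∈ K, ⟪z, x⟫ ≤ supportFun K z := fun z x hx => inner_le_supportFun hx z
  have hpos : ∀ z, 0 ≤ χ z + N := fun z => by linarith [neg_le_of_abs_le (χ.abs_apply_le z)]
  -- The point of the new body with normal `u` is the gradient at `u` of the function obtained by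
  -- replacing `h_K` with `⟪·, x⟫`, where `x` is a point of `K` with normal `u`.
  have main : ∀ u : E n, ‖u‖ = 1 → ∃ a : E n, (∀ z, ⟪z, a⟫ ≤
      χ z * supportFun K z + N * supportFun K z + 10 * N * R * ‖z‖) ∧ ∀ s : ℝ, 0 ≤ s → ⟪s • u, a⟫ =
      χ (s • u) * supportFun K (s • u) + N * supportFun K (s • u) + 10 * N * R * ‖s • u‖ := by
    intro u hu
    obtain ⟨x, hx, hxu⟩ := exists_inner_eq_supportFun K u
    have hu0 := ne_zero_of_mem_shell (mem_shell_of_norm_eq_one hu)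
    refine ⟨(χ u + N) • x + ⟪u, x⟫ • (InnerProductSpace.toDual ℝ (E n)).symm (fderiv ℝ χ u) +
      (10 * N * R) • u, fun z => ?_, fun s hs => ?_⟩
    · have h := linearization_le χ hN (hK x hx) hu z
      have h2 := mul_le_mul_of_nonneg_left (hle z x hx) (hpos z)
      have h3 : ⟪z, (InnerProductSpace.toDual ℝ (E n)).symm (fderiv ℝ χ u)⟫ = fderiv ℝ χ u z := by
        rw [real_inner_comm, InnerProductSpace.toDual_symm_apply]
      rw [inner_add_right, inner_add_right, inner_smul_right, inner_smul_right, inner_smul_right, h3]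
      linarith
    · have h3 : ⟪u, (InnerProductSpace.toDual ℝ (E n)).symm (fderiv ℝ χ u)⟫ = 0 := by
        rw [real_inner_comm, InnerProductSpace.toDual_symm_apply, χ.fderiv_self hu0]
      rcases hs.eq_or_lt with rfl | hs'
      · simp [supportFun_zero_arg]
      rw [χ.apply_smul hs', supportFun_smul_arg K hs, norm_smul, Real.norm_of_nonneg hs, hu,
        inner_smul_left, inner_add_right, inner_add_right, inner_smul_right, inner_smul_right,
        inner_smul_right, h3, ← hxu, real_inner_self_eq_norm_sq, hu]
      simp only [conj_trivial]
      ring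
  obtain ⟨P, hP⟩ := exists_supportFun_eq
    (F := fun y => χ y * supportFun K y + N * supportFun K y + 10 * N * R * ‖y‖)
    (C := ‖χ‖ * R + N * R + 10 * N * R) (by positivity) (fun z => by
      have h1 : |supportFun K z| ≤ R * ‖z‖ := by
        have := abs_supportFun_le hK z
        linarith
      have h2 : χ z * supportFun K z ≤ ‖χ‖ * (R * ‖z‖) := by
        refine (le_abs_self _).trans ?_
        rw [abs_mul]
        exact mul_le_mul (χ.abs_apply_le z) h1 (abs_nonneg _) (norm_nonneg _)
      have h3 := mul_le_mul_of_nonneg_left ((le_abs_self _).trans h1) hN0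
      change χ z * supportFun K z + N * supportFun K z + 10 * N * R * ‖z‖ ≤ _
      linarith)
    (fun y => by
      rcases eq_or_ne y 0 with rfl | hy
      · by_cases h : ∃ z : E n, z ≠ 0
        · obtain ⟨z, hz⟩ := h
          obtain ⟨a, ha, ha'⟩ := main _ (norm_normalize hz)
          exact ⟨a, ha, by simp⟩
        · push Not at h
          refine ⟨0, fun z => ?_, ?_⟩
          · simp [h z, supportFun_zero_arg]
          · simp [supportFun_zero_arg]
      · obtain ⟨a, ha, ha'⟩ := main _ (norm_normalize hy)
        refine ⟨a, ha, ?_⟩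
        have := ha' ‖y‖ (norm_nonneg _)
        rwa [smul_inv_smul₀ (norm_ne_zero_iff.2 hy)] at this)
  exact ⟨P, fun y => congrFun hP y⟩

/-! ### Localized valuations -/

/-- The unit ball as a convex body. -/
def unitBall (n : ℕ) : Body n :=
  ⟨Metric.closedBall 0 1, convex_closedBall _ _, isCompact_closedBall _ _, 0, by simp⟩

theorem supportFun_unitBall (y : E n) : supportFun (unitBall n) y = ‖y‖ := by
  have hle : ∀ x ∈ unitBall n, ‖x‖ ≤ 1 := fun x hx => by
    simpa using (show x ∈ Metric.closedBall (0 : E n) 1 from hx)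
  refine le_antisymm ((le_abs_self _).trans ((abs_supportFun_le hle y).trans_eq (one_mul _))) ?_
  rcases eq_or_ne y 0 with rfl | hy
  · simp [supportFun_zero_arg]
  · have hm : ‖y‖⁻¹ • y ∈ unitBall n := by
      change _ ∈ Metric.closedBall (0 : E n) 1
      simp [norm_normalize hy]
    have := inner_le_supportFun hm y
    rw [inner_smul_right, real_inner_self_eq_norm_sq, pow_two,
      inv_mul_cancel_left₀ (norm_ne_zero_iff.2 hy)] at this
    exact this

open Classical in
/-- The convex body with support function `(χ + 1) h_K + 10 R ‖·‖`, for `‖χ‖ ≤ 1` and `K` in the ball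
of radius `R`. -/
def mulBody (R : ℝ) (χ : Angular n) (K : Body n) : Body n :=
  if h : ∃ P : Body n, ∀ y, supportFun P y = χ y * supportFun K y + supportFun K y + 10 * R * ‖y‖ then
    h.choose else 0

theorem supportFun_mulBody {R : ℝ} {χ : Angular n} (hχ : ‖χ‖ ≤ 1) {K : Body n}
    (hK : K ∈ bodiesInBall n R) (y : E n) :
    supportFun (mulBody R χ K) y = χ y * supportFun K y + supportFun K y + 10 * R * ‖y‖ := by
  have h : ∃ P : Body n, ∀ y,
      supportFun P y = χ y * supportFun K y + supportFun K y + 10 * R * ‖y‖ := by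
    simpa using exists_supportFun_mul χ hχ hK
  rw [mulBody, dif_pos h]
  exact h.choose_spec y

/-- The convex body with support function `h_K + 10 R ‖·‖`. -/
def addBall (R : ℝ) (K : Body n) : Body n := K + (10 * R) • unitBall n

theorem supportFun_addBall {R : ℝ} (hR : 0 ≤ R) (K : Body n) (y : E n) :
    supportFun (addBall R K) y = supportFun K y + 10 * R * ‖y‖ := by
  rw [addBall, supportFun_add, supportFun_smul (by positivity), Pi.add_apply, Pi.smul_apply,
    supportFun_unitBall, smul_eq_mul]

/-- Multiplication by a smooth function on the sphere as an operator on differences of support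
functions. -/
def angMul (χ : Angular n) : dcSpace n →ₗ[ℝ] dcSpace n where
  toFun v := ⟨fun y => χ y * (v : E n → ℝ) y, by
    obtain ⟨_, K, L, rfl⟩ := v
    obtain ⟨R₁, h₁, hK⟩ := exists_norm_le K
    obtain ⟨R₂, h₂, hL⟩ := exists_norm_le L
    obtain ⟨P, hP⟩ := exists_supportFun_mul χ le_rfl
      (fun x hx => (hK x hx).trans (le_add_of_nonneg_right h₂))
    obtain ⟨Q, hQ⟩ := exists_supportFun_mul χ le_rfl
      (fun x hx => (hL x hx).trans (le_add_of_nonneg_left h₁))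
    refine ⟨P + ‖χ‖ • L, Q + ‖χ‖ • K, ?_⟩
    funext y
    simp only [supportFun_add, supportFun_smul (norm_nonneg χ), Pi.sub_apply, Pi.add_apply,
      Pi.smul_apply, smul_eq_mul, hP, hQ]
    ring⟩
  map_add' v w := Subtype.ext (funext fun y => mul_add _ _ _)
  map_smul' c v := Subtype.ext (funext fun y => mul_left_comm _ _ _)

theorem angMul_apply (χ : Angular n) (v : dcSpace n) (y : E n) :
    (angMul χ v : E n → ℝ) y = χ y * (v : E n → ℝ) y := rfl

theorem angMul_add (χ η : Angular n) (v : dcSpace n) : angMul (χ + η) v = angMul χ v + angMul η v :=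
  Subtype.ext (funext fun y => add_mul (χ y) (η y) _)

theorem angMul_smul (c : ℝ) (χ : Angular n) (v : dcSpace n) : angMul (c • χ) v = c • angMul χ v :=
  Subtype.ext (funext fun y => mul_assoc c (χ y) _)

theorem angMul_dcOf {R : ℝ} (hR : 0 ≤ R) {χ : Angular n} (hχ : ‖χ‖ ≤ 1) {K : Body n}
    (hK : K ∈ bodiesInBall n R) : angMul χ (dcOf K) = dcOf (mulBody R χ K) - dcOf (addBall R K) := by
  refine Subtype.ext (funext fun y => ?_)
  change χ y * supportFun K y = supportFun _ y - supportFun _ y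
  rw [supportFun_mulBody hχ hK, supportFun_addBall hR]
  ring

theorem dcSpace_apply_zero (v : dcSpace n) : (v : E n → ℝ) 0 = 0 := by
  obtain ⟨_, K, L, rfl⟩ := v
  simp [supportFun_zero_arg]

theorem extMulti_sub {r : ℕ} (B : MultilinearMap ℝ≥0 (fun _ : Fin r => Body n) ℂ)
    (P Q : Fin r → Body n) : (extMulti B fun i => dcOf (P i) - dcOf (Q i)) =
      ∑ s : Finset (Fin r), (-1 : ℂ) ^ s.card * B (s.piecewise Q P) := by
  have h : (fun i => dcOf (P i) - dcOf (Q i)) =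
      (fun i => (-1 : ℝ) • dcOf (Q i)) + fun i => dcOf (P i) := by
    funext i
    rw [Pi.add_apply]
    module
  rw [h, MultilinearMap.map_add_univ]
  refine Finset.sum_congr rfl fun s _ => ?_
  have h1 : (s.piecewise (fun i => (-1 : ℝ) • dcOf (Q i)) fun i => dcOf (P i)) =
      s.piecewise (fun i => (-1 : ℝ) • dcOf ((s.piecewise Q P) i))
        (fun i => dcOf ((s.piecewise Q P) i)) := by
    funext i
    by_cases hi : i ∈ s <;> simp [hi]
  rw [h1, MultilinearMap.map_piecewise_smul, extMulti_dcOf, Finset.prod_const]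
  simp

/-- A multilinear map is polynomial along affine lines. -/
theorem exists_polynomial_line {V : Type*} [AddCommGroup V] [Module ℝ V] {r : ℕ}
    (S : MultilinearMap ℝ (fun _ : Fin r => V) ℂ) (a b : Fin r → V) :
    ∃ p : Polynomial ℂ, ∀ t : ℝ, p.eval (t : ℂ) = S fun i => a i + t • b i := by
  refine ⟨∑ s : Finset (Fin r), Polynomial.C (S (s.piecewise b a)) * Polynomial.X ^ s.card,
    fun t => ?_⟩
  have h : (fun i => a i + t • b i) = (fun i => t • b i) + a := by
    funext i
    rw [Pi.add_apply, add_comm]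
  rw [h, MultilinearMap.map_add_univ, Polynomial.eval_finsetSum]
  refine Finset.sum_congr rfl fun s _ => ?_
  have h1 : s.piecewise (fun i => t • b i) a =
      s.piecewise (fun i => t • (s.piecewise b a) i) (s.piecewise b a) := by
    funext i
    by_cases hi : i ∈ s <;> simp [hi]
  rw [h1, MultilinearMap.map_piecewise_smul, Finset.prod_const, Polynomial.eval_mul,
    Polynomial.eval_C, Polynomial.eval_pow, Polynomial.eval_X, Complex.real_smul, Complex.ofReal_pow,
    mul_comm]

/-- The functional `K ↦ B(χ₁ h_K, …, χ_r h_K)`. -/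
def angVal {r : ℕ} (B : MultilinearMap ℝ≥0 (fun _ : Fin r => Body n) ℂ) (χ : Fin r → Angular n)
    (K : Body n) : ℂ := extMulti B fun i => angMul (χ i) (dcOf K)

/-- `angVal` as a multilinear map of the multipliers. -/
def angValMulti {r : ℕ} (B : MultilinearMap ℝ≥0 (fun _ : Fin r => Body n) ℂ) (K : Body n) :
    MultilinearMap ℝ (fun _ : Fin r => Angular n) ℂ :=
  (extMulti B).compLinearMap fun _ =>
    { toFun := fun χ => angMul χ (dcOf K)
      map_add' := fun χ η => angMul_add χ η _
      map_smul' := fun c χ => angMul_smul c χ _ }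

theorem angValMulti_apply {r : ℕ} (B : MultilinearMap ℝ≥0 (fun _ : Fin r => Body n) ℂ) (K : Body n)
    (χ : Fin r → Angular n) : angValMulti B K χ = angVal B χ K := rfl

/-- If `φ(K) = B(K, …, K)` is a valuation, then so is `K ↦ B(χ h_K, …, χ h_K)`. For `t ≥ 0` there are
bodies with support functions `(χ + (1 + t)‖χ‖) h_K + c_t ‖·‖`, and `K` is mapped to them in a way that
respects maxima and minima of support functions. So the valuation property holds for `φ` of these
bodies; both sides are polynomials in `t`, and `t = -1` is the assertion. -/
theorem isValuation_angVal_const {r : ℕ} (B : MultilinearMap ℝ≥0 (fun _ : Fin r => Body n) ℂ)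
    (hB : IsValuation fun K => B fun _ => K) (χ : Angular n) :
    IsValuation (angVal B fun _ => χ) := by
  intro K L U I hU hI
  obtain ⟨R, hR, hUR⟩ := exists_norm_le U
  have hKU : ∀ x ∈ K, ‖x‖ ≤ R := fun x hx => hUR x (by rw [← SetLike.mem_coe, hU]; exact Or.inl hx)
  have hLU : ∀ x ∈ L, ‖x‖ ≤ R := fun x hx => hUR x (by rw [← SetLike.mem_coe, hU]; exact Or.inr hx)
  have hIU : ∀ x ∈ I, ‖x‖ ≤ R := fun x hx => hKU x (by
    rw [← SetLike.mem_coe, hI] at hx; exact hx.1)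
  have hN := norm_nonneg χ
  -- `w X` is the function whose multiples make `χ h_X` a support function
  set w : Body n → dcSpace n := fun X => ‖χ‖ • dcOf X + (10 * ‖χ‖ * R) • dcOf (unitBall n) with hw
  have hP : ∀ X : Body n, (∀ x ∈ X, ‖x‖ ≤ R) → ∀ t : ℝ, ∃ P : Body n, 0 ≤ t →
      ((∀ y, supportFun P y = (χ y + (1 + t) * ‖χ‖) * supportFun X y + 10 * ((1 + t) * ‖χ‖) * R * ‖y‖) ∧
        dcOf P = (angMul χ (dcOf X) + w X) + t • w X) := by
    intro X hX t
    by_cases ht : 0 ≤ t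
    · obtain ⟨P, hP⟩ := exists_supportFun_mul χ (N := (1 + t) * ‖χ‖) (by nlinarith) hX
      refine ⟨P, fun _ => ⟨fun y => by rw [hP y]; ring, Subtype.ext (funext fun y => ?_)⟩⟩
      change supportFun P y = (χ y * supportFun X y + (‖χ‖ * supportFun X y + (10 * ‖χ‖ * R) *
        supportFun (unitBall n) y)) + t * (‖χ‖ * supportFun X y + (10 * ‖χ‖ * R) *
        supportFun (unitBall n) y)
      rw [hP, supportFun_unitBall]
      ring
    · exact ⟨0, fun h => absurd h ht⟩
  -- `P X t` is the convex body with support function `χ h_X + (1 + t) w X`, for `t ≥ 0`.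
  choose! P hP using hP
  choose p hp using fun X : Body n => exists_polynomial_line (extMulti B)
    (fun _ => angMul χ (dcOf X) + w X) (fun _ => w X)
  have hval : ∀ X : Body n, (∀ x ∈ X, ‖x‖ ≤ R) → ∀ t : ℝ, 0 ≤ t →
      (p X).eval (t : ℂ) = B fun _ => P X t := by
    intro X hX t ht
    rw [hp, ← (hP X hX t ht).2, ← extMulti_dcOf]
  have hpos : ∀ t : ℝ, 0 ≤ t → ∀ y, 0 ≤ χ y + (1 + t) * ‖χ‖ := fun t ht y => by
    nlinarith [neg_le_of_abs_le (χ.abs_apply_le y)]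
  have hpoly : p U + p I = p K + p L := by
    refine polynomial_eq_of_eval_nonneg fun t ht => ?_
    rw [Polynomial.eval_add, Polynomial.eval_add, hval U hUR t ht, hval I hIU t ht,
      hval K hKU t ht, hval L hLU t ht]
    have hmax : ∀ y, supportFun (P U t) y = max (supportFun (P K t) y) (supportFun (P L t) y) := by
      intro y
      rw [(hP U hUR t ht).1, (hP K hKU t ht).1, (hP L hLU t ht).1, supportFun_union hU,
        max_add_add_right, mul_max_of_nonneg _ _ (hpos t ht y)]
    have hmin : ∀ y, supportFun (P I t) y = min (supportFun (P K t) y) (supportFun (P L t) y) := by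
      intro y
      rw [(hP I hIU t ht).1, (hP K hKU t ht).1, (hP L hLU t ht).1, supportFun_inter hU hI,
        min_add_add_right, mul_min_of_nonneg _ _ (hpos t ht y)]
    exact hB _ _ _ _ (coe_eq_union_of_supportFun hmax hmin) (coe_eq_inter_of_supportFun hmin)
  have hend : ∀ X : Body n, (p X).eval ((-1 : ℝ) : ℂ) = angVal B (fun _ => χ) X := by
    intro X
    rw [hp, angVal]
    congr 1
    funext i
    module
  rw [← hend, ← hend, ← hend, ← hend, ← Polynomial.eval_add, ← Polynomial.eval_add, hpoly]

theorem angVal_comp_perm {r : ℕ} (B : MultilinearMap ℝ≥0 (fun _ : Fin r => Body n) ℂ)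
    (hBs : ∀ (σ : Equiv.Perm (Fin r)) (K : Fin r → Body n), B (K ∘ σ) = B K)
    (χ : Fin r → Angular n) (σ : Equiv.Perm (Fin r)) (K : Body n) :
    angVal B (χ ∘ σ) K = angVal B χ K := extMulti_symm B hBs σ fun i => angMul (χ i) (dcOf K)

/-- Polarization reduces the case of different multipliers to that of equal ones. -/
theorem isValuation_angVal {r : ℕ} (B : MultilinearMap ℝ≥0 (fun _ : Fin r => Body n) ℂ)
    (hBs : ∀ (σ : Equiv.Perm (Fin r)) (K : Fin r → Body n), B (K ∘ σ) = B K)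
    (hB : IsValuation fun K => B fun _ => K) (χ : Fin r → Angular n) : IsValuation (angVal B χ) := by
  have h : angVal B χ = fun K => (r.factorial : ℂ)⁻¹ * ∑ I ∈ (Finset.univ : Finset (Fin r)).powerset,
      (-1 : ℂ) ^ (r + I.card) * angVal B (fun _ => ∑ i ∈ I, χ i) K := by
    funext K
    have := polarization_formula (angValMulti B K) (fun σ η => angVal_comp_perm B hBs η σ K) χ
    exact this
  rw [h]
  refine IsValuation.const_mul (IsValuation.sum _ fun I _ => ?_) _
  exact IsValuation.const_mul (isValuation_angVal_const B hB _) _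

theorem dcOf_pointBody (x : E n) :
    dcOf (pointBody x) = ∑ a, x a • dcOf (pointBody (EuclideanSpace.single a (1 : ℝ))) := by
  refine Subtype.ext ?_
  rw [AddSubmonoidClass.coe_finsetSum]
  funext y
  rw [Finset.sum_apply]
  change supportFun _ y = ∑ a, x a * supportFun _ y
  simp only [supportFun_pointBody, EuclideanSpace.inner_single_right]
  rw [PiLp.inner_apply]
  simp

/-- Translations add to the support function a linear functional, in which `B` is multilinear. -/
theorem angVal_translate {r : ℕ} (B : MultilinearMap ℝ≥0 (fun _ : Fin r => Body n) ℂ)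
    (χ : Fin r → Angular n) (K : Body n) :
    ∃ p : MvPolynomial (Fin n) ℂ, p.totalDegree ≤ r ∧
      ∀ x : E n, angVal B χ (translate K x) = MvPolynomial.eval (fun i => (x i : ℂ)) p := by
  set k : Option (Fin n) → MvPolynomial (Fin n) ℂ := fun o => o.elim 1 MvPolynomial.X with hk
  set d : Fin r → Option (Fin n) → dcSpace n := fun i o => o.elim (angMul (χ i) (dcOf K))
    fun a => angMul (χ i) (dcOf (pointBody (EuclideanSpace.single a (1 : ℝ)))) with hd
  refine ⟨∑ g : Fin r → Option (Fin n), MvPolynomial.C (extMulti B fun i => d i (g i)) * ∏ i, k (g i),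
    ?_, fun x => ?_⟩
  · refine MvPolynomial.totalDegree_finsetSum_le fun g _ => ?_
    refine (MvPolynomial.totalDegree_mul _ _).trans ?_
    rw [MvPolynomial.totalDegree_C, zero_add]
    refine (MvPolynomial.totalDegree_finsetProd _ _).trans ?_
    have : ∀ o, (k o).totalDegree ≤ 1 := by
      rintro (_ | a)
      · simp [hk]
      · simp [hk]
    exact (Finset.sum_le_sum fun i _ => this (g i)).trans (by simp)
  · set c : Option (Fin n) → ℝ := fun o => o.elim 1 x with hc
    have h1 : (fun i => angMul (χ i) (dcOf (translate K x))) = fun i => ∑ o, c o • d i o := by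
      funext i
      rw [translate_eq, dcOf_add, dcOf_pointBody, map_add, map_sum, Fintype.sum_option]
      simp [hc, hd]
    rw [angVal, h1, MultilinearMap.map_sum, map_sum]
    refine Finset.sum_congr rfl fun g _ => ?_
    rw [MultilinearMap.map_smul_univ (extMulti B) (fun i => c (g i)) (fun i => d i (g i)), map_mul,
      map_prod, MvPolynomial.eval_C, Complex.real_smul, mul_comm, Complex.ofReal_prod]
    congr 1
    refine Finset.prod_congr rfl fun i _ => ?_
    cases g i <;> simp [hc, hk]

theorem isPolynomialValuationOfDegree_angVal {r : ℕ}
    (B : MultilinearMap ℝ≥0 (fun _ : Fin r => Body n) ℂ)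
    (hBs : ∀ (σ : Equiv.Perm (Fin r)) (K : Fin r → Body n), B (K ∘ σ) = B K)
    (hB : IsValuation fun K => B fun _ => K) (χ : Fin r → Angular n) :
    IsPolynomialValuationOfDegree r (angVal B χ) :=
  ⟨isValuation_angVal B hBs hB χ, angVal_translate B χ⟩

theorem isHomogeneous_angVal {r : ℕ} (B : MultilinearMap ℝ≥0 (fun _ : Fin r => Body n) ℂ)
    (χ : Fin r → Angular n) : IsHomogeneous r (angVal B χ) := by
  intro t K ht
  have h : dcOf (t • K) = t • dcOf K := Subtype.ext (supportFun_smul ht K)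
  simp only [angVal, h, map_smul]
  rw [MultilinearMap.map_smul_univ (extMulti B) (fun _ => t)]
  simp

theorem sum_angVal {r M : ℕ} (B : MultilinearMap ℝ≥0 (fun _ : Fin r => Body n) ℂ)
    (ψ : Fin M → Angular n) (hψ : ∀ y : E n, y ≠ 0 → ∑ j, ψ j y = 1) (K : Body n) :
    ∑ f : Fin r → Fin M, angVal B (fun i => ψ (f i)) K = B fun _ => K := by
  have h : ∀ v : dcSpace n, ∑ j, angMul (ψ j) v = v := by
    intro v
    refine Subtype.ext ?_
    rw [AddSubmonoidClass.coe_finsetSum]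
    funext y
    rw [Finset.sum_apply]
    simp only [angMul_apply]
    rw [← Finset.sum_mul]
    rcases eq_or_ne y 0 with rfl | hy
    · rw [dcSpace_apply_zero, mul_zero]
    · rw [hψ y hy, one_mul]
  rw [← extMulti_dcOf]
  conv_rhs => rw [← funext fun _ : Fin r => h (dcOf K)]
  rw [MultilinearMap.map_sum]
  rfl

/-! ### Continuity and bounds of localized valuations -/

/-- The compact set of convex bodies contained in the ball of radius `R`. -/
def bodyCompacts (n : ℕ) (R : ℝ) : TopologicalSpace.Compacts (Body n) :=
  ⟨bodiesInBall n R, isCompact_bodiesInBall R⟩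

/-- Restriction of a continuous functional to a compact set of bodies. -/
def restrictTo (S : TopologicalSpace.Compacts (Body n)) : C(Body n, ℂ) →ₗ[ℂ] C(S, ℂ) where
  toFun φ := φ.comp ⟨Subtype.val, continuous_subtype_val⟩
  map_add' _ _ := rfl
  map_smul' _ _ := rfl

theorem restrictTo_apply (S : TopologicalSpace.Compacts (Body n)) (φ : C(Body n, ℂ)) (K : S) :
    restrictTo S φ K = φ K := rfl

/-- The rescaling of `χ` to norm one (or zero, if `χ = 0`). -/
def unitize (χ : Angular n) : Angular n := ‖χ‖⁻¹ • χ

theorem norm_unitize_le (χ : Angular n) : ‖unitize χ‖ ≤ 1 := by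
  rw [unitize, norm_smul, norm_inv, norm_norm]
  exact inv_mul_le_one

theorem norm_smul_unitize (χ : Angular n) : ‖χ‖ • unitize χ = χ := by
  rcases eq_or_ne χ 0 with rfl | h
  · simp
  · exact smul_inv_smul₀ (norm_ne_zero_iff.2 h) χ

theorem mulBody_mem {R : ℝ} (hR : 0 ≤ R) {χ : Angular n} (hχ : ‖χ‖ ≤ 1) {K : Body n}
    (hK : K ∈ bodiesInBall n R) : mulBody R χ K ∈ bodiesInBall n (12 * R) := by
  refine norm_le_of_supportFun_le (by positivity) fun y => ?_
  rw [supportFun_mulBody hχ hK]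
  have h1 : |supportFun K y| ≤ R * ‖y‖ := abs_supportFun_le hK y
  have h2 : χ y * supportFun K y ≤ 1 * (R * ‖y‖) := by
    refine (le_abs_self _).trans ?_
    rw [abs_mul]
    exact mul_le_mul ((χ.abs_apply_le y).trans hχ) h1 (abs_nonneg _) zero_le_one
  linarith [le_abs_self (supportFun K y)]

theorem addBall_mem {R : ℝ} (hR : 0 ≤ R) {K : Body n} (hK : K ∈ bodiesInBall n R) :
    addBall R K ∈ bodiesInBall n (12 * R) := by
  refine norm_le_of_supportFun_le (by positivity) fun y => ?_
  rw [supportFun_addBall hR]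
  have h1 : |supportFun K y| ≤ R * ‖y‖ := abs_supportFun_le hK y
  have := mul_nonneg hR (norm_nonneg y)
  linarith [le_abs_self (supportFun K y)]

theorem sum_mem_bodiesInBall {r : ℕ} {R : ℝ} (hR : 0 ≤ R) (I : Finset (Fin r)) {P : Fin r → Body n}
    (hP : ∀ i, P i ∈ bodiesInBall n R) : ∑ i ∈ I, P i ∈ bodiesInBall n (R * r) := by
  refine norm_le_of_supportFun_le (by positivity) fun y => ?_
  rw [supportFun_sum, Finset.sum_apply]
  have h : ∀ i, supportFun (P i) y ≤ R * ‖y‖ := fun i =>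
    (le_abs_self _).trans (abs_supportFun_le (hP i) y)
  calc _ ≤ ∑ i ∈ I, R * ‖y‖ := Finset.sum_le_sum fun i _ => h i
    _ = I.card * (R * ‖y‖) := by rw [Finset.sum_const, nsmul_eq_mul]
    _ ≤ r * (R * ‖y‖) := by
      have : (I.card : ℝ) ≤ r := by exact_mod_cast (Finset.card_le_univ I).trans_eq (Fintype.card_fin r)
      exact mul_le_mul_of_nonneg_right this (by positivity)
    _ = _ := by ring

theorem continuousOn_mulBody {R : ℝ} {χ : Angular n} (hχ : ‖χ‖ ≤ 1) :
    ContinuousOn (mulBody R χ) (bodiesInBall n R) := by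
  have h : LipschitzOnWith 2 (mulBody R χ) (bodiesInBall n R) := by
    refine LipschitzOnWith.of_dist_le_mul fun K hK L hL => ?_
    refine dist_le_of_abs_supportFun_sub_le (by positivity) fun y hy => ?_
    rw [supportFun_mulBody hχ hK, supportFun_mulBody hχ hL]
    have h1 := abs_supportFun_sub_le_dist K L y
    rw [hy, one_mul] at h1
    have h2 : |(χ y + 1) * (supportFun K y - supportFun L y)| ≤ 2 * dist K L := by
      rw [abs_mul]
      refine mul_le_mul ?_ h1 (abs_nonneg _) zero_le_two
      refine (abs_add_le _ _).trans ?_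
      rw [abs_one]
      linarith [(χ.abs_apply_le y).trans hχ]
    refine le_of_eq_of_le ?_ h2
    congr 1
    ring
  exact h.continuousOn

theorem continuous_addBall (R : ℝ) : Continuous (addBall (n := n) R) := by
  unfold addBall
  fun_prop

/-- The bodies at which a functional has to be evaluated to obtain the value of its polarization at
products of support functions with functions on the sphere. -/
def sampleMap (R : ℝ≥0) {r : ℕ} (χ : Fin r → Angular n) (s I : Finset (Fin r)) :
    C(bodyCompacts n R, bodyCompacts n (12 * R * r)) where
  toFun K := ⟨∑ i ∈ I, s.piecewise (fun _ => addBall R (K : Body n))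
    (fun i => mulBody R (unitize (χ i)) K) i, by
      refine sum_mem_bodiesInBall (by positivity) I fun i => ?_
      by_cases hi : i ∈ s
      · simpa [hi] using addBall_mem R.2 K.2
      · simpa [hi] using mulBody_mem R.2 (norm_unitize_le (χ i)) K.2⟩
  continuous_toFun := by
    refine Continuous.subtype_mk (continuous_finsetSum _ fun i _ => ?_) _
    by_cases hi : i ∈ s
    · simp only [hi, Finset.piecewise_eq_of_mem]
      exact (continuous_addBall _).comp continuous_subtype_val
    · simp only [hi, not_false_eq_true, Finset.piecewise_eq_of_notMem]
      exact (continuousOn_mulBody (norm_unitize_le (χ i))).comp_continuous continuous_subtype_val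
        fun K => K.2

/-- The coefficients in the formula expressing a polarization at differences of bodies. -/
def polCoeff {r : ℕ} (s I : Finset (Fin r)) : ℂ :=
  (-1) ^ s.card * ((r.factorial : ℂ)⁻¹ * (-1) ^ (r + I.card))

/-- For `f` the restriction of a functional with polarization `B`, this is the restriction of the
functional `K ↦ B(χ₁ h_K, …, χ_r h_K)`. The definition makes sense for all continuous functions `f`, but
it is multilinear in the `χᵢ` only for such `f` and their limits. -/
def theta (R : ℝ≥0) {r : ℕ} (χ : Fin r → Angular n) :
    C(bodyCompacts n (12 * R * r), ℂ) →ₗ[ℂ] C(bodyCompacts n R, ℂ) where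
  toFun f := ((∏ i, ‖χ i‖ : ℝ) : ℂ) • ∑ s : Finset (Fin r), ∑ I : Finset (Fin r),
    polCoeff s I • f.comp (sampleMap R χ s I)
  map_add' f g := by
    ext K
    simp [Finset.sum_add_distrib]
  map_smul' c f := by
    ext K
    simp only [ContinuousMap.smul_apply, ContinuousMap.sum_apply, ContinuousMap.comp_apply,
      smul_eq_mul, RingHom.id_apply, Finset.mul_sum]
    refine Finset.sum_congr rfl fun s _ => Finset.sum_congr rfl fun I _ => ?_
    ring

theorem theta_apply (R : ℝ≥0) {r : ℕ} (χ : Fin r → Angular n)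
    (f : C(bodyCompacts n (12 * R * r), ℂ)) : theta R χ f = ((∏ i, ‖χ i‖ : ℝ) : ℂ) •
      ∑ s : Finset (Fin r), ∑ I : Finset (Fin r), polCoeff s I • f.comp (sampleMap R χ s I) := rfl

theorem norm_theta_le (R : ℝ≥0) {r : ℕ} (χ : Fin r → Angular n)
    (f : C(bodyCompacts n (12 * R * r), ℂ)) : ‖theta R χ f‖ ≤
      (∑ s : Finset (Fin r), ∑ I : Finset (Fin r), ‖polCoeff s I‖) * ‖f‖ * ∏ i, ‖χ i‖ := by
  rw [theta_apply, norm_smul, Complex.norm_real, Real.norm_of_nonneg (by positivity), mul_comm]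
  refine mul_le_mul_of_nonneg_right ?_ (by positivity)
  rw [Finset.sum_mul]
  refine norm_sum_le_of_le _ fun s _ => ?_
  rw [Finset.sum_mul]
  refine norm_sum_le_of_le _ fun I _ => ?_
  rw [norm_smul]
  refine mul_le_mul_of_nonneg_left ?_ (norm_nonneg _)
  exact (ContinuousMap.norm_le _ (norm_nonneg f)).2 fun K => f.norm_coe_le_norm _

/-- The polarization formula for the value at products with functions on the sphere. -/
theorem theta_restrictTo (R : ℝ≥0) {r : ℕ} (B : MultilinearMap ℝ≥0 (fun _ : Fin r => Body n) ℂ)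
    (hBs : ∀ (σ : Equiv.Perm (Fin r)) (K : Fin r → Body n), B (K ∘ σ) = B K) (φ : C(Body n, ℂ))
    (hφ : ∀ K, φ K = B fun _ => K) (χ : Fin r → Angular n) (K : bodyCompacts n R) :
    theta R χ (restrictTo _ φ) K = angVal B χ K := by
  have h : angVal B χ K = ((∏ i, ‖χ i‖ : ℝ) : ℂ) * angVal B (fun i => unitize (χ i)) K := by
    have := (angValMulti B K).map_smul_univ (fun i => ‖χ i‖) (fun i => unitize (χ i))
    simp only [norm_smul_unitize, angValMulti_apply] at this
    rw [this, Complex.real_smul]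
  rw [h, theta_apply, ContinuousMap.smul_apply, smul_eq_mul, angVal]
  congr 1
  rw [funext fun i => angMul_dcOf R.2 (norm_unitize_le (χ i)) K.2, extMulti_sub,
    ContinuousMap.sum_apply]
  refine Finset.sum_congr rfl fun s _ => ?_
  rw [polarization_formula B hBs, Finset.mul_sum, Finset.mul_sum, ContinuousMap.sum_apply,
    Finset.powerset_univ]
  refine Finset.sum_congr rfl fun I _ => ?_
  rw [ContinuousMap.smul_apply, ContinuousMap.comp_apply, restrictTo_apply, hφ, polCoeff, smul_eq_mul]
  rw [mul_assoc, mul_assoc]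
  rfl

theorem continuous_angVal {r : ℕ} (B : MultilinearMap ℝ≥0 (fun _ : Fin r => Body n) ℂ)
    (hBs : ∀ (σ : Equiv.Perm (Fin r)) (K : Fin r → Body n), B (K ∘ σ) = B K)
    (hBc : Continuous B) (χ : Fin r → Angular n) : Continuous (angVal B χ) := by
  set φ : C(Body n, ℂ) := ⟨fun K => B fun _ => K, hBc.comp (continuous_pi fun _ => continuous_id)⟩
  rw [continuous_iff_continuousAt]
  intro K
  obtain ⟨R, hR, hK⟩ := exists_norm_le_of_isCompact (isCompact_singleton (x := K))
  have hKR := hK (mem_singleton K)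
  -- A neighbourhood of `K` consists of bodies in a fixed ball, and there `theta` yields a continuous
  -- function.
  have hmem : Metric.ball K 1 ⊆ bodiesInBall n (R + 1) := by
    intro L hL
    refine norm_le_of_supportFun_le (by positivity) fun y => ?_
    have h1 := supportFun_sub_le_dist L K y
    have h2 := (le_abs_self _).trans (abs_supportFun_le hKR y)
    have h3 : ‖y‖ * dist L K ≤ ‖y‖ * 1 := mul_le_mul_of_nonneg_left (Metric.mem_ball.1 hL).le
      (norm_nonneg y)
    linarith
  have hcont : ContinuousOn (angVal B χ) (bodiesInBall n (R + 1)) := by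
    rw [continuousOn_iff_continuous_domRestrict]
    have h := (theta ⟨R + 1, by positivity⟩ χ (restrictTo _ φ)).continuous
    refine h.congr fun L => ?_
    exact theta_restrictTo ⟨R + 1, by positivity⟩ B hBs φ (fun _ => rfl) χ L
  exact (hcont.mono hmem).continuousAt (Metric.ball_mem_nhds K one_pos)

/-- The continuous functions on a compact set of bodies for which `theta` is multilinear in the
multipliers. -/
def polarSpace (n : ℕ) (R : ℝ≥0) (r : ℕ) : Submodule ℝ C(bodyCompacts n (12 * R * r), ℂ) where
  carrier := {f | (∀ (χ : Fin r → Angular n) i x y, theta R (Function.update χ i (x + y)) f =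
      theta R (Function.update χ i x) f + theta R (Function.update χ i y) f) ∧
    ∀ (χ : Fin r → Angular n) i (c : ℝ) x, theta R (Function.update χ i (c • x)) f =
      c • theta R (Function.update χ i x) f}
  zero_mem' := ⟨fun _ _ _ _ => by simp only [map_zero, add_zero],
    fun _ _ _ _ => by simp only [map_zero, smul_zero]⟩
  add_mem' := by
    rintro f g ⟨hf, hf'⟩ ⟨hg, hg'⟩
    refine ⟨fun χ i x y => ?_, fun χ i c x => ?_⟩
    · simp only [map_add, hf, hg]
      abel
    · simp only [map_add, hf', hg', smul_add]
  smul_mem' := by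
    rintro a f ⟨hf, hf'⟩
    have h : ∀ χ : Fin r → Angular n, theta R χ (a • f) = a • theta R χ f := fun χ =>
      (theta R χ).map_smul (a : ℂ) f
    refine ⟨fun χ i x y => ?_, fun χ i c x => ?_⟩
    · simp only [h, hf, smul_add]
    · simp only [h, hf', smul_comm a c]

theorem continuous_theta (R : ℝ≥0) {r : ℕ} (χ : Fin r → Angular n) : Continuous (theta R χ) :=
  AddMonoidHomClass.continuous_of_bound (theta R χ)
    ((∑ s : Finset (Fin r), ∑ I : Finset (Fin r), ‖polCoeff s I‖) * ∏ i, ‖χ i‖) fun f => by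
      refine (norm_theta_le R χ f).trans_eq ?_
      ring

theorem isClosed_polarSpace (R : ℝ≥0) (r : ℕ) :
    IsClosed (polarSpace n R r : Set C(bodyCompacts n (12 * R * r), ℂ)) := by
  have h : (polarSpace n R r : Set C(bodyCompacts n (12 * R * r), ℂ)) =
      (⋂ (χ : Fin r → Angular n) (i) (x) (y), {f | theta R (Function.update χ i (x + y)) f =
        theta R (Function.update χ i x) f + theta R (Function.update χ i y) f}) ∩
      ⋂ (χ : Fin r → Angular n) (i) (c : ℝ) (x), {f | theta R (Function.update χ i (c • x)) f =
        c • theta R (Function.update χ i x) f} := by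
    ext f
    simp only [mem_inter_iff, mem_iInter]
    rfl
  rw [h]
  refine IsClosed.inter ?_ ?_
  · exact isClosed_iInter fun χ => isClosed_iInter fun i => isClosed_iInter fun x =>
      isClosed_iInter fun y => isClosed_eq (continuous_theta R _)
        ((continuous_theta R _).add (continuous_theta R _))
  · exact isClosed_iInter fun χ => isClosed_iInter fun i => isClosed_iInter fun c =>
      isClosed_iInter fun x => isClosed_eq (continuous_theta R _)
        ((continuous_theta R _).const_smul c)

theorem restrictTo_mem_polarSpace (R : ℝ≥0) {r : ℕ}
    (B : MultilinearMap ℝ≥0 (fun _ : Fin r => Body n) ℂ)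
    (hBs : ∀ (σ : Equiv.Perm (Fin r)) (K : Fin r → Body n), B (K ∘ σ) = B K) (φ : C(Body n, ℂ))
    (hφ : ∀ K, φ K = B fun _ => K) : restrictTo _ φ ∈ polarSpace n R r := by
  refine ⟨fun χ i x y => ?_, fun χ i c x => ?_⟩
  · ext K
    simp only [ContinuousMap.add_apply, theta_restrictTo R B hBs φ hφ]
    exact (angValMulti B K).map_update_add χ i x y
  · ext K
    simp only [ContinuousMap.smul_apply, theta_restrictTo R B hBs φ hφ]
    exact (angValMulti B K).map_update_smul χ i c x

/-- The bounded multilinear map `(χ₁, …, χ_r) ↦ theta R χ f`, for `f` in `polarSpace`. -/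
def thetaCMM (R : ℝ≥0) {r : ℕ} (f : polarSpace n R r) :
    ContinuousMultilinearMap ℝ (fun _ : Fin r => Angular n) C(bodyCompacts n R, ℂ) :=
  MultilinearMap.mkContinuous
    (MultilinearMap.mk' (fun χ => theta R χ f.1) f.2.1 f.2.2)
    ((∑ s : Finset (Fin r), ∑ I : Finset (Fin r), ‖polCoeff s I‖) * ‖f.1‖)
    (fun χ => norm_theta_le R χ f.1)

/-- `thetaCMM` as a bounded linear map. -/
def thetaMulti (n : ℕ) (R : ℝ≥0) (r : ℕ) : polarSpace n R r →L[ℝ]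
    ContinuousMultilinearMap ℝ (fun _ : Fin r => Angular n) C(bodyCompacts n R, ℂ) :=
  LinearMap.mkContinuous
    { toFun := thetaCMM R
      map_add' := fun f g => by
        ext1 χ
        exact map_add (theta R χ) f.1 g.1
      map_smul' := fun c f => by
        ext1 χ
        exact (theta R χ).map_smul (c : ℂ) f.1 }
    (∑ s : Finset (Fin r), ∑ I : Finset (Fin r), ‖polCoeff s I‖)
    (fun f => MultilinearMap.mkContinuous_norm_le _ (by positivity) fun χ => norm_theta_le R χ f.1)

/-! ### Smooth maps into spaces of functions -/

section Calculus

variable {G F H V : Type*} [NormedAddCommGroup G] [NormedSpace ℝ G] [NormedAddCommGroup F]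
  [NormedSpace ℝ F] [NormedAddCommGroup H] [NormedSpace ℝ H] [NormedAddCommGroup V]
  [NormedSpace ℝ V]

/-- A map into a closed subspace is smooth as soon as it is smooth as a map into the whole space. -/
theorem contDiffOn_of_coe [FiniteDimensional ℝ G] {Z : Submodule ℝ F} (hZ : IsClosed (Z : Set F))
    {U : Set G} (hU : IsOpen U) {g : G → Z} (hg : ContDiffOn ℝ ∞ (fun x => (g x : F)) U) :
    ContDiffOn ℝ ∞ g U := by
  have hderiv : ∀ g : G → Z, ContDiffOn ℝ ∞ (fun x => (g x : F)) U → ∀ x ∈ U,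
      ∃ g' : G →L[ℝ] Z, HasFDerivAt g g' x ∧ ∀ v, (g' v : F) = fderiv ℝ (fun x => (g x : F)) x v := by
    intro g hg x hx
    have hd : HasFDerivAt (fun x => (g x : F)) (fderiv ℝ (fun x => (g x : F)) x) x :=
      ((hg.contDiffAt (hU.mem_nhds hx)).differentiableAt (by simp)).hasFDerivAt
    have hmem : ∀ v, fderiv ℝ (fun x => (g x : F)) x v ∈ Z := by
      intro v
      have h1 : HasDerivAt (fun t : ℝ => (g (x + t • v) : F)) (fderiv ℝ (fun x => (g x : F)) x v) 0 := by
        have h2 : HasDerivAt (fun t : ℝ => x + t • v) v 0 := by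
          simpa using ((hasDerivAt_id (0 : ℝ)).smul_const v).const_add x
        have h3 : HasFDerivAt (fun x => (g x : F)) (fderiv ℝ (fun x => (g x : F)) x)
            ((fun t : ℝ => x + t • v) 0) := by simpa using hd
        exact h3.comp_hasDerivAt 0 h2
      rw [hasDerivAt_iff_tendsto_slope] at h1
      refine hZ.mem_of_tendsto h1 (Eventually.of_forall fun t => ?_)
      exact Z.smul_mem _ (Z.sub_mem (g _).2 (g _).2)
    refine ⟨(fderiv ℝ (fun x => (g x : F)) x).codRestrict Z hmem, ?_, fun v => rfl⟩
    rw [hasFDerivAt_iff_isLittleO_nhds_zero, ← Asymptotics.isLittleO_norm_left] at hd ⊢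
    exact hd
  have key : ∀ m : ℕ, ∀ g : G → Z, ContDiffOn ℝ ∞ (fun x => (g x : F)) U → ContDiffOn ℝ m g U := by
    intro m
    induction m with
    | zero =>
      intro g hg
      rw [Nat.cast_zero, contDiffOn_zero]
      intro x hx
      obtain ⟨g', hg', -⟩ := hderiv g hg x hx
      exact hg'.continuousAt.continuousWithinAt
    | succ m ih =>
      intro g hg
      rw [Nat.cast_succ, contDiffOn_succ_iff_fderiv_of_isOpen hU]
      refine ⟨fun x hx => ?_, by simp, ?_⟩
      · obtain ⟨g', hg', -⟩ := hderiv g hg x hx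
        exact hg'.differentiableAt.differentiableWithinAt
      · rw [contDiffOn_clm_apply]
        intro v
        refine ih _ ?_
        have h1 : ContDiffOn ℝ ∞ (fun x => fderiv ℝ (fun x => (g x : F)) x v) U :=
          (hg.fderiv_of_isOpen hU (by simp)).clm_apply contDiffOn_const
        refine h1.congr fun x hx => ?_
        obtain ⟨g', hg', h⟩ := hderiv g hg x hx
        rw [← h, hg'.fderiv]
  exact contDiffOn_infty.2 fun m => key m g hg

/-- The remainder of the first order expansion in the first variable is uniformly small on compact
sets. -/
theorem eventually_forall_norm_sub_le {W : Set (G × H)} (hW : IsOpen W) {h : G × H → F}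
    (hh : ContDiffOn ℝ ∞ h W) {x : G} {P : Set H} (hP : IsCompact P) (hxP : ∀ y ∈ P, (x, y) ∈ W)
    {ε : ℝ} (hε : 0 < ε) : ∀ᶠ z in 𝓝 x, ∀ y ∈ P,
      ‖h (z, y) - h (x, y) - fderiv ℝ h (x, y) (z - x, 0)‖ ≤ ε * ‖z - x‖ := by
  have hcont : ContinuousOn (fderiv ℝ h) W := (hh.fderiv_of_isOpen hW (m := 0) (by simp)).continuousOn
  have h1 : ∀ᶠ z in 𝓝 x, ∀ y ∈ P, (z, y) ∈ W ∧ ‖fderiv ℝ h (z, y) - fderiv ℝ h (x, y)‖ ≤ ε := by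
    refine hP.eventually_forall_of_forall_eventually fun y hy => ?_
    have hWy := hW.mem_nhds (hxP y hy)
    have hc : ContinuousAt (fderiv ℝ h) (x, y) := hcont.continuousAt hWy
    have hc2 : ContinuousAt (fun p : G × H => fderiv ℝ h (x, p.2)) (x, y) :=
      ContinuousAt.comp (f := fun p : G × H => (x, p.2)) (g := fderiv ℝ h) hc (by fun_prop)
    have h2 : Tendsto (fun p : G × H => ‖fderiv ℝ h p - fderiv ℝ h (x, p.2)‖) (𝓝 (x, y)) (𝓝 0) := by
      have h3 := (hc.sub hc2).norm
      simpa [ContinuousAt] using h3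
    filter_upwards [hWy, h2.eventually_lt_const hε] with p hp hp2
    exact ⟨hp, hp2.le⟩
  obtain ⟨δ, hδ, hball⟩ := Metric.eventually_nhds_iff_ball.1 h1
  filter_upwards [Metric.ball_mem_nhds x hδ] with z hz y hy
  have h4 := (convex_ball x δ).norm_image_sub_le_of_norm_hasFDerivWithin_le' (f := fun w => h (w, y))
    (f' := fun w => (fderiv ℝ h (w, y)).comp (ContinuousLinearMap.inl ℝ G H))
    (φ := (fderiv ℝ h (x, y)).comp (ContinuousLinearMap.inl ℝ G H)) (C := ε)
    (fun w hw => by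
      have hd : HasFDerivAt h (fderiv ℝ h (w, y)) (w, y) :=
        ((hh.contDiffAt (hW.mem_nhds (hball w hw y hy).1)).differentiableAt (by simp)).hasFDerivAt
      exact (hd.comp w (hasFDerivAt_prodMk_left w y)).hasFDerivWithinAt)
    (fun w hw => by
      rw [← ContinuousLinearMap.sub_comp]
      refine (ContinuousLinearMap.opNorm_comp_le _ _).trans ?_
      refine (mul_le_mul (hball w hw y hy).2 (ContinuousLinearMap.norm_inl_le_one ℝ G H)
        (norm_nonneg _) hε.le).trans_eq (mul_one _))
    (Metric.mem_ball_self hδ) hz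
  simpa using h4

/-- The partial derivative in the second variable. -/
def dsnd (h : G × H → F) (p : G × H) : H →L[ℝ] F :=
  (fderiv ℝ h p).comp (ContinuousLinearMap.inr ℝ G H)

/-- The derivative in the direction of a vector of the first factor. -/
def dfst (v : G) (h : G × H → F) (p : G × H) : F := fderiv ℝ h p (v, 0)

theorem contDiffOn_dsnd {W : Set (G × H)} (hW : IsOpen W) {h : G × H → F} (hh : ContDiffOn ℝ ∞ h W) :
    ContDiffOn ℝ ∞ (dsnd h) W :=
  (hh.fderiv_of_isOpen hW (by simp)).clm_comp contDiffOn_const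

theorem contDiffOn_dfst {W : Set (G × H)} (hW : IsOpen W) {h : G × H → F} (hh : ContDiffOn ℝ ∞ h W)
    (v : G) : ContDiffOn ℝ ∞ (dfst v h) W :=
  (hh.fderiv_of_isOpen hW (by simp)).clm_apply contDiffOn_const

/-- Symmetry of the second derivative. -/
theorem dfst_dsnd {W : Set (G × H)} (hW : IsOpen W) {h : G × H → F} (hh : ContDiffOn ℝ ∞ h W)
    (v : G) {p : G × H} (hp : p ∈ W) : dfst v (dsnd h) p = dsnd (dfst v h) p := by
  have hd : DifferentiableAt ℝ (fderiv ℝ h) p :=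
    ((hh.fderiv_of_isOpen hW (m := ∞) (by simp)).contDiffAt (hW.mem_nhds hp)).differentiableAt (by simp)
  have hs : IsSymmSndFDerivAt ℝ h p := (hh.contDiffAt (hW.mem_nhds hp)).isSymmSndFDerivAt
    (by rw [minSmoothness_of_isRCLikeNormedField]; exact WithTop.coe_le_coe.2 (le_top : (2 : ℕ∞) ≤ ⊤))
  have h1 : HasFDerivAt (dsnd h) ((ContinuousLinearMap.precomp F (ContinuousLinearMap.inr ℝ G H)).comp
      (fderiv ℝ (fderiv ℝ h) p)) p := by
    have := (ContinuousLinearMap.precomp F (ContinuousLinearMap.inr ℝ G H)).hasFDerivAt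
      (x := fderiv ℝ h p)
    exact this.comp p hd.hasFDerivAt
  have h2 : HasFDerivAt (dfst v h) ((ContinuousLinearMap.apply ℝ F ((v, 0) : G × H)).comp
      (fderiv ℝ (fderiv ℝ h) p)) p := by
    have := (ContinuousLinearMap.apply ℝ F ((v, 0) : G × H)).hasFDerivAt (x := fderiv ℝ h p)
    exact this.comp p hd.hasFDerivAt
  ext w
  rw [dfst, dsnd, h1.fderiv, h2.fderiv]
  exact hs (v, 0) (0, w)

theorem fderiv_snd_eq {W : Set (G × H)} (hW : IsOpen W) {h : G × H → F} (hh : ContDiffOn ℝ ∞ h W)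
    {x : G} {y : H} (hp : (x, y) ∈ W) : fderiv ℝ (fun z => h (x, z)) y = dsnd h (x, y) := by
  have hd : HasFDerivAt h (fderiv ℝ h (x, y)) (x, y) :=
    ((hh.contDiffAt (hW.mem_nhds hp)).differentiableAt (by simp)).hasFDerivAt
  exact (hd.comp y (hasFDerivAt_prodMk_right x y)).fderiv

end Calculus

section Angular

variable {G : Type*} [NormedAddCommGroup G]

/-- The domain of definition of a family of functions on the sphere. -/
def famDomain (n : ℕ) (U : Set G) : Set (G × E n) := U ×ˢ {y | y ≠ 0}

theorem isOpen_famDomain {U : Set G} (hU : IsOpen U) : IsOpen (famDomain n U) :=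
  hU.prod Angular.isOpen_ne

variable [NormedSpace ℝ G]

/-- The joint function of a family of functions on the sphere. -/
def joint (c : G → Angular n) (p : G × E n) : ℝ := c p.1 p.2

theorem fderiv_fam {U : Set G} (hU : IsOpen U) {c : G → Angular n}
    (hc : ContDiffOn ℝ ∞ (joint c) (famDomain n U)) {x : G} (hx : x ∈ U) {y : E n} (hy : y ≠ 0) :
    fderiv ℝ (c x) y = dsnd (joint c) (x, y) :=
  fderiv_snd_eq (h := joint c) (isOpen_famDomain hU) hc (mk_mem_prod hx hy)

theorem fderiv_fderiv_fam {U : Set G} (hU : IsOpen U) {c : G → Angular n}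
    (hc : ContDiffOn ℝ ∞ (joint c) (famDomain n U)) {x : G} (hx : x ∈ U) {y : E n} (hy : y ≠ 0) :
    fderiv ℝ (fderiv ℝ (c x)) y = dsnd (dsnd (joint c)) (x, y) := by
  rw [← fderiv_snd_eq (isOpen_famDomain hU) (contDiffOn_dsnd (isOpen_famDomain hU) hc)
    (mk_mem_prod hx hy)]
  refine Filter.EventuallyEq.fderiv_eq ?_
  filter_upwards [Angular.isOpen_ne.mem_nhds hy] with z hz
  exact fderiv_fam hU hc hx hz

/-- The derivative of a smooth family of functions on the sphere with respect to the parameter. -/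
def famDeriv {U : Set G} (hU : IsOpen U) {c : G → Angular n}
    (hc : ContDiffOn ℝ ∞ (joint c) (famDomain n U)) {x : G} (hx : x ∈ U) (v : G) : Angular n :=
  ⟨fun y => open Classical in if y = 0 then 0 else dfst v (joint c) (x, y), by
    refine ⟨?_, fun t y ht => ?_, by simp⟩
    · have h1 : ContDiffOn ℝ ∞ (fun y : E n => dfst v (joint c) (x, y)) {y | y ≠ 0} :=
        (contDiffOn_dfst (isOpen_famDomain hU) hc v).comp (contDiffOn_const.prodMk contDiffOn_id)
          fun y hy => mk_mem_prod hx hy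
      exact h1.congr fun y hy => by simp [show y ≠ 0 from hy]
    · by_cases hy : y = 0
      · simp [hy]
      · have hty : t • y ≠ 0 := smul_ne_zero ht.ne' hy
        simp only [hy, hty, if_false]
        have hd : ∀ y : E n, y ≠ 0 → HasFDerivAt (fun z => c z y)
            ((fderiv ℝ (joint c) (x, y)).comp (ContinuousLinearMap.inl ℝ G (E n))) x := fun y hy => by
          have hd : HasFDerivAt (joint c) (fderiv ℝ (joint c) (x, y)) (x, y) :=
            ((hc.contDiffAt ((isOpen_famDomain hU).mem_nhds (mk_mem_prod hx hy))).differentiableAt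
              (by simp)).hasFDerivAt
          have h2 := HasFDerivAt.comp (g := joint c) (f := fun z => (z, y)) x hd
            (hasFDerivAt_prodMk_left x y)
          exact h2
        have h1 := hd _ hty
        have h2 : (fun z => c z (t • y)) = fun z => c z y := funext fun z => (c z).apply_smul ht y
        rw [h2] at h1
        exact DFunLike.congr_fun (h1.unique (hd y hy)) v⟩

theorem famDeriv_apply {U : Set G} (hU : IsOpen U) {c : G → Angular n}
    (hc : ContDiffOn ℝ ∞ (joint c) (famDomain n U)) {x : G} (hx : x ∈ U) (v : G) {y : E n}
    (hy : y ≠ 0) : famDeriv hU hc hx v y = dfst v (joint c) (x, y) := if_neg hy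

theorem fderiv_famDeriv {U : Set G} (hU : IsOpen U) {c : G → Angular n}
    (hc : ContDiffOn ℝ ∞ (joint c) (famDomain n U)) {x : G} (hx : x ∈ U) (v : G) {y : E n}
    (hy : y ≠ 0) : fderiv ℝ (famDeriv hU hc hx v) y = dfst v (dsnd (joint c)) (x, y) := by
  rw [dfst_dsnd (isOpen_famDomain hU) hc v (mk_mem_prod hx hy),
    ← fderiv_snd_eq (isOpen_famDomain hU) (contDiffOn_dfst (isOpen_famDomain hU) hc v)
      (mk_mem_prod hx hy)]
  refine Filter.EventuallyEq.fderiv_eq ?_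
  filter_upwards [Angular.isOpen_ne.mem_nhds hy] with z hz
  exact famDeriv_apply hU hc hx v hz

theorem fderiv_fderiv_famDeriv {U : Set G} (hU : IsOpen U) {c : G → Angular n}
    (hc : ContDiffOn ℝ ∞ (joint c) (famDomain n U)) {x : G} (hx : x ∈ U) (v : G) {y : E n}
    (hy : y ≠ 0) : fderiv ℝ (fderiv ℝ (famDeriv hU hc hx v)) y =
      dfst v (dsnd (dsnd (joint c))) (x, y) := by
  have hW := isOpen_famDomain (n := n) hU
  rw [dfst_dsnd hW (contDiffOn_dsnd hW hc) v (mk_mem_prod hx hy),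
    ← fderiv_snd_eq hW (contDiffOn_dfst hW (contDiffOn_dsnd hW hc) v) (mk_mem_prod hx hy)]
  refine Filter.EventuallyEq.fderiv_eq ?_
  filter_upwards [Angular.isOpen_ne.mem_nhds hy] with z hz
  exact fderiv_famDeriv hU hc hx v hz

theorem Angular.norm_le_of (χ : Angular n) {C : ℝ} (hC : 0 ≤ C) (h0 : ∀ y ∈ shell n, |χ y| ≤ C)
    (h1 : ∀ y ∈ shell n, ‖fderiv ℝ χ y‖ ≤ C)
    (h2 : ∀ y ∈ shell n, ‖fderiv ℝ (fderiv ℝ χ) y‖ ≤ C) : ‖χ‖ ≤ C := by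
  rw [Angular.norm_eq]
  refine norm_prod_le_iff.2 ⟨(ContinuousMap.norm_le _ hC).2 fun y => h0 y y.2, ?_⟩
  exact norm_prod_le_iff.2 ⟨(ContinuousMap.norm_le _ hC).2 fun y => h1 y y.2,
    (ContinuousMap.norm_le _ hC).2 fun y => h2 y y.2⟩

/-- `famDeriv` as a linear map in the direction. -/
def famDerivLin {U : Set G} (hU : IsOpen U) {c : G → Angular n}
    (hc : ContDiffOn ℝ ∞ (joint c) (famDomain n U)) {x : G} (hx : x ∈ U) : G →ₗ[ℝ] Angular n where
  toFun := famDeriv hU hc hx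
  map_add' v w := Angular.ext_fun fun y => by
    rw [Angular.add_apply]
    rcases eq_or_ne y 0 with rfl | hy
    · simp only [Angular.apply_zero, add_zero]
    · rw [famDeriv_apply _ _ _ _ hy, famDeriv_apply _ _ _ _ hy, famDeriv_apply _ _ _ _ hy, dfst, dfst,
        dfst, ← map_add, Prod.mk_add_mk, add_zero]
  map_smul' a v := Angular.ext_fun fun y => by
    rw [RingHom.id_apply, Angular.smul_apply]
    rcases eq_or_ne y 0 with rfl | hy
    · simp only [Angular.apply_zero, mul_zero]
    · rw [famDeriv_apply _ _ _ _ hy, famDeriv_apply _ _ _ _ hy, dfst, dfst, ← smul_eq_mul, ← map_smul,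
        Prod.smul_mk, smul_zero]

set_option synthInstance.maxHeartbeats 200000 in
/-- A smooth family of functions on the sphere is differentiable in the `C²`-norm, as the first order
expansions of the family and of its first two derivatives in `y` are uniform on the shell. -/
theorem hasFDerivAt_fam [FiniteDimensional ℝ G] {U : Set G} (hU : IsOpen U) {c : G → Angular n}
    (hc : ContDiffOn ℝ ∞ (joint c) (famDomain n U)) {x : G} (hx : x ∈ U) :
    HasFDerivAt c (LinearMap.toContinuousLinearMap (famDerivLin hU hc hx)) x := by
  have hW := isOpen_famDomain (n := n) hU
  have hxP : ∀ y ∈ shell n, (x, y) ∈ famDomain n U := fun y hy =>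
    mk_mem_prod hx (ne_zero_of_mem_shell hy)
  rw [hasFDerivAt_iff_isLittleO, Asymptotics.isLittleO_iff]
  intro ε hε
  filter_upwards [eventually_forall_norm_sub_le hW hc isCompact_shell hxP hε,
    eventually_forall_norm_sub_le hW (contDiffOn_dsnd hW hc) isCompact_shell hxP hε,
    eventually_forall_norm_sub_le hW (contDiffOn_dsnd hW (contDiffOn_dsnd hW hc)) isCompact_shell
      hxP hε, hU.mem_nhds hx] with z h0 h1 h2 hz
  rw [LinearMap.coe_toContinuousLinearMap']
  change ‖c z - c x - famDeriv hU hc hx (z - x)‖ ≤ _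
  have e1 : ∀ y : E n, y ≠ 0 → fderiv ℝ ⇑(c z - c x - famDeriv hU hc hx (z - x)) y =
      fderiv ℝ (c z) y - fderiv ℝ (c x) y - fderiv ℝ (famDeriv hU hc hx (z - x)) y := by
    intro y hy
    have a1 := (c z).differentiableAt hy
    have a2 := (c x).differentiableAt hy
    have a3 := (famDeriv hU hc hx (z - x)).differentiableAt hy
    exact ((a1.hasFDerivAt.sub a2.hasFDerivAt).sub a3.hasFDerivAt).fderiv
  have e2 : ∀ y : E n, y ≠ 0 → fderiv ℝ (fderiv ℝ ⇑(c z - c x - famDeriv hU hc hx (z - x))) y =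
      fderiv ℝ (fderiv ℝ (c z)) y - fderiv ℝ (fderiv ℝ (c x)) y -
        fderiv ℝ (fderiv ℝ (famDeriv hU hc hx (z - x))) y := by
    intro y hy
    have a1 := (c z).differentiableAt_fderiv hy
    have a2 := (c x).differentiableAt_fderiv hy
    have a3 := (famDeriv hU hc hx (z - x)).differentiableAt_fderiv hy
    refine HasFDerivAt.fderiv (HasFDerivAt.congr_of_eventuallyEq
      ((a1.hasFDerivAt.sub a2.hasFDerivAt).sub a3.hasFDerivAt) ?_)
    filter_upwards [Angular.isOpen_ne.mem_nhds hy] with w hw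
    exact e1 w hw
  refine Angular.norm_le_of _ (by positivity) (fun y hy => ?_) (fun y hy => ?_) (fun y hy => ?_)
  · have hy0 := ne_zero_of_mem_shell hy
    have := h0 y hy
    change |c z y - c x y - famDeriv hU hc hx (z - x) y| ≤ _
    rwa [famDeriv_apply _ _ _ _ hy0]
  · have hy0 := ne_zero_of_mem_shell hy
    rw [e1 y hy0, fderiv_famDeriv _ _ _ _ hy0, fderiv_fam hU hc hz hy0, fderiv_fam hU hc hx hy0]
    exact h1 y hy
  · have hy0 := ne_zero_of_mem_shell hy
    rw [e2 y hy0, fderiv_fderiv_famDeriv _ _ _ _ hy0, fderiv_fderiv_fam hU hc hz hy0,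
      fderiv_fderiv_fam hU hc hx hy0]
    exact h2 y hy

/-- A family of smooth functions on the sphere that is jointly smooth is smooth as a map into the space
of functions with the `C²`-norm. -/
theorem contDiffOn_fam [FiniteDimensional ℝ G] {U : Set G} (hU : IsOpen U) {c : G → Angular n}
    (hc : ContDiffOn ℝ ∞ (joint c) (famDomain n U)) : ContDiffOn ℝ ∞ c U := by
  have key : ∀ m : ℕ, ∀ c : G → Angular n, ContDiffOn ℝ ∞ (joint c) (famDomain n U) →
      ContDiffOn ℝ m c U := by
    intro m
    induction m with
    | zero =>
      intro c hc
      rw [Nat.cast_zero, contDiffOn_zero]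
      intro x hx
      exact (hasFDerivAt_fam hU hc hx).continuousAt.continuousWithinAt
    | succ m ih =>
      intro c hc
      rw [Nat.cast_succ, contDiffOn_succ_iff_fderiv_of_isOpen hU]
      refine ⟨fun x hx => (hasFDerivAt_fam hU hc hx).differentiableAt.differentiableWithinAt,
        by simp, ?_⟩
      rw [contDiffOn_clm_apply]
      intro v
      refine ih _ ?_
      refine (contDiffOn_dfst (isOpen_famDomain hU) hc v).congr fun p hp => ?_
      rw [joint, (hasFDerivAt_fam hU hc hp.1).fderiv]
      exact famDeriv_apply hU hc hp.1 v hp.2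
  exact contDiffOn_infty.2 fun m => key m c hc

end Angular

/-! ### Smoothness under the general linear group -/

/-- Linear images of convex bodies as a linear map over the nonnegative reals. -/
def linImageLin (A : E n →L[ℝ] E n) : Body n →ₗ[ℝ≥0] Body n where
  toFun := linImage A
  map_add' K L := supportFun_injective <| funext fun y => by
    simp only [supportFun_linImage, supportFun_add, Pi.add_apply]
  map_smul' a K := supportFun_injective <| funext fun y => by
    simp only [supportFun_linImage, supportFun_nnsmul, RingHom.id_apply, Pi.smul_apply]

/-- The action of linear maps on differences of support functions. -/
def dcPull (A : E n →L[ℝ] E n) : dcSpace n →ₗ[ℝ] dcSpace n where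
  toFun v := ⟨fun y => (v : E n → ℝ) (A.adjoint y), by
    obtain ⟨_, K, L, rfl⟩ := v
    refine ⟨linImage A K, linImage A L, funext fun y => ?_⟩
    simp only [Pi.sub_apply, supportFun_linImage]⟩
  map_add' v w := rfl
  map_smul' c v := rfl

/-- The pullback of a multilinear functional of convex bodies under a linear map. -/
def imageMulti {r : ℕ} (B : MultilinearMap ℝ≥0 (fun _ : Fin r => Body n) ℂ) (A : E n →L[ℝ] E n) :
    MultilinearMap ℝ≥0 (fun _ : Fin r => Body n) ℂ := B.compLinearMap fun _ => linImageLin A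

theorem imageMulti_apply {r : ℕ} (B : MultilinearMap ℝ≥0 (fun _ : Fin r => Body n) ℂ)
    (A : E n →L[ℝ] E n) (K : Fin r → Body n) : imageMulti B A K = B fun i => linImage A (K i) := rfl

theorem imageMulti_symm {r : ℕ} {B : MultilinearMap ℝ≥0 (fun _ : Fin r => Body n) ℂ}
    (hBs : ∀ (σ : Equiv.Perm (Fin r)) (K : Fin r → Body n), B (K ∘ σ) = B K) (A : E n →L[ℝ] E n)
    (σ : Equiv.Perm (Fin r)) (K : Fin r → Body n) : imageMulti B A (K ∘ σ) = imageMulti B A K :=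
  hBs σ fun i => linImage A (K i)

theorem dcPull_dcOf (A : E n →L[ℝ] E n) (K : Body n) : dcPull A (dcOf K) = dcOf (linImage A K) :=
  Subtype.ext (funext fun y => (supportFun_linImage A K y).symm)

theorem extMulti_comp_linImage {r : ℕ} (B : MultilinearMap ℝ≥0 (fun _ : Fin r => Body n) ℂ)
    (A : E n →L[ℝ] E n) (v : Fin r → dcSpace n) :
    extMulti (imageMulti B A) v = extMulti B fun i => dcPull A (v i) := by
  have h : v = fun i => dcOf (dcPos (v i)) - dcOf (dcNeg (v i)) :=
    funext fun i => (dcOf_pos_sub_neg (v i)).symm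
  rw [h]
  simp only [map_sub, dcPull_dcOf]
  rw [extMulti_sub, extMulti_sub]
  refine Finset.sum_congr rfl fun s _ => ?_
  rw [imageMulti_apply]
  congr 2
  funext i
  by_cases hi : i ∈ s <;> simp [hi]

/-- Equivariance: a linear map acts on localized valuations by acting on `B` and on the multipliers. -/
theorem angVal_linImage {r : ℕ} (B : MultilinearMap ℝ≥0 (fun _ : Fin r => Body n) ℂ)
    (A : E n →L[ℝ] E n) {χ χ' : Fin r → Angular n} (h : ∀ i y, χ' i (A.adjoint y) = χ i y)
    (K : Body n) : angVal B χ (linImage A K) =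
      angVal (imageMulti B A) χ' K := by
  rw [angVal, angVal, extMulti_comp_linImage]
  congr 1
  funext i
  refine Subtype.ext (funext fun y => ?_)
  change χ i y * supportFun (linImage A K) y = χ' i (A.adjoint y) * supportFun K (A.adjoint y)
  rw [supportFun_linImage, h]

/-- The adjoint as a linear map. -/
def adjointLin (n : ℕ) : (E n →L[ℝ] E n) →ₗ[ℝ] E n →L[ℝ] E n where
  toFun := ContinuousLinearMap.adjoint
  map_add' := map_add _
  map_smul' c A := by simp

theorem adjoint_ne_zero (u : GLn n) {y : E n} (hy : y ≠ 0) :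
    ContinuousLinearMap.adjoint (u : E n →L[ℝ] E n) y ≠ 0 := by
  intro h
  have h1 : ContinuousLinearMap.adjoint ((u⁻¹ : GLn n) : E n →L[ℝ] E n)
      (ContinuousLinearMap.adjoint (u : E n →L[ℝ] E n) y) = y := by
    rw [← ContinuousLinearMap.comp_apply, ← ContinuousLinearMap.adjoint_comp]
    have : (u : E n →L[ℝ] E n).comp ((u⁻¹ : GLn n) : E n →L[ℝ] E n) = 1 := u.mul_inv
    rw [this, ContinuousLinearMap.one_def, ContinuousLinearMap.adjoint_id]
    rfl
  rw [h, map_zero] at h1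
  exact hy h1.symm

/-- The composition of a function on the sphere (extended homogeneously) with the transpose of an
invertible linear map. -/
def angComp (u : GLn n) (χ : Angular n) : Angular n :=
  ⟨fun y => χ (ContinuousLinearMap.adjoint (u : E n →L[ℝ] E n) y), by
    refine ⟨?_, fun t y ht => ?_, ?_⟩
    · exact χ.contDiffOn.comp (ContinuousLinearMap.contDiff _).contDiffOn
        fun y hy => adjoint_ne_zero u hy
    · beta_reduce
      rw [map_smul, χ.apply_smul ht]
    · beta_reduce
      rw [map_zero, χ.apply_zero]⟩

theorem angComp_apply (u : GLn n) (χ : Angular n) (y : E n) :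
    angComp u χ y = χ (ContinuousLinearMap.adjoint (u : E n →L[ℝ] E n) y) := rfl

/-- The extension by zero of a function on `GL(n, ℝ)` to all endomorphisms. -/
def glExtend {V : Type*} [Zero V] (f : GLn n → V) (a : E n →L[ℝ] E n) : V :=
  open Classical in if h : IsUnit a then f h.unit else 0

theorem glExtend_coe {V : Type*} [Zero V] (f : GLn n → V) (u : GLn n) :
    glExtend f (u : E n →L[ℝ] E n) = f u := by
  have h : IsUnit (u : E n →L[ℝ] E n) := u.isUnit
  rw [glExtend, dif_pos h]
  congr 1
  exact Units.ext rfl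

theorem isOpen_isUnit : IsOpen {a : E n →L[ℝ] E n | IsUnit a} := Units.isOpen

/-- Smoothness on the Lie group `GL(n, ℝ)` is smoothness on an open subset of the space of
endomorphisms. -/
theorem contMDiff_iff_glExtend {V : Type*} [NormedAddCommGroup V] [NormedSpace ℝ V] (f : GLn n → V) :
    ContMDiff 𝓘(ℝ, E n →L[ℝ] E n) 𝓘(ℝ, V) ∞ f ↔
      ContDiffOn ℝ ∞ (glExtend f) {a : E n →L[ℝ] E n | IsUnit a} := by
  constructor
  · intro hf
    have h1 := contMDiffOn_isOpenEmbedding_symm (I := 𝓘(ℝ, E n →L[ℝ] E n)) (n := ∞)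
      (Units.isOpenEmbedding_val (R := E n →L[ℝ] E n))
    have h2 := hf.comp_contMDiffOn h1
    rw [contMDiffOn_iff_contDiffOn] at h2
    have hrange : range (Units.val : GLn n → E n →L[ℝ] E n) = {a | IsUnit a} := by
      ext a; rfl
    rw [hrange] at h2
    refine h2.congr fun a ha => ?_
    obtain ⟨u, rfl⟩ := ha
    rw [glExtend_coe, Function.comp_apply]
    congr 1
    exact (OpenPartialHomeomorph.left_inv (IsOpenEmbedding.toOpenPartialHomeomorph _
      (Units.isOpenEmbedding_val (R := E n →L[ℝ] E n))) (mem_univ u)).symm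
  · intro hf
    have h1 : ContMDiffOn 𝓘(ℝ, E n →L[ℝ] E n) 𝓘(ℝ, V) ∞ (glExtend f) {a | IsUnit a} :=
      contMDiffOn_iff_contDiffOn.2 hf
    have h2 := h1.comp_contMDiff (Units.contMDiff_val (𝕜 := ℝ) (R := E n →L[ℝ] E n) (n := ∞))
      fun u => u.isUnit
    have h3 : glExtend f ∘ (Units.val : GLn n → E n →L[ℝ] E n) = f := funext (glExtend_coe f)
    rwa [h3] at h2

/-- Composition with a fixed continuous map as a bounded linear map. -/
def compCLM {X Y : Type*} [TopologicalSpace X] [CompactSpace X] [TopologicalSpace Y] [CompactSpace Y]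
    (σ : C(X, Y)) : C(Y, ℂ) →L[ℝ] C(X, ℂ) :=
  LinearMap.mkContinuous
    { toFun := fun f => f.comp σ
      map_add' := fun _ _ => rfl
      map_smul' := fun _ _ => rfl } 1 fun f => by
    rw [one_mul]
    exact (ContinuousMap.norm_le _ (norm_nonneg f)).2 fun x => f.norm_coe_le_norm _

theorem IsGLSmooth.add {φ ψ : C(Body n, ℂ)} (hφ : IsGLSmooth φ) (hψ : IsGLSmooth ψ) :
    IsGLSmooth (φ + ψ) := fun S => (hφ S).add (hψ S)

theorem IsGLSmooth.const_smul {φ : C(Body n, ℂ)} (hφ : IsGLSmooth φ) (c : ℂ) :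
    IsGLSmooth (c • φ) := by
  intro S
  have h : ContDiff ℝ ∞ fun f : C(S, ℂ) => c • f := contDiff_const_smul c
  exact h.contMDiff.comp (hφ S)

theorem isGLSmooth_zero : IsGLSmooth (0 : C(Body n, ℂ)) := fun S =>
  contMDiff_const (c := (0 : C(S, ℂ)))

theorem IsGLSmooth.sum {ι : Type*} (s : Finset ι) {φ : ι → C(Body n, ℂ)}
    (h : ∀ i ∈ s, IsGLSmooth (φ i)) : IsGLSmooth (∑ i ∈ s, φ i) :=
  Finset.sum_induction _ IsGLSmooth (fun _ _ => IsGLSmooth.add) isGLSmooth_zero h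

theorem IsGLSmooth.comp_smul {φ : C(Body n, ℂ)} (hφ : IsGLSmooth φ) {t : ℝ} (ht : 0 ≤ t) :
    IsGLSmooth (φ.comp ⟨fun K => t • K, continuous_smul_body ht⟩) := by
  intro S
  let m : C(Body n, Body n) := ⟨fun K => t • K, continuous_smul_body ht⟩
  let S' : TopologicalSpace.Compacts (Body n) := S.map m m.continuous
  let σ : C(S, S') := ⟨fun K => ⟨m K, mem_image_of_mem m K.2⟩,
    (m.continuous.comp continuous_subtype_val).subtype_mk _⟩
  have h := (compCLM σ).contDiff (n := ∞) |>.contMDiff.comp (hφ S')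
  refine h.congr fun g => ?_
  ext K
  change φ (t • linImage _ (K : Body n)) = φ (linImage _ (t • (K : Body n)))
  congr 1
  apply supportFun_injective
  funext y
  rw [supportFun_smul ht, Pi.smul_apply, supportFun_linImage, supportFun_linImage, supportFun_smul ht,
    Pi.smul_apply]

theorem isGLSmooth_homPart {φ : C(Body n, ℂ)} (hφ : IsGLSmooth φ) (D r : ℕ) :
    IsGLSmooth (homPart D φ r) :=
  IsGLSmooth.sum _ fun i _ => (hφ.comp_smul (Nat.cast_nonneg i)).const_smul _

theorem contDiffOn_glExtend_angComp (χ : Angular n) :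
    ContDiffOn ℝ ∞ (glExtend fun u : GLn n => angComp u χ) {a | IsUnit a} := by
  refine contDiffOn_fam isOpen_isUnit ?_
  have h1 : ContDiff ℝ ∞ fun p : (E n →L[ℝ] E n) × E n => ContinuousLinearMap.adjoint p.1 p.2 := by
    have h2 : ContDiff ℝ ∞ (LinearMap.toContinuousLinearMap (adjointLin n)) :=
      ContinuousLinearMap.contDiff _
    have h3 : ContDiff ℝ ∞ fun p : (E n →L[ℝ] E n) × E n =>
        (LinearMap.toContinuousLinearMap (adjointLin n)) p.1 := h2.comp contDiff_fst
    exact h3.clm_apply contDiff_snd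
  have h4 : ContDiffOn ℝ ∞ (fun p : (E n →L[ℝ] E n) × E n => χ (ContinuousLinearMap.adjoint p.1 p.2))
      (famDomain n {a : E n →L[ℝ] E n | IsUnit a}) := by
    refine χ.contDiffOn.comp h1.contDiffOn ?_
    rintro ⟨a, y⟩ ⟨⟨u, rfl⟩, hy⟩
    exact adjoint_ne_zero u hy
  refine h4.congr ?_
  rintro ⟨a, y⟩ ⟨⟨u, rfl⟩, hy⟩
  rw [joint, glExtend_coe, angComp_apply]

theorem contDiffOn_clm_multilinear {G Z X Y Y' : Type*} [NormedAddCommGroup G] [NormedSpace ℝ G]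
    [NormedAddCommGroup Z] [NormedSpace ℝ Z] [NormedAddCommGroup X] [NormedSpace ℝ X]
    [NormedAddCommGroup Y] [NormedSpace ℝ Y] [CompleteSpace Y] [NormedAddCommGroup Y']
    [NormedSpace ℝ Y'] {r : ℕ} (L : Y →L[ℝ] Y')
    (Θ : Z →L[ℝ] ContinuousMultilinearMap ℝ (fun _ : Fin r => X) Y)
    {U : Set G} {F : G → Z} (hF : ContDiffOn ℝ ∞ F U) {c : Fin r → G → X}
    (hc : ∀ i, ContDiffOn ℝ ∞ (c i) U) :
    ContDiffOn ℝ ∞ (fun a => L (Θ (F a) fun i => c i a)) U := by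
  refine L.contDiff.comp_contDiffOn ?_
  have h1 : ContDiff ℝ ∞ fun p : Z × (Fin r → X) => Θ p.1 p.2 :=
    Θ.analyticOnNhd_uncurry_of_multilinear.contDiff
  exact h1.comp_contDiffOn (hF.prodMk (contDiffOn_pi.2 hc))

/-- If a homogeneous functional is smooth, then so are the functionals obtained by multiplying the
arguments of its polarization with functions on the sphere. -/
theorem isGLSmooth_angVal {r : ℕ} (B : MultilinearMap ℝ≥0 (fun _ : Fin r => Body n) ℂ)
    (hBs : ∀ (σ : Equiv.Perm (Fin r)) (K : Fin r → Body n), B (K ∘ σ) = B K) {φ : C(Body n, ℂ)}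
    (hφ : ∀ K, φ K = B fun _ => K) (hsm : IsGLSmooth φ) (χ : Fin r → Angular n) {ψ : C(Body n, ℂ)}
    (hψ : ∀ K, ψ K = angVal B χ K) : IsGLSmooth ψ := by
  intro S
  obtain ⟨R₀, hR₀, hS⟩ := exists_norm_le_of_isCompact S.isCompact
  set R : ℝ≥0 := ⟨R₀, hR₀⟩ with hR
  -- the action on `ψ` is expressed by the action on `φ` and on the multipliers
  have hact : ∀ (g : GLn n) (K : bodyCompacts n R), ψ (linImage ((g⁻¹ : GLn n) : E n →L[ℝ] E n) K) =
      theta R (fun i => angComp g (χ i)) (restrictTo _ (glAct g φ)) K := by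
    intro g K
    have hadj : ∀ y, ContinuousLinearMap.adjoint (g : E n →L[ℝ] E n)
        (ContinuousLinearMap.adjoint ((g⁻¹ : GLn n) : E n →L[ℝ] E n) y) = y := by
      intro y
      rw [← ContinuousLinearMap.comp_apply, ← ContinuousLinearMap.adjoint_comp]
      have : ((g⁻¹ : GLn n) : E n →L[ℝ] E n).comp (g : E n →L[ℝ] E n) = 1 := g.inv_mul
      rw [this, ContinuousLinearMap.one_def, ContinuousLinearMap.adjoint_id]
      rfl
    rw [hψ, angVal_linImage B _ (χ' := fun i => angComp g (χ i))
      (fun i y => by rw [angComp_apply, hadj])]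
    exact (theta_restrictTo R _ (imageMulti_symm hBs _) (glAct g φ)
      (fun K => hφ (linImage _ K)) _ K).symm
  have hmem : ∀ g : GLn n, restrictTo _ (glAct g φ) ∈ polarSpace n R r := fun g =>
    restrictTo_mem_polarSpace R _ (imageMulti_symm hBs _) _ fun K => hφ (linImage _ K)
  -- `theta` is jointly smooth only on the closed subspace `polarSpace`, through which the action on
  -- `φ` factors.
  set F : (E n →L[ℝ] E n) → polarSpace n R r := glExtend fun g => ⟨_, hmem g⟩ with hF
  have hFs : ContDiffOn ℝ ∞ F {a | IsUnit a} := by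
    refine contDiffOn_of_coe (isClosed_polarSpace R r) isOpen_isUnit ?_
    refine ((contMDiff_iff_glExtend _).1 (hsm (bodyCompacts n (12 * R * r)))).congr ?_
    rintro _ ⟨u, rfl⟩
    rw [hF, glExtend_coe, glExtend_coe]
    rfl
  let σ : C(S, bodyCompacts n R) := ⟨fun K => ⟨K, hS K.2⟩, continuous_subtype_val.subtype_mk _⟩
  rw [contMDiff_iff_glExtend]
  have hall : ContDiffOn ℝ ∞ (fun a => compCLM σ (thetaMulti n R r (F a)
      fun i => glExtend (fun u => angComp u (χ i)) a)) {a | IsUnit a} := by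
    exact contDiffOn_clm_multilinear _ _ hFs fun i => contDiffOn_glExtend_angComp (χ i)
  refine hall.congr ?_
  rintro _ ⟨u, rfl⟩
  rw [glExtend_coe]
  ext K
  change ψ (linImage _ (K : Body n)) = thetaMulti n R r (F u) _ (σ K)
  simp only [hF, glExtend_coe]
  exact hact u (σ K)

/-! ### Mollification in the `C^k`-topology -/

section Mollification

open MeasureTheory
open scoped Convolution

variable {V : Type} [NormedAddCommGroup V] [NormedSpace ℝ V] [FiniteDimensional ℝ V]
  [MeasurableSpace V] [BorelSpace V] {μ : Measure V} [μ.IsAddHaarMeasure]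

/-- The derivatives of a convolution fall on the second factor. -/
theorem iteratedFDeriv_convolution_apply {A : Type*} [NormedAddCommGroup A] [NormedSpace ℝ A]
    {f : V → A} (hf : Continuous f) (m : ℕ) :
    ∀ {F F' : Type} [NormedAddCommGroup F] [NormedSpace ℝ F] [NormedAddCommGroup F'] [NormedSpace ℝ F']
      [CompleteSpace F'] (L : A →L[ℝ] F →L[ℝ] F') {g : V → F} (_ : HasCompactSupport g)
      (_ : ContDiff ℝ ∞ g) (x : V) (v : Fin m → V), iteratedFDeriv ℝ m (f ⋆[L, μ] g) x v =
        ∫ t, L (f t) (iteratedFDeriv ℝ m g (x - t) v) ∂μ := by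
  induction m with
  | zero =>
    intro F F' _ _ _ _ _ L g hg hgs x v
    simp [convolution_def]
  | succ m ih =>
    intro F F' _ _ _ _ _ L g hg hgs x v
    have hd : fderiv ℝ (f ⋆[L, μ] g) = f ⋆[L.precompR V, μ] fderiv ℝ g := funext fun y =>
      (hg.hasFDerivAt_convolution_right L hf.locallyIntegrable (hgs.of_le (by simp)) y).fderiv
    have hgs' : ContDiff ℝ ∞ (fderiv ℝ g) := hgs.fderiv_right (by simp)
    rw [iteratedFDeriv_succ_apply_right]
    change (iteratedFDeriv ℝ m (fderiv ℝ (f ⋆[L, μ] g)) x (Fin.init v)) (v (Fin.last m)) = _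
    rw [hd, ih (L.precompR V) (hg.fderiv ℝ) hgs' x (Fin.init v)]
    have hD : Continuous (iteratedFDeriv ℝ m (fderiv ℝ g)) :=
      hgs'.continuous_iteratedFDeriv (by exact_mod_cast le_top)
    have hcont : Continuous fun t => (L.precompR V) (f t)
        (iteratedFDeriv ℝ m (fderiv ℝ g) (x - t) (Fin.init v)) := by
      have h1 : Continuous fun t => iteratedFDeriv ℝ m (fderiv ℝ g) (x - t) (Fin.init v) :=
        (ContinuousMultilinearMap.apply ℝ (fun _ : Fin m => V) (V →L[ℝ] F) (Fin.init v)).continuous.comp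
          (hD.comp (continuous_const.sub continuous_id))
      exact ((L.precompR V).continuous.comp hf).clm_apply h1
    have hsupp : HasCompactSupport fun t => (L.precompR V) (f t)
        (iteratedFDeriv ℝ m (fderiv ℝ g) (x - t) (Fin.init v)) := by
      have h1 : HasCompactSupport fun t => iteratedFDeriv ℝ m (fderiv ℝ g) (x - t) :=
        ((hg.fderiv ℝ).iteratedFDeriv m).comp_homeomorph (Homeomorph.subLeft x)
      refine h1.mono fun t ht => ?_
      rw [Function.mem_support] at ht ⊢
      contrapose! ht
      rw [ht]
      simp
    rw [ContinuousLinearMap.integral_apply (hcont.integrable_of_hasCompactSupport hsupp)]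
    refine integral_congr_ae (Eventually.of_forall fun t => ?_)
    beta_reduce
    rw [iteratedFDeriv_succ_apply_right]
    rfl

/-- Mollification approximates the derivatives. -/
theorem norm_iteratedFDeriv_convolution_sub_le {f : V → ℂ} (hf : ContDiff ℝ ∞ f)
    (hfs : HasCompactSupport f) {ρ : V → ℝ} (hρ : Continuous ρ) (hρs : HasCompactSupport ρ)
    (hρ0 : ∀ t, 0 ≤ ρ t) (hρ1 : ∫ t, ρ t ∂μ = 1) {m : ℕ} {η : ℝ} (hη : 0 ≤ η) {x : V}
    (h : ∀ t, ρ t ≠ 0 → ‖iteratedFDeriv ℝ m f (x - t) - iteratedFDeriv ℝ m f x‖ ≤ η) :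
    ‖iteratedFDeriv ℝ m ((fun t => (ρ t : ℂ)) ⋆[ContinuousLinearMap.mul ℝ ℂ, μ] f) x -
      iteratedFDeriv ℝ m f x‖ ≤ η := by
  refine ContinuousMultilinearMap.opNorm_le_bound hη fun v => ?_
  have hρc : Continuous fun t => (ρ t : ℂ) := Complex.continuous_ofReal.comp hρ
  have hρcs : HasCompactSupport fun t => (ρ t : ℂ) := hρs.comp_left (g := Complex.ofReal) rfl
  rw [sub_apply, iteratedFDeriv_convolution_apply hρc m _ hfs hf]
  simp only [ContinuousLinearMap.mul_apply']
  have hint1 : Integrable (fun t => (ρ t : ℂ) * iteratedFDeriv ℝ m f (x - t) v) μ := by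
    refine Continuous.integrable_of_hasCompactSupport ?_ hρcs.mul_right
    refine hρc.mul ?_
    have hD : Continuous (iteratedFDeriv ℝ m f) :=
      hf.continuous_iteratedFDeriv (by exact_mod_cast le_top)
    exact (ContinuousMultilinearMap.apply ℝ (fun _ : Fin m => V) ℂ v).continuous.comp
      (hD.comp (continuous_const.sub continuous_id))
  have hint2 : Integrable (fun t => (ρ t : ℂ) * iteratedFDeriv ℝ m f x v) μ :=
    (hρc.integrable_of_hasCompactSupport hρcs).mul_const _
  have e : iteratedFDeriv ℝ m f x v = ∫ t, (ρ t : ℂ) * iteratedFDeriv ℝ m f x v ∂μ := by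
    rw [integral_mul_const, integral_complex_ofReal, hρ1, Complex.ofReal_one, one_mul]
  conv_lhs => rw [e]
  rw [← integral_sub hint1 hint2]
  calc _ ≤ ∫ t, ρ t * (η * ∏ i, ‖v i‖) ∂μ := by
        refine norm_integral_le_of_norm_le ((hρ.integrable_of_hasCompactSupport hρs).mul_const _)
          (Eventually.of_forall fun t => ?_)
        rw [← mul_sub, norm_mul, Complex.norm_real, Real.norm_of_nonneg (hρ0 t)]
        rcases eq_or_ne (ρ t) 0 with h0 | h0
        · rw [h0, zero_mul, zero_mul]
        · refine mul_le_mul_of_nonneg_left ?_ (hρ0 t)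
          rw [← sub_apply]
          exact (ContinuousMultilinearMap.le_opNorm _ _).trans
            (mul_le_mul_of_nonneg_right (h t h0) (by positivity))
    _ = _ := by rw [integral_mul_const, hρ1, one_mul]

/-- The space of smooth complex-valued functions. -/
def smoothSubmodule (V : Type*) [NormedAddCommGroup V] [NormedSpace ℝ V] : Submodule ℂ (V → ℂ) where
  carrier := {f | ContDiff ℝ ∞ f}
  zero_mem' := by
    change ContDiff ℝ ∞ fun _ : V => (0 : ℂ)
    exact contDiff_const
  add_mem' := by
    intro f g hf hg
    change ContDiff ℝ ∞ (f + g)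
    exact ContDiff.add (f := f) (g := g) hf hg
  smul_mem' := by
    intro c f hf
    change ContDiff ℝ ∞ (c • f)
    exact ContDiff.const_smul (f := f) c hf

theorem contDiff_coe {V : Type*} [NormedAddCommGroup V] [NormedSpace ℝ V] (f : smoothSubmodule V) :
    ContDiff ℝ ∞ f.1 := f.2

theorem continuous_iteratedFDeriv_coe {V : Type*} [NormedAddCommGroup V] [NormedSpace ℝ V]
    (f : smoothSubmodule V) (m : ℕ) : Continuous (iteratedFDeriv ℝ m f.1) :=
  (contDiff_coe f).continuous_iteratedFDeriv (by exact_mod_cast le_top)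

/-- The space of jets of order `k` at a point. -/
abbrev Jet (V : Type*) [NormedAddCommGroup V] [NormedSpace ℝ V] (k : ℕ) : Type _ :=
  ∀ m : Fin (k + 1), ContinuousMultilinearMap ℝ (fun _ : Fin m => V) ℂ

/-- The continuous functions with values in a normed space. -/
abbrev NormedFun (X F : Type*) [TopologicalSpace X] [NormedAddCommGroup F] : Type _ := C(X, F)

/-- The `k`-jet of a smooth function along a compact set. -/
def jetOn {V : Type*} [NormedAddCommGroup V] [NormedSpace ℝ V] (P : Set V) (k : ℕ) :
    smoothSubmodule V →ₗ[ℂ] NormedFun P (Jet V k) where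
  toFun f := ⟨fun p m => iteratedFDeriv ℝ m f.1 p, continuous_pi fun m =>
    (continuous_iteratedFDeriv_coe f m).comp continuous_subtype_val⟩
  map_add' f g := by
    ext1 p
    funext m
    exact iteratedFDeriv_add_apply ((contDiff_coe f).contDiffAt.of_le (by exact_mod_cast le_top))
      ((contDiff_coe g).contDiffAt.of_le (by exact_mod_cast le_top))
  map_smul' c f := by
    ext1 p
    funext m
    exact iteratedFDeriv_const_smul_apply ((contDiff_coe f).contDiffAt.of_le (by exact_mod_cast le_top))

theorem jetOn_apply {V : Type*} [NormedAddCommGroup V] [NormedSpace ℝ V] (P : Set V) (k : ℕ)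
    (f : smoothSubmodule V) (p : P) (m : Fin (k + 1)) :
    jetOn P k f p m = iteratedFDeriv ℝ m f.1 p := rfl

/-- The translate of a smooth function. -/
def translateSmooth {V : Type*} [NormedAddCommGroup V] [NormedSpace ℝ V] (ρ : smoothSubmodule V)
    (t : V) : smoothSubmodule V :=
  ⟨fun x => ρ.1 (x - t), (contDiff_coe ρ).comp (contDiff_id.sub contDiff_const)⟩

theorem continuous_jetOn_translate {V : Type*} [NormedAddCommGroup V] [NormedSpace ℝ V] {P : Set V}
    [CompactSpace P] (k : ℕ) (ρ : smoothSubmodule V) :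
    Continuous fun t => jetOn P k (translateSmooth ρ t) := by
  have h : Continuous fun q : V × P => fun m : Fin (k + 1) =>
      iteratedFDeriv ℝ m ρ.1 ((q.2 : V) - q.1) := by
    refine continuous_pi fun m => (continuous_iteratedFDeriv_coe ρ m).comp ?_
    exact (continuous_subtype_val.comp continuous_snd).sub continuous_fst
  refine ((ContinuousMap.curry ⟨_, h⟩).continuous).congr fun t => ?_
  ext1 p
  funext m
  rw [jetOn_apply]
  exact (iteratedFDeriv_comp_sub (f := ρ.1) m t p).symm

/-- A linear functional of smooth functions that is bounded by a `C^k`-norm on a compact set vanishes at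
a compactly supported function if it vanishes at suitably translated mollifiers. -/
theorem eq_zero_of_mollifier {P : Set V} [CompactSpace P] (Λ : smoothSubmodule V →ₗ[ℂ] ℂ) {k : ℕ}
    {C : ℝ} (hΛ : ∀ g, ‖Λ g‖ ≤ C * ‖jetOn P k g‖) (f : smoothSubmodule V) (hf : HasCompactSupport f.1)
    (hρ : ∀ ε > 0, ∃ (ρ : smoothSubmodule V) (b : V → ℝ), (∀ x, ρ.1 x = b x) ∧ HasCompactSupport b ∧
      Continuous b ∧ (∀ x, 0 ≤ b x) ∧ ∫ x, b x ∂μ = 1 ∧ (∀ x, b x ≠ 0 → ‖x‖ ≤ ε) ∧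
      ∀ t, f.1 t ≠ 0 → Λ (translateSmooth ρ t) = 0) : Λ f = 0 := by
  have hC0 : ∀ g, ‖Λ g‖ ≤ (max C 0) * ‖jetOn P k g‖ := fun g =>
    (hΛ g).trans (mul_le_mul_of_nonneg_right (le_max_left _ _) (norm_nonneg _))
  set Z : Submodule ℂ (NormedFun P (Jet V k)) :=
    ((LinearMap.ker Λ).map (jetOn P k)).topologicalClosure with hZ
  have hZclosed : IsClosed (Z : Set (NormedFun P (Jet V k))) := Submodule.isClosed_topologicalClosure _
  have hfc : Continuous f.1 := (contDiff_coe f).continuous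
  -- membership of the jet of `f` in the closure of the jets of the kernel suffices
  suffices hmem : jetOn P k f ∈ Z by
    rw [← norm_le_zero_iff]
    refine le_of_forall_pos_le_add fun δ hδ => ?_
    obtain ⟨_, ⟨g, hg, rfl⟩, hgd⟩ := Metric.mem_closure_iff.1 hmem (δ / (max C 0 + 1))
      (by positivity)
    have h1 : Λ f = Λ (f - g) := by rw [map_sub, LinearMap.mem_ker.1 hg, sub_zero]
    rw [h1, zero_add]
    refine (hC0 _).trans ?_
    rw [map_sub, ← dist_eq_norm]
    have h2 : 0 ≤ max C 0 := le_max_right _ _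
    calc _ ≤ max C 0 * (δ / (max C 0 + 1)) := mul_le_mul_of_nonneg_left hgd.le h2
      _ ≤ (max C 0 + 1) * (δ / (max C 0 + 1)) :=
        mul_le_mul_of_nonneg_right (by linarith) (by positivity)
      _ = δ := mul_div_cancel₀ _ (by positivity)
  refine hZclosed.closure_subset (Metric.mem_closure_iff.2 fun η hη => ?_)
  -- uniform continuity of the derivatives
  have hunif : ∀ m : Fin (k + 1), ∃ ε > 0, ∀ x y : V, dist x y < ε →
      dist (iteratedFDeriv ℝ m f.1 x) (iteratedFDeriv ℝ m f.1 y) < η / 2 := fun m =>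
    Metric.uniformContinuous_iff.1 ((hf.iteratedFDeriv (𝕜 := ℝ) m).uniformContinuous_of_continuous
      (continuous_iteratedFDeriv_coe f m)) (η / 2) (half_pos hη)
  choose ε hε hεf using hunif
  obtain ⟨ε₀, hε₀, hε₀'⟩ : ∃ ε₀ > 0, ∀ m, ε₀ < ε m := by
    obtain ⟨m₀, hm₀⟩ := Finite.exists_min ε
    exact ⟨ε m₀ / 2, half_pos (hε m₀), fun m => (half_lt_self (hε m₀)).trans_le (hm₀ m)⟩
  obtain ⟨ρ, b, hρb, hbs, hbc, hb0, hb1, hbε, hΛρ⟩ := hρ ε₀ hε₀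
  have hρs : HasCompactSupport ρ.1 := by
    refine hbs.mono fun x hx => ?_
    rw [Function.mem_support, hρb] at hx
    rw [Function.mem_support]
    exact fun h => hx (by rw [h, Complex.ofReal_zero])
  have hρfun : ρ.1 = fun x => (b x : ℂ) := funext hρb
  -- the mollification as a Bochner integral of jets of translated mollifiers
  set h : V → NormedFun P (Jet V k) := fun t => f.1 t • jetOn P k (translateSmooth ρ t) with hh
  have hhc : Continuous h := hfc.smul (continuous_jetOn_translate k ρ)
  have hhs : HasCompactSupport h := hf.smul_right
  have hhZ : ∀ t, h t ∈ Z := by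
    intro t
    rcases eq_or_ne (f.1 t) 0 with h0 | h0
    · rw [hh]
      simp only [h0, zero_smul]
      exact Z.zero_mem
    · exact Z.smul_mem _ (Submodule.le_topologicalClosure _
        ⟨_, LinearMap.mem_ker.2 (hΛρ t h0), rfl⟩)
  have hint : Integrable h μ := hhc.integrable_of_hasCompactSupport hhs
  have hI : ∫ t, h t ∂μ ∈ Z := by
    have : CompleteSpace Z := hZclosed.completeSpace_coe
    have hc' : Continuous fun t => (⟨h t, hhZ t⟩ : Z) := hhc.subtype_mk hhZ
    have hs' : HasCompactSupport fun t => (⟨h t, hhZ t⟩ : Z) := by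
      refine hhs.mono fun t ht => ?_
      rw [Function.mem_support] at ht ⊢
      exact fun h0 => ht (Subtype.ext h0)
    have := (Z.subtypeL.restrictScalars ℝ).integral_comp_comm
      (hc'.integrable_of_hasCompactSupport (μ := μ) hs')
    change ∫ t, h t ∂μ = _ at this
    rw [this]
    exact Subtype.property _
  refine ⟨_, hI, ?_⟩
  have hval : ∀ (p : P) (m : Fin (k + 1)), (∫ t, h t ∂μ) p m =
      iteratedFDeriv ℝ m ((fun t => (b t : ℂ)) ⋆[ContinuousLinearMap.mul ℝ ℂ, μ] f.1) p := by
    intro p m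
    have hflip : (fun t => (b t : ℂ)) ⋆[ContinuousLinearMap.mul ℝ ℂ, μ] f.1 =
        f.1 ⋆[ContinuousLinearMap.mul ℝ ℂ, μ] ρ.1 := by
      funext x
      rw [convolution_eq_swap, convolution_def, hρfun]
      simp only [ContinuousLinearMap.mul_apply', mul_comm]
    rw [hflip]
    ext v
    rw [iteratedFDeriv_convolution_apply hfc m _ hρs (contDiff_coe ρ)]
    let ev : NormedFun P (Jet V k) →L[ℝ] ℂ :=
      (ContinuousMultilinearMap.apply ℝ (fun _ : Fin m => V) ℂ v).comp
        ((ContinuousLinearMap.proj m).comp (ContinuousMap.evalCLM ℝ p))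
    have := ev.integral_comp_comm hint
    change ∫ t, ev (h t) ∂μ = (∫ t, h t ∂μ) p m v at this
    rw [← this]
    refine integral_congr_ae (Eventually.of_forall fun t => ?_)
    change f.1 t * iteratedFDeriv ℝ m (fun x => ρ.1 (x - t)) p v = f.1 t * _
    rw [iteratedFDeriv_comp_sub]
  refine lt_of_le_of_lt ?_ (half_lt_self hη)
  refine (ContinuousMap.dist_le (half_pos hη).le).2 fun p => (dist_pi_le_iff (half_pos hη).le).2 fun m => ?_
  rw [hval, dist_comm, dist_eq_norm, jetOn_apply]
  refine norm_iteratedFDeriv_convolution_sub_le (contDiff_coe f) hf hbc hbs hb0 hb1 (half_pos hη).le ?_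
  intro t ht
  rw [← dist_eq_norm]
  refine (hεf m _ _ ?_).le
  rw [dist_eq_norm, sub_sub_cancel_left, norm_neg]
  exact (hbε t ht).trans_lt (hε₀' m)

end Mollification

/-! ### Distributions on products of spheres that vanish on tensor products -/

theorem isOpen_punctured (n r : ℕ) : IsOpen (punctured n r) := by
  have : punctured n r = ⋂ i, {x : Fin r → E n | x i ≠ 0} := by
    ext x; simp [punctured]
  rw [this]
  exact isOpen_iInter_of_finite fun i => isOpen_ne.preimage (continuous_apply i)

/-- The radial projection onto the product of spheres. -/
def normalizeAll {r : ℕ} (x : Fin r → E n) : Fin r → E n := fun i => ‖x i‖⁻¹ • x i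

theorem contDiffOn_normalizeAll (n r : ℕ) :
    ContDiffOn ℝ ∞ (normalizeAll (n := n) (r := r)) (punctured n r) := by
  refine contDiffOn_pi.2 fun i => ?_
  have hi : ContDiffOn ℝ ∞ (fun x : Fin r → E n => x i) (punctured n r) :=
    (contDiff_apply ℝ (E n) i).contDiffOn
  exact ((hi.norm ℝ fun x hx => hx i).inv fun x hx => norm_ne_zero_iff.2 (hx i)).smul hi

/-- The product of spheres as a subset of the product of Euclidean spaces. -/
def spherePts (n r : ℕ) : Set (Fin r → E n) := {p | ∀ i, ‖p i‖ = 1}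

theorem isCompact_spherePts (n r : ℕ) : IsCompact (spherePts n r) := by
  have : spherePts n r = Set.pi univ fun _ => Metric.sphere (0 : E n) 1 := by
    ext p; simp [spherePts, Set.mem_pi]
  rw [this]
  exact isCompact_univ_pi fun _ => isCompact_sphere _ _

instance (n r : ℕ) : CompactSpace (spherePts n r) := isCompact_iff_compactSpace.1 (isCompact_spherePts n r)

theorem spherePts_subset (n r : ℕ) : spherePts n r ⊆ punctured n r := fun p hp i hi => by
  have := hp i
  rw [hi, norm_zero] at this
  exact zero_ne_one this

theorem normalizeAll_mem {r : ℕ} {p : Fin r → E n} (hp : p ∈ spherePts n r) : normalizeAll p = p := by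
  funext i
  rw [normalizeAll, hp i, inv_one, one_smul]

/-- The restriction to the product of spheres of a function on the product of Euclidean spaces. -/
def sphereRestrict {r : ℕ} (g : (Fin r → E n) → ℂ) : (Fin r → Sph n) → ℂ := fun p => g fun i => p i

theorem ext0_sphereRestrict {r : ℕ} (g : (Fin r → E n) → ℂ) {x : Fin r → E n} (hx : x ∈ punctured n r) :
    ext0 (sphereRestrict g) x = g (normalizeAll x) := dif_pos hx

/-- The restriction of smooth functions to the product of spheres. -/
def restrictSmooth (n r : ℕ) : smoothSubmodule (Fin r → E n) →ₗ[ℂ] SmoothFun n r where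
  toFun g := ⟨sphereRestrict g.1, by
    have h : ContDiffOn ℝ ∞ (g.1 ∘ normalizeAll) (punctured n r) :=
      (contDiff_coe g).comp_contDiffOn (contDiffOn_normalizeAll n r)
    exact h.congr fun x hx => ext0_sphereRestrict g.1 hx⟩
  map_add' _ _ := rfl
  map_smul' _ _ := rfl

/-- The order of a distribution is finite also in terms of the jets of functions on the product of
Euclidean spaces, by the chain rule for the radial projection. -/
theorem exists_bound_restrictSmooth {r : ℕ} (T : SphereDistribution n r) :
    ∃ (k : ℕ) (C : ℝ), ∀ g : smoothSubmodule (Fin r → E n),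
      ‖T.toLin (restrictSmooth n r g)‖ ≤ C * ‖jetOn (spherePts n r) k g‖ := by
  obtain ⟨k, C, hC⟩ := T.bound
  have hN : ContDiffOn ℝ ∞ (normalizeAll (n := n) (r := r)) (punctured n r) :=
    contDiffOn_normalizeAll n r
  have ho := isOpen_punctured n r
  -- a bound for the derivatives of the radial projection
  have hD : ∀ i : ℕ, ∃ D : ℝ, ∀ p ∈ spherePts n r,
      ‖iteratedFDerivWithin ℝ i (normalizeAll (n := n) (r := r)) (punctured n r) p‖ ≤ D := by
    intro i
    have hc : ContinuousOn (iteratedFDerivWithin ℝ i (normalizeAll (n := n) (r := r)) (punctured n r))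
        (spherePts n r) :=
      (hN.continuousOn_iteratedFDerivWithin (by exact_mod_cast le_top) ho.uniqueDiffOn).mono
        (spherePts_subset n r)
    exact (isCompact_spherePts n r).exists_bound_of_continuousOn hc
  choose D hD using hD
  set D₀ : ℝ := 1 + ∑ i ∈ Finset.range (k + 1), |D i| with hD₀
  have hD₀1 : 1 ≤ D₀ := le_add_of_nonneg_right (Finset.sum_nonneg fun _ _ => abs_nonneg _)
  have hDle : ∀ i ≤ k, D i ≤ D₀ := fun i hi => by
    have h1 : |D i| ≤ ∑ i ∈ Finset.range (k + 1), |D i| :=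
      Finset.single_le_sum (f := fun i => |D i|) (fun _ _ => abs_nonneg _)
        (Finset.mem_range.2 (Nat.lt_succ_of_le hi))
    linarith [le_abs_self (D i)]
  refine ⟨k, C * (k.factorial * D₀ ^ k), fun g => ?_⟩
  rw [mul_assoc]
  refine hC _ _ (by positivity) fun m hm p => ?_
  have hp : (fun i => (p i : E n)) ∈ spherePts n r := fun i => mem_sphere_zero_iff_norm.1 (p i).2
  have hpp := spherePts_subset n r hp
  have hEq : ext0 (restrictSmooth n r g) =ᶠ[𝓝 fun i => (p i : E n)] g.1 ∘ normalizeAll := by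
    filter_upwards [ho.mem_nhds hpp] with x hx
    exact ext0_sphereRestrict g.1 hx
  rw [(hEq.iteratedFDeriv ℝ m).self_of_nhds, ← iteratedFDerivWithin_of_isOpen m ho hpp]
  have h := norm_iteratedFDerivWithin_comp_le (n := m) (N := ∞) (contDiff_coe g).contDiffOn hN
    (by exact_mod_cast le_top) uniqueDiffOn_univ ho.uniqueDiffOn (mapsTo_univ _ _) hpp
    (C := ‖jetOn (spherePts n r) k g‖) (D := D₀) (fun i hi => by
      rw [normalizeAll_mem hp, iteratedFDerivWithin_univ]
      have h1 := ContinuousMap.norm_coe_le_norm (jetOn (spherePts n r) k g) ⟨_, hp⟩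
      have h2 := norm_le_pi_norm (jetOn (spherePts n r) k g ⟨_, hp⟩)
        ⟨i, Nat.lt_succ_of_le (hi.trans hm)⟩
      exact h2.trans h1) (fun i hi him => by
      refine ((hD i _ hp).trans (hDle i (him.trans hm))).trans ?_
      exact le_self_pow₀ hD₀1 (by omega))
  refine h.trans ?_
  have h1 : (m.factorial : ℝ) ≤ k.factorial := by exact_mod_cast Nat.factorial_le hm
  have h2 : D₀ ^ m ≤ D₀ ^ k := pow_le_pow_right₀ hD₀1 hm
  have h3 := norm_nonneg (jetOn (spherePts n r) k g)
  have h0 : 0 ≤ D₀ ^ m := by positivity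
  calc _ = (m.factorial * D₀ ^ m) * ‖jetOn (spherePts n r) k g‖ := by ring
    _ ≤ _ := mul_le_mul_of_nonneg_right (mul_le_mul h1 h2 h0 (by positivity)) h3

/-- The tensor product of smooth functions on the sphere. -/
def tensorAngular {r : ℕ} (χ : Fin r → Angular n) : SmoothFun n r :=
  ⟨fun p => ∏ i, ((χ i (p i : E n) : ℝ) : ℂ), by
    have h : ContDiffOn ℝ ∞ (fun x : Fin r → E n => ∏ i, ((χ i (x i) : ℝ) : ℂ)) (punctured n r) := by
      refine contDiffOn_prod fun i _ => Complex.ofRealCLM.contDiff.comp_contDiffOn ?_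
      exact (χ i).contDiffOn.comp (contDiff_apply ℝ (E n) i).contDiffOn fun x hx => hx i
    refine h.congr fun x hx => ?_
    have hx' : ∀ i, x i ≠ 0 := hx
    simp only [ext0, hx', ne_eq, not_false_eq_true, implies_true, dif_pos]
    exact Finset.prod_congr rfl fun i _ => by rw [← (χ i).apply_eq_normalize (hx' i)]⟩

/-- The restriction of a smooth function to the sphere, extended homogeneously. -/
def angRestrict (f : E n → ℝ) (hf : ContDiff ℝ ∞ f) : Angular n :=
  ⟨fun y => open Classical in if y = 0 then 0 else f (‖y‖⁻¹ • y), by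
    refine ⟨?_, fun t y ht => ?_, by simp⟩
    · have h : ContDiffOn ℝ ∞ (fun y : E n => f (‖y‖⁻¹ • y)) {y | y ≠ 0} := by
        have hid : ContDiffOn ℝ ∞ (fun y : E n => y) {y | y ≠ 0} := contDiffOn_id
        refine hf.comp_contDiffOn ?_
        exact ((hid.norm ℝ fun x hx => hx).inv fun x hx => norm_ne_zero_iff.2 hx).smul hid
      exact h.congr fun y hy => by simp [show y ≠ 0 from hy]
    · by_cases hy : y = 0
      · simp [hy]
      · have hty : t • y ≠ 0 := smul_ne_zero ht.ne' hy
        have ht' : ‖t • y‖⁻¹ • t • y = ‖y‖⁻¹ • y := by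
          rw [norm_smul, Real.norm_of_nonneg ht.le, smul_smul, mul_inv, mul_right_comm,
            inv_mul_cancel₀ ht.ne', one_mul]
        simp only [hy, hty, if_false, ht']⟩

theorem angRestrict_apply {f : E n → ℝ} (hf : ContDiff ℝ ∞ f) {y : E n} (hy : y ≠ 0) :
    angRestrict f hf y = f (‖y‖⁻¹ • y) := if_neg hy

theorem angRestrict_of_norm {f : E n → ℝ} (hf : ContDiff ℝ ∞ f) {y : E n} (hy : ‖y‖ = 1) :
    angRestrict f hf y = f y := by
  rw [angRestrict_apply hf (ne_zero_of_mem_shell (mem_shell_of_norm_eq_one hy)), hy, inv_one, one_smul]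

/-- There is a smooth compactly supported function that equals one on the sphere and vanishes near the
origin. -/
theorem exists_cutoff (n : ℕ) : ∃ θ : E n → ℝ, ContDiff ℝ ∞ θ ∧ (∀ y, ‖y‖ = 1 → θ y = 1) ∧
    (∀ᶠ y in 𝓝 0, θ y = 0) ∧ ∀ y, θ y ≠ 0 → ‖y‖ ≤ 3 := by
  let b₁ : ContDiffBump (0 : E n) := ⟨2, 3, by norm_num, by norm_num⟩
  let b₂ : ContDiffBump (0 : E n) := ⟨1 / 4, 1 / 2, by norm_num, by norm_num⟩
  refine ⟨fun y => b₁ y * (1 - b₂ y), b₁.contDiff.mul (contDiff_const.sub b₂.contDiff),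
    fun y hy => ?_, ?_, fun y hy => ?_⟩
  · beta_reduce
    rw [b₁.one_of_mem_closedBall (by simp [hy, b₁]), b₂.zero_of_le_dist (by simp [hy, b₂]; norm_num)]
    norm_num
  · filter_upwards [b₂.eventuallyEq_one] with y hy
    rw [hy]
    simp
  · have h1 : b₁ y ≠ 0 := left_ne_zero_of_mul hy
    by_contra h
    push Not at h
    exact h1 (b₁.zero_of_le_dist (by simpa [b₁] using h.le))

/-- A smooth function on a product of spheres is the restriction of a smooth compactly supported
function, whose support projects to the support of the given function. -/
theorem exists_smooth_extension {r : ℕ} (F : SmoothFun n r) :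
    ∃ f : smoothSubmodule (Fin r → E n), HasCompactSupport f.1 ∧ restrictSmooth n r f = F ∧
      ∀ t, f.1 t ≠ 0 → ∃ p : Fin r → Sph n, F p ≠ 0 ∧ ∀ i, (p i : E n) = ‖t i‖⁻¹ • t i := by
  obtain ⟨θ, hθ, hθ1, hθ0, hθ3⟩ := exists_cutoff n
  set f : (Fin r → E n) → ℂ := fun x => ((∏ i, θ (x i) : ℝ) : ℂ) * ext0 F x with hf
  have hθp : ContDiff ℝ ∞ fun x : Fin r → E n => ∏ i, θ (x i) :=
    contDiff_prod fun i _ => hθ.comp (contDiff_apply ℝ (E n) i)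
  have hprod : ContDiff ℝ ∞ fun x : Fin r → E n => ((∏ i, θ (x i) : ℝ) : ℂ) :=
    Complex.ofRealCLM.contDiff.comp hθp
  have hsm : ContDiff ℝ ∞ f := by
    rw [contDiff_iff_contDiffAt]
    intro x
    by_cases hx : x ∈ punctured n r
    · have hF : ContDiffOn ℝ ∞ (ext0 F) (punctured n r) := F.2
      exact hprod.contDiffAt.mul (hF.contDiffAt ((isOpen_punctured n r).mem_nhds hx))
    · have : ∃ i, x i = 0 := by
        by_contra h
        push Not at h
        exact hx h
      obtain ⟨i, hi⟩ := this
      have h0 : f =ᶠ[𝓝 x] fun _ => 0 := by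
        have hc : Tendsto (fun z : Fin r → E n => z i) (𝓝 x) (𝓝 0) := by
          have := (continuous_apply i : Continuous fun z : Fin r → E n => z i).tendsto x
          rwa [hi] at this
        filter_upwards [hc.eventually hθ0] with z hz
        rw [hf]
        beta_reduce
        rw [Finset.prod_eq_zero (Finset.mem_univ i) hz, Complex.ofReal_zero, zero_mul]
      exact contDiffAt_const.congr_of_eventuallyEq h0
  refine ⟨⟨f, hsm⟩, ?_, ?_, fun t ht => ?_⟩
  · refine HasCompactSupport.intro (isCompact_closedBall 0 3) fun x hx => ?_
    by_contra h
    have h1 := Complex.ofReal_ne_zero.1 (left_ne_zero_of_mul h)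
    refine hx (mem_closedBall_zero_iff.2 ((pi_norm_le_iff_of_nonneg (by norm_num)).2 fun i => ?_))
    exact hθ3 _ (Finset.prod_ne_zero_iff.1 h1 i (Finset.mem_univ i))
  · refine DFunLike.ext _ _ fun p => ?_
    have hp : ∀ i, ‖(p i : E n)‖ = 1 := fun i => mem_sphere_zero_iff_norm.1 (p i).2
    have hp0 : ∀ i, (p i : E n) ≠ 0 := fun i => ne_zero_of_mem_shell (mem_shell_of_norm_eq_one (hp i))
    change ((∏ i, θ (p i) : ℝ) : ℂ) * ext0 F (fun i => (p i : E n)) = F p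
    rw [Finset.prod_congr rfl fun i _ => hθ1 _ (hp i), Finset.prod_const_one, Complex.ofReal_one,
      one_mul, ext0, dif_pos hp0]
    congr 1
    funext i
    refine Subtype.ext ?_
    change ‖(p i : E n)‖⁻¹ • (p i : E n) = p i
    rw [hp i, inv_one, one_smul]
  · have h2 : ext0 F t ≠ 0 := right_ne_zero_of_mul ht
    rw [ext0] at h2
    split_ifs at h2 with h
    · exact ⟨_, h2, fun i => rfl⟩
    · exact absurd rfl h2

/-- A distribution that vanishes on the tensor products of functions supported near a point does not have
the corresponding diagonal point in its support. -/
theorem notMem_support_of_tensor {r : ℕ} (T : SphereDistribution n r) (u : Sph n) {δ : ℝ} (hδ : 0 < δ)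
    (hT : ∀ χ : Fin r → Angular n, (∀ i y, ‖y‖ = 1 → χ i y ≠ 0 → ‖y - u‖ ≤ 3 * δ) →
      T.toLin (tensorAngular χ) = 0) : (fun _ : Fin r => u) ∉ T.support := by
  rw [SphereDistribution.support, Distribution.notMem_dsupport_iff]
  refine ⟨{p | ∀ i, dist (p i) u < δ}, fun F hF => ?_, ?_, fun i => by simpa using hδ⟩
  swap
  · have : {p : Fin r → Sph n | ∀ i, dist (p i) u < δ} = ⋂ i, {p | dist (p i) u < δ} := by
      ext p; simp
    rw [this]
    exact isOpen_iInter_of_finite fun i =>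
      isOpen_lt ((continuous_apply i).dist continuous_const) continuous_const
  obtain ⟨f, hfs, hfF, hft⟩ := exists_smooth_extension F
  obtain ⟨k, C, hC⟩ := exists_bound_restrictSmooth T
  rw [← hfF]
  refine eq_zero_of_mollifier (μ := MeasureTheory.Measure.addHaar)
    (T.toLin.comp (restrictSmooth n r)) hC f hfs fun ε hε => ?_
  set ε' := min ε δ with hε'
  have hε'0 : 0 < ε' := lt_min hε hδ
  let β : ContDiffBump (0 : E n) := ⟨ε' / 2, ε', half_pos hε'0, half_lt_self hε'0⟩
  have hβ : ∀ y, β y ≠ 0 → ‖y‖ < ε' := fun y hy => by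
    by_contra h
    push Not at h
    exact hy (β.zero_of_le_dist (by simpa [β] using h))
  set b₀ : (Fin r → E n) → ℝ := fun x => ∏ i, β (x i) with hb₀
  have hb₀s : ContDiff ℝ ∞ b₀ := contDiff_prod fun i _ => β.contDiff.comp (contDiff_apply ℝ (E n) i)
  have hb₀0 : ∀ x, 0 ≤ b₀ x := fun x => Finset.prod_nonneg fun i _ => β.nonneg
  have hb₀ε : ∀ x, b₀ x ≠ 0 → ‖x‖ ≤ ε' := fun x hx =>
    (pi_norm_le_iff_of_nonneg hε'0.le).2 fun i =>
      (hβ _ (Finset.prod_ne_zero_iff.1 hx i (Finset.mem_univ i))).le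
  have hb₀c : HasCompactSupport b₀ :=
    HasCompactSupport.intro (isCompact_closedBall 0 ε') fun x hx => by
      by_contra h
      exact hx (mem_closedBall_zero_iff.2 (hb₀ε x h))
  have hI : 0 < ∫ x, b₀ x ∂(MeasureTheory.Measure.addHaar : MeasureTheory.Measure (Fin r → E n)) := by
    refine hb₀s.continuous.integral_pos_of_hasCompactSupport_nonneg_nonzero hb₀c hb₀0 (x := 0) ?_
    refine Finset.prod_ne_zero_iff.2 fun i _ => ?_
    rw [Pi.zero_apply, β.one_of_mem_closedBall (Metric.mem_closedBall_self β.rIn_pos.le)]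
    exact one_ne_zero
  set c := (∫ x, b₀ x ∂(MeasureTheory.Measure.addHaar : MeasureTheory.Measure (Fin r → E n)))⁻¹ with hc
  have hc0 : 0 < c := inv_pos.2 hI
  refine ⟨⟨fun x => ((c * b₀ x : ℝ) : ℂ), Complex.ofRealCLM.contDiff.comp (contDiff_const.mul hb₀s)⟩,
    fun x => c * b₀ x, fun x => rfl, hb₀c.mul_left, continuous_const.mul hb₀s.continuous,
    fun x => mul_nonneg hc0.le (hb₀0 x), ?_, fun x hx =>
      (hb₀ε x (right_ne_zero_of_mul hx)).trans (min_le_left _ _), fun t ht => ?_⟩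
  · rw [MeasureTheory.integral_const_mul, hc, inv_mul_cancel₀ hI.ne']
  -- the translated mollifiers restrict to tensor products
  set χ : Fin r → Angular n := fun i => angRestrict (fun y => β (y - t i))
    (β.contDiff.comp (contDiff_id.sub contDiff_const)) with hχ
  have hχT : T.toLin (tensorAngular χ) = 0 := by
    refine hT χ fun i y hy hne => ?_
    rw [hχ, angRestrict_of_norm _ hy] at hne
    have h1 : ‖y - t i‖ < ε' := hβ _ hne
    obtain ⟨p, hp, hpt⟩ := hft t ht
    have h2 : dist (p i) u < δ := hF (subset_tsupport _ hp) i
    rw [Subtype.dist_eq, dist_eq_norm, hpt] at h2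
    have h3 : ‖t i - ‖t i‖⁻¹ • t i‖ ≤ ‖y - t i‖ := by
      have ht0 : t i ≠ 0 := by
        intro h0
        have h4 := mem_sphere_zero_iff_norm.1 (p i).2
        rw [hpt, h0, smul_zero, norm_zero] at h4
        exact zero_ne_one h4
      have h5 : ‖t i‖ ≠ 0 := norm_ne_zero_iff.2 ht0
      have h6 : t i - ‖t i‖⁻¹ • t i = (1 - ‖t i‖⁻¹) • t i := by rw [sub_smul, one_smul]
      have h7 : ‖(1 - ‖t i‖⁻¹) • t i‖ = |‖t i‖ - 1| := by
        rw [norm_smul, Real.norm_eq_abs, ← abs_of_nonneg (norm_nonneg (t i)), ← abs_mul,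
          abs_of_nonneg (norm_nonneg (t i)), sub_mul, one_mul, inv_mul_cancel₀ h5]
      rw [h6, h7, ← hy, abs_sub_comm]
      exact abs_norm_sub_norm_le _ _
    have h8 : ε' ≤ δ := min_le_right _ _
    calc ‖y - u‖ = ‖(y - t i) + (t i - ‖t i‖⁻¹ • t i) + (‖t i‖⁻¹ • t i - u)‖ := by congr 1; abel
      _ ≤ ‖y - t i‖ + ‖t i - ‖t i‖⁻¹ • t i‖ + ‖‖t i‖⁻¹ • t i - u‖ := norm_add₃_le
      _ ≤ 3 * δ := by linarith
  have hres : restrictSmooth n r (translateSmooth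
      ⟨fun x => ((c * b₀ x : ℝ) : ℂ), Complex.ofRealCLM.contDiff.comp (contDiff_const.mul hb₀s)⟩ t) =
      (c : ℂ) • tensorAngular χ := by
    refine DFunLike.ext _ _ fun p => ?_
    change ((c * b₀ ((fun i => (p i : E n)) - t) : ℝ) : ℂ) = (c : ℂ) * ∏ i, ((χ i (p i : E n) : ℝ) : ℂ)
    rw [Complex.ofReal_mul, hb₀, Complex.ofReal_prod]
    congr 1
    refine Finset.prod_congr rfl fun i _ => ?_
    rw [hχ, angRestrict_of_norm _ (mem_sphere_zero_iff_norm.1 (p i).2), Pi.sub_apply]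
  rw [LinearMap.comp_apply, hres, map_smul, hχT, smul_zero]

/-! ### Smooth bodies with positive curvature -/

/-- The first two derivatives along a line avoiding the origin. -/
theorem hasDerivAt_line {f : E n → ℝ} (hf : ContDiffOn ℝ ∞ f {y | y ≠ 0}) {u v : E n}
    (h : ∀ t : ℝ, u + t • v ≠ 0) :
    (∀ t : ℝ, HasDerivAt (fun t : ℝ => f (u + t • v)) (fderiv ℝ f (u + t • v) v) t) ∧
      HasDerivAt (fun t : ℝ => fderiv ℝ f (u + t • v) v) (iteratedFDeriv ℝ 2 f u ![v, v]) 0 := by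
  have hl : ∀ t : ℝ, HasDerivAt (fun t : ℝ => u + t • v) v t := fun t => by
    simpa using ((hasDerivAt_id t).smul_const v).const_add u
  refine ⟨fun t => ?_, ?_⟩
  · have h1 : DifferentiableAt ℝ f (u + t • v) :=
      (hf.contDiffAt (Angular.isOpen_ne.mem_nhds (h t))).differentiableAt (by simp)
    exact h1.hasFDerivAt.comp_hasDerivAt t (hl t)
  · have hu : u + (0 : ℝ) • v = u := by simp
    have hu0 : u ≠ 0 := by simpa using h 0
    have h2 : ContDiffOn ℝ ∞ (fderiv ℝ f) {y | y ≠ 0} :=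
      hf.fderiv_of_isOpen Angular.isOpen_ne (by simp)
    have h1 : DifferentiableAt ℝ (fderiv ℝ f) (u + (0 : ℝ) • v) := by
      rw [hu]
      exact (h2.contDiffAt (Angular.isOpen_ne.mem_nhds hu0)).differentiableAt (by simp)
    have h3 : HasDerivAt (fun t : ℝ => fderiv ℝ f (u + t • v))
        (fderiv ℝ (fderiv ℝ f) (u + (0 : ℝ) • v) v) 0 := h1.hasFDerivAt.comp_hasDerivAt (0 : ℝ) (hl 0)
    have h4 := (ContinuousLinearMap.apply ℝ ℝ v).hasFDerivAt.comp_hasDerivAt (0 : ℝ) h3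
    rw [hu] at h4
    rw [iteratedFDeriv_two_apply]
    exact h4

theorem line_ne_zero {u v : E n} (hu : ‖u‖ = 1) (huv : ⟪u, v⟫ = 0) (t : ℝ) : u + t • v ≠ 0 := by
  intro h
  have h1 : ⟪u, u + t • v⟫ = 1 := by
    rw [inner_add_right, inner_smul_right, huv, real_inner_self_eq_norm_sq, hu]
    norm_num
  rw [h, inner_zero_right] at h1
  exact zero_ne_one h1

theorem iteratedFDeriv_two_nonneg {f : E n → ℝ} (hf : ContDiffOn ℝ ∞ f {y | y ≠ 0})
    (hc : ConvexOn ℝ univ f) {u v : E n} (h : ∀ t : ℝ, u + t • v ≠ 0) :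
    0 ≤ iteratedFDeriv ℝ 2 f u ![v, v] := by
  obtain ⟨h1, h2⟩ := hasDerivAt_line hf h
  have hconv : ConvexOn ℝ univ fun t : ℝ => f (u + t • v) := by
    refine ⟨convex_univ, fun s _ t _ a b ha hb hab => ?_⟩
    have h3 := hc.2 (mem_univ (u + s • v)) (mem_univ (u + t • v)) ha hb hab
    have h4 : a • (u + s • v) + b • (u + t • v) = u + (a • s + b • t) • v := by
      have : u = (a + b) • u := by rw [hab, one_smul]
      nth_rewrite 3 [this]
      module
    rwa [h4] at h3
  have hd : deriv (fun t : ℝ => f (u + t • v)) = fun t : ℝ => fderiv ℝ f (u + t • v) v :=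
    funext fun t => (h1 t).deriv
  have hm : Monotone fun t : ℝ => fderiv ℝ f (u + t • v) v := by
    rw [← hd, ← monotoneOn_univ]
    exact hconv.monotoneOn_deriv fun t _ => (h1 t).differentiableAt
  rw [← h2.deriv]
  exact hm.deriv_nonneg

theorem iteratedFDeriv_two_norm_pos {u v : E n} (hu : ‖u‖ = 1) (huv : ⟪u, v⟫ = 0) (hv : v ≠ 0) :
    0 < iteratedFDeriv ℝ 2 (fun y : E n => ‖y‖) u ![v, v] := by
  have hid : ContDiffOn ℝ ∞ (fun y : E n => y) {y | y ≠ 0} := contDiffOn_id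
  obtain ⟨h1, h2⟩ := hasDerivAt_line (hid.norm ℝ fun x hx => hx) (line_ne_zero hu huv)
  set G : ℝ → ℝ := fun t => fderiv ℝ (fun y : E n => ‖y‖) (u + t • v) v with hG
  -- both sides are derivatives of `‖u + t v‖² = 1 + t² ‖v‖²`
  have h3 : ∀ t : ℝ, 2 * (‖u + t • v‖ * G t) = 2 * t * ‖v‖ ^ 2 := by
    intro t
    have e : (fun t : ℝ => ‖u + t • v‖ ^ 2) = fun t => 1 + t ^ 2 * ‖v‖ ^ 2 := by
      funext t
      rw [norm_add_sq_real, inner_smul_right, huv, hu, norm_smul, mul_pow, Real.norm_eq_abs, sq_abs]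
      ring
    have h4 := (h1 t).pow 2
    have h5 : HasDerivAt (fun t : ℝ => 1 + t ^ 2 * ‖v‖ ^ 2) (2 * t * ‖v‖ ^ 2) t := by
      simpa using (((hasDerivAt_id t).pow 2).mul_const (‖v‖ ^ 2)).const_add 1
    have h6 : HasDerivAt (fun t : ℝ => ‖u + t • v‖ ^ 2) _ t := h4
    rw [e] at h6
    rw [← h6.unique h5]
    simp only [hG]
    push_cast
    ring
  have hu1 : ‖u + (0 : ℝ) • v‖ = 1 := by simp [hu]
  have hG0 : G 0 = 0 := by
    have := h3 0
    rw [hu1] at this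
    linarith
  have h7 : HasDerivAt (fun t : ℝ => ‖u + t • v‖ * G t) _ 0 := (h1 0).mul h2
  have h8 : HasDerivAt (fun t : ℝ => ‖u + t • v‖ * G t) (‖v‖ ^ 2) 0 := by
    have e : (fun t : ℝ => ‖u + t • v‖ * G t) = fun t => t * ‖v‖ ^ 2 := by
      funext t
      linarith [h3 t]
    rw [e]
    simpa using (hasDerivAt_id (0 : ℝ)).mul_const (‖v‖ ^ 2)
  have h9 := h7.unique h8
  rw [hG0, hu1, mul_zero, zero_add, one_mul] at h9
  rw [h9]
  have := norm_pos_iff.2 hv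
  positivity

/-- Adding a ball to a body with smooth support function makes the principal radii of curvature
positive. -/
theorem isSmoothPositivelyCurved_add_unitBall {P : Body n}
    (hP : ContDiffOn ℝ ∞ (supportFun P) {y | y ≠ 0}) : IsSmoothPositivelyCurved (P + unitBall n) := by
  have hid : ContDiffOn ℝ ∞ (fun y : E n => y) {y | y ≠ 0} := contDiffOn_id
  have hnorm : ContDiffOn ℝ ∞ (fun y : E n => ‖y‖) {y | y ≠ 0} := hid.norm ℝ fun x hx => hx
  have h : supportFun (P + unitBall n) = supportFun P + fun y => ‖y‖ := by
    rw [supportFun_add]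
    exact congrArg _ (funext supportFun_unitBall)
  refine ⟨by rw [h]; exact hP.add hnorm, fun u v hu huv hv => ?_⟩
  have hu0 : u ≠ 0 := ne_zero_of_mem_shell (mem_shell_of_norm_eq_one hu)
  have hn := Angular.isOpen_ne.mem_nhds hu0
  have h2 : ((2 : ℕ) : ℕ∞ω) ≤ ∞ := WithTop.coe_le_coe.2 le_top
  rw [h, iteratedFDeriv_add_apply ((hP.contDiffAt hn).of_le h2)
    ((hnorm.contDiffAt hn).of_le h2), add_apply]
  exact add_pos_of_nonneg_of_pos
    (iteratedFDeriv_two_nonneg hP (convexOn_supportFun P) (line_ne_zero hu huv))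
    (iteratedFDeriv_two_norm_pos hu huv hv)

/-- A smooth function on the sphere is a difference of support functions of smooth bodies with positive
curvature. -/
theorem exists_angMul_unitBall (χ : Angular n) : ∃ P Q : Body n, IsSmoothPositivelyCurved P ∧
    IsSmoothPositivelyCurved Q ∧ angMul χ (dcOf (unitBall n)) = dcOf P - dcOf Q := by
  have hid : ContDiffOn ℝ ∞ (fun y : E n => y) {y | y ≠ 0} := contDiffOn_id
  have hnorm : ContDiffOn ℝ ∞ (fun y : E n => ‖y‖) {y | y ≠ 0} := hid.norm ℝ fun x hx => hx
  have hN := norm_nonneg χ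
  obtain ⟨P, hP⟩ := exists_supportFun_mul χ le_rfl (K := unitBall n) (R := 1) fun x hx => by
    simpa using (show x ∈ Metric.closedBall (0 : E n) 1 from hx)
  have hQ : ∀ y, supportFun ((11 * ‖χ‖) • unitBall n) y = 11 * ‖χ‖ * ‖y‖ := fun y => by
    rw [supportFun_smul (by positivity), Pi.smul_apply, supportFun_unitBall, smul_eq_mul]
  refine ⟨P + unitBall n, (11 * ‖χ‖) • unitBall n + unitBall n,
    isSmoothPositivelyCurved_add_unitBall ?_, isSmoothPositivelyCurved_add_unitBall ?_,
    Subtype.ext (funext fun y => ?_)⟩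
  · rw [funext hP]
    simp only [supportFun_unitBall]
    exact ((χ.contDiffOn.mul hnorm).add (contDiffOn_const.mul hnorm)).add
      (contDiffOn_const.mul hnorm)
  · rw [funext hQ]
    exact contDiffOn_const.mul hnorm
  · rw [dcOf_add, dcOf_add]
    change χ y * supportFun (unitBall n) y = supportFun P y + _ - (supportFun _ y + _)
    rw [hP, hQ, supportFun_unitBall]
    ring

/-- The condition that characterizes the Goodey–Weil distribution determines it on all tensor products of
smooth functions, because these are combinations of tensor products of support functions. -/
theorem toLin_tensorAngular {r : ℕ} (T : SphereDistribution n r)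
    (C : MultilinearMap ℝ≥0 (fun _ : Fin r => Body n) ℂ)
    (hT : ∀ (K : Fin r → Body n) (hK : ∀ i, IsSmoothPositivelyCurved (K i)),
      T.toLin (tensorSupport K hK) = C K) (χ : Fin r → Angular n) :
    T.toLin (tensorAngular χ) = extMulti C fun i => angMul (χ i) (dcOf (unitBall n)) := by
  choose P Q hP hQ hPQ using fun i => exists_angMul_unitBall (χ i)
  have hs : ∀ (s : Finset (Fin r)) i, IsSmoothPositivelyCurved (s.piecewise Q P i) := fun s i => by
    by_cases hi : i ∈ s
    · rw [Finset.piecewise_eq_of_mem _ _ _ hi]; exact hQ i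
    · rw [Finset.piecewise_eq_of_notMem _ _ _ hi]; exact hP i
  have h : tensorAngular χ = ∑ s : Finset (Fin r), (-1 : ℂ) ^ s.card •
      tensorSupport (s.piecewise Q P) (hs s) := by
    refine Subtype.ext ?_
    rw [AddSubmonoidClass.coe_finsetSum]
    funext p
    rw [Finset.sum_apply]
    change ∏ i, ((χ i (p i : E n) : ℝ) : ℂ) =
      ∑ s : Finset (Fin r), (-1 : ℂ) ^ s.card * ∏ i, ((supportFun (s.piecewise Q P i) (p i) : ℝ) : ℂ)
    have h1 : ∀ i, ((χ i (p i : E n) : ℝ) : ℂ) =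
        ((supportFun (P i) (p i) : ℝ) : ℂ) - ((supportFun (Q i) (p i) : ℝ) : ℂ) := fun i => by
      have h2 := congrFun (congrArg Subtype.val (hPQ i)) (p i : E n)
      have h3 : χ i (p i : E n) * supportFun (unitBall n) (p i) =
        supportFun (P i) (p i) - supportFun (Q i) (p i) := h2
      rw [supportFun_unitBall, mem_sphere_zero_iff_norm.1 (p i).2, mul_one] at h3
      rw [h3, Complex.ofReal_sub]
    rw [Finset.prod_congr rfl fun i _ => h1 i, Finset.prod_sub, Finset.powerset_univ]
    refine Finset.sum_congr rfl fun s _ => ?_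
    have h2 : ∀ i, ((supportFun (s.piecewise Q P i) (p i) : ℝ) : ℂ) =
        s.piecewise (fun i => ((supportFun (Q i) (p i) : ℝ) : ℂ))
          (fun i => ((supportFun (P i) (p i) : ℝ) : ℂ)) i := fun i => by
      by_cases hi : i ∈ s <;> simp [hi]
    rw [Finset.prod_congr rfl fun i _ => h2 i, Finset.prod_piecewise, Finset.univ_inter]
    ring
  rw [h, map_sum, funext hPQ, extMulti_sub]
  refine Finset.sum_congr rfl fun s _ => ?_
  rw [map_smul, hT, smul_eq_mul]

/-! ### The vertical support of a localized valuation -/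

/-- The diagonal of the polarization of a localized valuation, on differences of support functions. -/
theorem extMulti_diag_eq {r : ℕ} (B C : MultilinearMap ℝ≥0 (fun _ : Fin r => Body n) ℂ)
    (χ : Fin r → Angular n) (h : ∀ K : Body n, (C fun _ => K) = angVal B χ K) (v : dcSpace n) :
    (extMulti C fun _ => v) = extMulti B fun i => angMul (χ i) v := by
  obtain ⟨p, hp⟩ := exists_polynomial_line (extMulti C) (fun _ => dcOf (dcPos v))
    fun _ => dcOf (dcNeg v)
  obtain ⟨q, hq⟩ := exists_polynomial_line (extMulti B) (fun i => angMul (χ i) (dcOf (dcPos v)))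
    fun i => angMul (χ i) (dcOf (dcNeg v))
  -- the two polynomials agree for `t ≥ 0`, where `P + tQ` is a convex body, and `v = P - Q`
  have hpq : p = q := by
    refine polynomial_eq_of_eval_nonneg fun t ht => ?_
    have hd : dcOf (dcPos v + t • dcNeg v) = dcOf (dcPos v) + t • dcOf (dcNeg v) := by
      rw [dcOf_add]
      exact congrArg _ (Subtype.ext (supportFun_smul ht _))
    have := h (dcPos v + t • dcNeg v)
    rw [← extMulti_dcOf, angVal, hd] at this
    rw [hp, hq, this]
    simp only [map_add, map_smul]
  have h1 := hp (-1)
  have h2 := hq (-1)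
  rw [hpq, h2] at h1
  have hv : dcOf (dcPos v) + (-1 : ℝ) • dcOf (dcNeg v) = v := by
    conv_rhs => rw [← dcOf_pos_sub_neg v]
    module
  simp only [← map_smul, ← map_add, hv] at h1
  exact h1.symm

/-- Let `C` be the polarization of `K ↦ B(χ₁ h_K, …, χ_r h_K)`. Then `C` vanishes at functions that are
all annihilated by a single multiplier `χⱼ`: by the polarization formula only diagonal values of `C` enter,
and in these the argument `j` of `B` is zero. -/
theorem extMulti_eq_zero {r : ℕ} (B C : MultilinearMap ℝ≥0 (fun _ : Fin r => Body n) ℂ)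
    (hC : ∀ (σ : Equiv.Perm (Fin r)) (K : Fin r → Body n), C (K ∘ σ) = C K)
    (χ : Fin r → Angular n) (h : ∀ K : Body n, (C fun _ => K) = angVal B χ K) {j : Fin r}
    {v : Fin r → dcSpace n} (hv : ∀ i, angMul (χ j) (v i) = 0) : extMulti C v = 0 := by
  rw [polarization_formula (extMulti C) (extMulti_symm C hC) v, Finset.sum_eq_zero, mul_zero]
  intro I _
  rw [extMulti_diag_eq B C χ h, MultilinearMap.map_coord_zero _ j, mul_zero]
  rw [map_sum]
  exact Finset.sum_eq_zero fun i _ => hv i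

/-- The vertical support of a localized valuation is contained in the support of each of the
multipliers. -/
theorem vsuppHom_subset_closure {r : ℕ} (B : MultilinearMap ℝ≥0 (fun _ : Fin r => Body n) ℂ)
    (hBs : ∀ (σ : Equiv.Perm (Fin r)) (K : Fin r → Body n), B (K ∘ σ) = B K)
    (hB : IsValuation fun K => B fun _ => K) (χ : Fin r → Angular n) {ψ : C(Body n, ℂ)}
    (hψ : ∀ K, ψ K = angVal B χ K) (j : Fin r) :
    vsuppHom r ψ ⊆ closure {p : Sph n | χ j p ≠ 0} := by
  intro u hu
  by_contra hcl
  obtain ⟨ε, hε, hball⟩ := Metric.isOpen_iff.1 isClosed_closure.isOpen_compl u hcl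
  have hδ : 0 < ε / 4 := by positivity
  refine notMem_support_of_tensor (goodeyWeil r ψ) u hδ (fun η hη => ?_) hu
  by_cases hex : ∃ T : SphereDistribution n r, IsGoodeyWeil ψ T
  swap
  · rw [goodeyWeil, dif_neg hex]
    rfl
  rw [goodeyWeil, dif_pos hex]
  obtain ⟨B', hB', hT⟩ := hex.choose_spec
  have hψp : IsPolynomialValuationOfDegree r ψ := by
    rw [show (ψ : Body n → ℂ) = angVal B χ from funext hψ]
    exact isPolynomialValuationOfDegree_angVal B hBs hB χ
  have hψh : IsHomogeneous r ψ := by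
    rw [show (ψ : Body n → ℂ) = angVal B χ from funext hψ]
    exact isHomogeneous_angVal B χ
  let ψ' : dilPolySpace n (2 * n + (r + 1)) :=
    ⟨ψ, dilPoly_of_isValuation ψ hψp.1 hψp.transDegLT⟩
  let C := polar (2 * n + (r + 1)) r ψ'
  have hC : ∀ K : Body n, (C fun _ => K) = ψ K := polar_diag (by omega) ψ' hψh
  have hpol : IsPolarization ψ C := by
    have := isPolarization_of_multilinear C (continuous_polar _ r ψ') (polar_symm _ r ψ')
    rwa [show (fun K : Body n => C fun _ => K) = ψ from funext hC] at this
  have hBC : B' = C := hB'.unique hpol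
  rw [toLin_tensorAngular _ C (fun K hK => by rw [hT K hK, hBC])]
  refine extMulti_eq_zero B C (polar_symm _ r ψ') χ (fun K => (hC K).trans (hψ K)) (j := j)
    fun i => Subtype.ext (funext fun y => ?_)
  change χ j y * (η i y * supportFun (unitBall n) y) = 0
  rcases eq_or_ne y 0 with rfl | hy
  · rw [Angular.apply_zero, zero_mul]
  by_cases hηy : η i y = 0
  · rw [hηy, zero_mul, mul_zero]
  have hmem : ‖y‖⁻¹ • y ∈ Metric.sphere (0 : E n) 1 := mem_sphere_zero_iff_norm.2 (norm_normalize hy)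
  have h1 := hη i _ (norm_normalize hy) (by rwa [← Angular.apply_eq_normalize _ hy])
  have h2 : (⟨‖y‖⁻¹ • y, hmem⟩ : Sph n) ∈ Metric.ball u ε := by
    rw [Metric.mem_ball, Subtype.dist_eq, dist_eq_norm]
    change ‖‖y‖⁻¹ • y - (u : E n)‖ < ε
    linarith
  have h3 : χ j y = 0 := by
    by_contra hne
    rw [Angular.apply_eq_normalize _ hy] at hne
    exact hball h2 (subset_closure hne)
  rw [h3, zero_mul]

/-- The zero functional is localized with all multipliers zero. -/
theorem vsuppHom_zero {r : ℕ} (hr : 1 ≤ r) : vsuppHom r ((0 : C(Body n, ℂ)) : Body n → ℂ) = ∅ := by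
  have h := vsuppHom_subset_closure (0 : MultilinearMap ℝ≥0 (fun _ : Fin r => Body n) ℂ)
    (fun _ _ => rfl) (fun _ _ _ _ _ _ => rfl) (fun _ => 0) (ψ := 0) (fun K => by
      rw [angVal, extMulti_apply]
      simp) ⟨0, hr⟩
  refine subset_empty_iff.1 (h.trans ?_)
  have : {p : Sph n | (0 : Angular n) p ≠ 0} = ∅ := by
    ext p
    exact iff_of_false (fun h => h rfl) (notMem_empty p)
  rw [this, closure_empty]

/-- A homogeneous functional is its only homogeneous component, so that only its own Goodey–Weil
distribution contributes. -/
theorem vsupp_subset_vsuppHom {ψ : C(Body n, ℂ)} (hψ : IsPolynomialValuation ψ) {r : ℕ}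
    (hr : IsHomogeneous r ψ) : vsupp ψ ⊆ ⋃ _ : 1 ≤ r, vsuppHom r ψ := by
  refine iUnion₂_subset fun s hs => ?_
  rw [homComponent_of_isHomogeneous hψ hr]
  split_ifs with h
  · subst h
    exact subset_iUnion_of_subset hs Subset.rfl
  · rw [vsuppHom_zero hs]
    exact empty_subset _

/-! ### Partitions of unity and the decomposition -/

/-- A smooth partition of unity on the sphere, subordinate to an open cover. -/
theorem exists_angular_partition {ι : Type*} (U : ι → Set (Sph n)) (hUopen : ∀ α, IsOpen (U α))
    (hUcover : ⋃ α, U α = univ) : ∃ (M : ℕ) (a : Fin M → ι) (χ : Fin M → Angular n),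
      (∀ y, y ≠ 0 → ∑ j, χ j y = 1) ∧ ∀ j, closure {p : Sph n | χ j p ≠ 0} ⊆ U (a j) := by
  obtain ⟨t, ht⟩ := isCompact_univ.elim_finite_subcover U hUopen hUcover.ge
  choose V hVo hV using fun α => isOpen_induced_iff.1 (hUopen α)
  set a : Fin t.card → ι := fun j => (t.equivFin.symm j : ι) with ha
  have hcov : Metric.sphere (0 : E n) 1 ⊆ ⋃ j, V (a j) := by
    intro y hy
    obtain ⟨α, hα, hyα⟩ := mem_iUnion₂.1 (ht (mem_univ (⟨y, hy⟩ : Sph n)))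
    refine mem_iUnion.2 ⟨t.equivFin ⟨α, hα⟩, ?_⟩
    rw [← hV α] at hyα
    have h : a (t.equivFin ⟨α, hα⟩) = α := by
      simp only [ha, Equiv.symm_apply_apply]
    rw [h]
    exact hyα
  obtain ⟨f, hf⟩ := SmoothPartitionOfUnity.exists_isSubordinate 𝓘(ℝ, E n)
    Metric.isClosed_sphere (fun j => V (a j)) (fun j => hVo _) hcov
  have hfs : ∀ j, ContDiff ℝ ∞ (f j) := fun j => (f j).contMDiff.contDiff
  refine ⟨t.card, a, fun j => angRestrict (f j) (hfs j), fun y hy => ?_, fun j => ?_⟩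
  · have h1 := f.sum_eq_one (mem_sphere_zero_iff_norm.2 (norm_normalize hy))
    rw [finsum_eq_sum_of_fintype] at h1
    exact (Finset.sum_congr rfl fun j _ => angRestrict_apply (hfs j) hy).trans h1
  · have h1 : IsClosed (Subtype.val ⁻¹' tsupport (f j) : Set (Sph n)) :=
      (isClosed_tsupport _).preimage continuous_subtype_val
    have h2 : {p : Sph n | angRestrict (f j) (hfs j) p ≠ 0} ⊆ Subtype.val ⁻¹' tsupport (f j) := by
      intro p hp
      have hp' : angRestrict (f j) (hfs j) p ≠ 0 := hp
      rw [angRestrict_of_norm _ (mem_sphere_zero_iff_norm.1 p.2)] at hp'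
      exact subset_tsupport _ hp'
    refine (closure_minimal h2 h1).trans ?_
    rw [← hV (a j)]
    exact preimage_mono (hf j)

end ConvVal

end

theorem theoremB {n : ℕ} (hn : 1 ≤ n) (φ : C(ConvVal.Body n, ℂ))
    (hφ : ConvVal.IsPolynomialValuation φ) {ι : Type*} (U : ι → Set (ConvVal.Sph n))
    (hUopen : ∀ α, IsOpen (U α)) (hUcover : ⋃ α, U α = Set.univ) :
    ∃ (M : ℕ) (ψ : Fin M → C(ConvVal.Body n, ℂ)), 1 ≤ M ∧
      (∀ j, ConvVal.IsPolynomialValuation (ψ j)) ∧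
      (∀ j, ∃ α, ConvVal.vsupp (ψ j) ⊆ U α) ∧
      φ = ∑ j, ψ j ∧
      (ConvVal.IsGLSmooth φ → ∀ j, ConvVal.IsGLSmooth (ψ j)) := by
  open ConvVal in
  obtain ⟨d, hd⟩ := hφ
  obtain ⟨M, a, χ, hχ, hχU⟩ := exists_angular_partition U hUopen hUcover
  set D := 2 * n + (d + 1) with hD
  have hφD : DilPoly D φ := dilPoly_of_isValuation φ hd.1 hd.transDegLT
  have hp : ∀ r, IsPolynomialValuationOfDegree d (homPart D φ r) :=
    isPolynomialValuationOfDegree_homPart hd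
  let φ' : ℕ → dilPolySpace n D := fun r =>
    ⟨homPart D φ r, dilPoly_of_isValuation _ (hp r).1 (hp r).transDegLT⟩
  have hB : ∀ r : Fin (D + 1), ∀ K, homPart D φ r K = polar D r (φ' r) fun _ => K := fun r K =>
    (polar_diag (Nat.le_of_lt_succ r.2) (φ' r) (isHomogeneous_homPart hφD r) K).symm
  have hBv : ∀ r : Fin (D + 1), IsValuation fun K => polar D r (φ' r) fun _ => K := fun r => by
    rw [← funext (hB r)]
    exact (hp r).1
  -- The summands are indexed by a degree `r` and the choice of one of the functions `χ₁, …, χ_M` for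
  -- each of the `r` arguments of the polarization.
  let Ψ : (Σ r : Fin (D + 1), Fin r → Fin M) → C(Body n, ℂ) := fun q =>
    ⟨angVal (polar D q.1 (φ' q.1)) fun i => χ (q.2 i),
      continuous_angVal _ (polar_symm D q.1 (φ' q.1)) (continuous_polar D q.1 (φ' q.1)) _⟩
  have hΨ : ∀ q, IsPolynomialValuationOfDegree q.1 (Ψ q) := fun q =>
    isPolynomialValuationOfDegree_angVal _ (polar_symm D q.1 (φ' q.1)) (hBv q.1) _
  have hΨh : ∀ q, IsHomogeneous q.1 (Ψ q) := fun q =>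
    isHomogeneous_angVal (polar D q.1 (φ' q.1)) fun i => χ (q.2 i)
  let e := Fintype.equivFin (Σ r : Fin (D + 1), Fin r → Fin M)
  refine ⟨_, fun j => Ψ (e.symm j), ?_, fun j => ⟨_, hΨ _⟩, fun j => ?_, ?_, fun hsm j => ?_⟩
  · -- the component of degree zero contributes the empty multi-index
    exact Fintype.card_pos_iff.2 ⟨⟨0, fun i => absurd i.2 (by simp)⟩⟩
  · beta_reduce
    generalize e.symm j = q
    have hsub := vsupp_subset_vsuppHom ⟨_, hΨ q⟩ (hΨh q)
    rcases Nat.eq_zero_or_pos q.1 with h0 | h0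
    · -- an element of the cover exists, because the sphere is nonempty
      have hx : EuclideanSpace.single (⟨0, hn⟩ : Fin n) (1 : ℝ) ∈ Metric.sphere (0 : E n) 1 := by
        simp
      obtain ⟨α, -⟩ := Set.mem_iUnion.1 (hUcover.ge (Set.mem_univ (⟨_, hx⟩ : Sph n)))
      refine ⟨α, hsub.trans (Set.iUnion_subset fun h => ?_)⟩
      omega
    · refine ⟨a (q.2 ⟨0, h0⟩), hsub.trans (Set.iUnion_subset fun _ => ?_)⟩
      exact (vsuppHom_subset_closure _ (polar_symm D q.1 (φ' q.1)) (hBv q.1) _ (fun K => rfl)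
        ⟨0, h0⟩).trans (hχU _)
  · rw [Equiv.sum_comp e.symm Ψ, Fintype.sum_sigma]
    refine (sum_homPart hφD).trans ?_
    rw [Finset.sum_range]
    refine Finset.sum_congr rfl fun r _ => ContinuousMap.ext fun K => ?_
    rw [hB, ← sum_angVal _ χ hχ K, ContinuousMap.sum_apply]
    rfl
  · beta_reduce
    generalize e.symm j = q
    exact isGLSmooth_angVal (polar D q.1 (φ' q.1)) (polar_symm D q.1 (φ' q.1)) (hB q.1)
      (isGLSmooth_homPart hsm D q.1) (fun i => χ (q.2 i)) (ψ := Ψ q) fun K => rfl
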